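/- We work in the word-RAM model with logarithmic word size: for a problem of size $n$ a machine word has $w$ bits, where $n<2^w$ and $w\le\kappa(\lfloor\log_2 n\rfloor+1)$ for a constant $\kappa$; arithmetic, bitwise operations, shifts, comparisons and memory accesses on words cost one step each. Space is the number of machine words that a data structure occupies, and time is deterministic worst-case. A weighted tree is a rooted tree whose nodes carry non-negative integer weights such that every node other than the root has a larger weight than its parent; weights fit into one machine word. Every node counts as an ancestor of itself. The predecessor of a number $d$ in a set of nodes is the node of the set of largest weight at most $d$; if there is none, a search reports this. (1) Consider a weighted tree on $n$ nodes, some of which are marked, such that every path from a leaf to the root contains $\mathcal{O}(\log n)$ marked nodes, that is, at most $C(\lfloor\log_2 n\rfloor+1)$ for a constant $C$. It can be preprocessed into a data structure of $\mathcal{O}(n)$ words such that, given any node $v$ and any one-word number $d$, the predecessor of $d$ among the marked ancestors of $v$ is found in $\mathcal{O}(1)$ time. The constants and the query program depend only on $C$ and $\kappa$. (2) Let $\mathrm{pred}(m,U)\ge 1$ be nondecreasing in $m$, and suppose that static predecessor search has a linear space solution with this query time: on machines whose word size is logarithmic (with constant $\kappa$) in some $N\geq m$, and for $U\le 2^w$,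 any $m\ge 1$ distinct integers from $[0,U)$ can be stored in $\mathcal{O}(m)$ words so that the position in sorted order of the predecessor of any number in $[0,U)$ is found in $\mathcal{O}(\mathrm{pred}(m,U))$ time. Then weighted ancestor queries (given a node $v$ and a one-word number $d$, find the predecessor of $d$ among all ancestors of $v$) in an arbitrary weighted tree on $n$ nodes with weights from $[0,U)$ can be answered in $\mathcal{O}(\mathrm{pred}(n,U))$ time, without an additive $\mathcal{O}(\log^* n)$ term, by a data structure of $\mathcal{O}(n)$ words. -/

import Mathlib

/-! ## The word RAM

Words are bit strings of length `w`.  The machine has registers `0, 1, 2, …`, each holding one word,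
and a memory made of arrays of words.  A cell is addressed by an array, which is named in the
instruction, and an index, which is the content of a register.  A program is a fixed finite piece of
code that does not depend on the input or on the word size. -/

namespace WordRAM

/-- The unit-cost operations on words: arithmetic modulo `2 ^ w`, unsigned division with remainder,
bitwise operations and logical shifts. -/
inductive BinOp where
  | add | sub | mul | div | mod | and | or | xor | shl | shr

def BinOp.eval {w : ℕ} : BinOp → BitVec w → BitVec w → BitVec w
  | .add, x, y => x + y
  | .sub, x, y => x - y
  | .mul, x, y => x * y
  | .div, x, y => x / y
  | .mod, x, y => x % y
  | .and, x, y => x &&& y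
  | .or, x, y => x ||| y
  | .xor, x, y => x ^^^ y
  | .shl, x, y => x <<< y
  | .shr, x, y => x >>> y

/-- Tests between the contents of two registers (unsigned comparison). -/
inductive Test where
  | eq (a b : ℕ)
  | lt (a b : ℕ)

/-- Programs. The natural number arguments `r a b` name registers, and `seg` names an array. -/
inductive Prog where
  | skip
  /-- `r := k` (modulo `2 ^ w`) -/
  | const (r k : ℕ)
  /-- `r := a` -/
  | copy (r a : ℕ)
  /-- `r := a op b` -/
  | op (o : BinOp) (r a b : ℕ)
  /-- `r := seg[a]` -/
  | load (r seg a : ℕ)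
  /-- `seg[a] := r` -/
  | store (seg a r : ℕ)
  | seq (p q : Prog)
  | ite (b : Test) (p q : Prog)
  | loop (b : Test) (p : Prog)

/-- The memory: a list of arrays of words. -/
abbrev Memory (w : ℕ) := List (List (BitVec w))

/-- The space occupied: the total number of words. -/
def Memory.size {w : ℕ} (m : Memory w) : ℕ := (m.map List.length).sum

/-- The array named `seg`. -/
def Memory.array {w : ℕ} (m : Memory w) (seg : ℕ) : List (BitVec w) := m.getD seg []

structure State (w : ℕ) where
  regs : ℕ → BitVec w
  mem : Memory w

def State.setReg {w : ℕ} (s : State w) (r : ℕ) (x : BitVec w) : State w :=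
  { s with regs := Function.update s.regs r x }

def State.setCell {w : ℕ} (s : State w) (seg i : ℕ) (x : BitVec w) : State w :=
  { s with mem := s.mem.set seg ((s.mem.array seg).set i x) }

def Test.holds {w : ℕ} (s : State w) : Test → Prop
  | .eq a b => s.regs a = s.regs b
  | .lt a b => s.regs a < s.regs b

/-- `Exec p s s' t`: started in `s`, the program `p` halts in `s'` after `t` steps. Every basic
instruction and every test costs one step. A memory access outside the allocated cells is an error:
such a run does not halt. -/
inductive Exec {w : ℕ} : Prog → State w → State w → ℕ → Prop
  | skip (s : State w) : Exec .skip s s 0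
  | const (s : State w) (r k : ℕ) : Exec (.const r k) s (s.setReg r (BitVec.ofNat w k)) 1
  | copy (s : State w) (r a : ℕ) : Exec (.copy r a) s (s.setReg r (s.regs a)) 1
  | op (s : State w) (o : BinOp) (r a b : ℕ) :
      Exec (.op o r a b) s (s.setReg r (o.eval (s.regs a) (s.regs b))) 1
  | load (s : State w) (r seg a : ℕ) (x : BitVec w)
      (h : (s.mem.array seg)[(s.regs a).toNat]? = some x) :
      Exec (.load r seg a) s (s.setReg r x) 1
  | store (s : State w) (seg a r : ℕ) (h : (s.regs a).toNat < (s.mem.array seg).length) :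
      Exec (.store seg a r) s (s.setCell seg (s.regs a).toNat (s.regs r)) 1
  | seq (p q : Prog) (s s₁ s₂ : State w) (t₁ t₂ : ℕ) (h₁ : Exec p s s₁ t₁)
      (h₂ : Exec q s₁ s₂ t₂) : Exec (.seq p q) s s₂ (t₁ + t₂)
  | ite_true (b : Test) (p q : Prog) (s s₁ : State w) (t : ℕ) (hb : b.holds s)
      (h : Exec p s s₁ t) : Exec (.ite b p q) s s₁ (t + 1)
  | ite_false (b : Test) (p q : Prog) (s s₁ : State w) (t : ℕ) (hb : ¬ b.holds s)
      (h : Exec q s s₁ t) : Exec (.ite b p q) s s₁ (t + 1)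
  | loop_true (b : Test) (p : Prog) (s s₁ s₂ : State w) (t₁ t₂ : ℕ) (hb : b.holds s)
      (h₁ : Exec p s s₁ t₁) (h₂ : Exec (.loop b p) s₁ s₂ t₂) :
      Exec (.loop b p) s s₂ (t₁ + t₂ + 1)
  | loop_false (b : Test) (p : Prog) (s : State w) (hb : ¬ b.holds s) :
      Exec (.loop b p) s s 1

/-- The initial state of a query: the arguments are in the first registers, all others are `0`. -/
def queryState {w : ℕ} (m : Memory w) (args : List (BitVec w)) : State w where
  regs := fun r => args.getD r 0
  mem := m

/-- On the data structure `m` and the given arguments, the program `q` halts after at most `t` steps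
with the number `out` in register `0`, and it leaves the data structure as it found it. -/
def Answers {w : ℕ} (q : Prog) (m : Memory w) (args : List (BitVec w)) (t out : ℕ) : Prop :=
  ∃ (s : State w) (k : ℕ), Exec q (queryState m args) s k ∧ k ≤ t ∧
    (s.regs 0).toNat = out ∧ s.mem = m

/-- Logarithmic word size for problems of size `n`: the numbers `0, …, n` fit into a word, and a
word has at most `κ * (⌊log₂ n⌋ + 1)` bits. -/
def LogWordSize (κ n w : ℕ) : Prop := n < 2 ^ w ∧ w ≤ κ * (Nat.log 2 n + 1)

end WordRAM

/-! ## Predecessors and weighted trees -/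

/-- The predecessor of `d` in the set `A` with respect to the keys `key`: an element of `A` whose
key is largest among those that are at most `d`, or `none` if there is no such key. -/
def IsPredecessor {ι : Type*} (A : Set ι) (key : ι → ℕ) (d : ℕ) : Option ι → Prop
  | none => ∀ i ∈ A, d < key i
  | some i => i ∈ A ∧ key i ≤ d ∧ ∀ j ∈ A, key j ≤ d → key j ≤ key i

/-- An answer as a number: an index below `n`, or `n` for "no predecessor". -/
def encodeAnswer {n : ℕ} : Option (Fin n) → ℕ
  | none => n
  | some i => i

/-- A rooted tree on the nodes `0, …, n - 1`, given by parents (the root is its own parent), with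
node weights that strictly increase from parent to child. -/
structure WeightedTree (n : ℕ) where
  root : Fin n
  parent : Fin n → Fin n
  parent_root : parent root = root
  reaches_root : ∀ v, ∃ k, parent^[k] v = root
  weight : Fin n → ℕ
  weight_parent_lt : ∀ v, v ≠ root → weight (parent v) < weight v

namespace WeightedTree

variable {n : ℕ} (T : WeightedTree n)

/-- The ancestors of `v`, including `v` itself: the nodes on the path from `v` to the root. -/
def ancestors (v : Fin n) : Set (Fin n) := {u | ∃ k, T.parent^[k] v = u}

def IsLeaf (v : Fin n) : Prop := ∀ u, u ≠ T.root → T.parent u ≠ v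

end WeightedTree

open WordRAM in
/-- `pred` is an achievable query time for linear space static predecessor search: `m ≥ 1` integers
from `[0, U)` can be stored in `O(m)` words so that the (index of the) predecessor of any number in
`[0, U)` is found in time `O(pred m U)`. The word size is logarithmic in a bound `N ≥ m`, the size
of the problem of which the set is a part. -/
def LinearSpacePredecessor (κ : ℕ) (pred : ℕ → ℕ → ℕ) : Prop :=
  ∃ (c : ℕ) (query : Prog), ∀ (N w U m : ℕ) (key : Fin m → ℕ),
    LogWordSize κ N w → U ≤ 2 ^ w → 0 < m → m ≤ N → StrictMono key → (∀ i, key i < U) →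
    ∃ mem : Memory w, mem.size ≤ c * m ∧
      ∀ d : BitVec w, d.toNat < U →
        ∃ ans : Option (Fin m), IsPredecessor Set.univ key d.toNat ans ∧
          Answers query mem [d] (c * pred m U) (encodeAnswer ans)

open WordRAM in
/-- Weighted ancestor search in arbitrary trees on `n` nodes with weights from `[0, U)` takes linear
space and query time `O(pred n U)`. -/
def LinearSpaceWeightedAncestor (κ : ℕ) (pred : ℕ → ℕ → ℕ) : Prop :=
  ∃ (c : ℕ) (query : Prog), ∀ (n w U : ℕ) (T : WeightedTree n),
    LogWordSize κ n w → U ≤ 2 ^ w → (∀ v, T.weight v < U) →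
    ∃ mem : Memory w, mem.size ≤ c * n ∧
      ∀ (v : Fin n) (d : BitVec w),
        ∃ ans : Option (Fin n), IsPredecessor (T.ancestors v) T.weight d.toNat ans ∧
          Answers query mem [BitVec.ofNat w v, d] (c * pred n U) (encodeAnswer ans)

/-! The basic tool is a constant time predecessor search in a set of at most `B * B` keys, where `δ`
is about one eighth of `log n` and `B` is about `√δ`. A word is cut into `D = O(κ)` chunks of `δ`
bits, so the keys form a trie of constant depth, and a search follows one path of it. At a trie node
the outgoing chunks are searched in two rounds, first among every `B`-th chunk and then inside one
group of `B` chunks. Each round is a blind search: the positions of the highest differing bits of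
adjacent keys determine, together with the query, a key that shares a longest prefix with the query,
and one look at that key settles the rank. There are at most `(B + 1) * (δ + 1) ^ B ≤ 2 ^ δ` such
codes, so tables of `2 ^ (3 * δ) ≤ n` words serve all searches (`Fusion.exists_tables`,
`Fusion.exists_rank_structure`).

For part (1), suppose that every node has at most `δ` marked ancestors, and split the tree by
subtree size. The lowest nodes with more than `δ` descendants have disjoint subtrees, so each of
them can afford to store all its marked ancestors; this serves every node above them. The maximal
subtrees with at most `δ` nodes are disjoint too. In such a subtree the search by weight returns the
set of all light enough nodes as a mask of `δ` bits, and a table intersects it with the mask of the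
marked ancestors of the queried node (`exists_marked_structure`). A bound `O(log n)` in place of `δ`
is reduced to this by cutting the marked nodes into constantly many layers by their number of marked
ancestors. If words have constant length, weights bound the depth by a constant and walking up
suffices (`exists_ancestor_structure`).

For part (2), the tree is decomposed into paths of nodes with equal `⌊log₂ |subtree|⌋`. A root path
meets at most `⌊log₂ n⌋ + 1` of them, so part (1) with the topmost nodes of the paths as marked
nodes finds in constant time the only path on which a predecessor search is still needed. That is a
single call of the given structure, hence no additive term. The structures of all paths, whose
programs name their arrays explicitly, are packed into constantly many shared arrays and run by
simulation (`pack_exec`). -/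

open WordRAM

/-! ## Loop-free expressions over a read-only memory -/

namespace WordRAM

/-- Expressions that read registers and memory cells. -/
inductive Expr where
  | var (r : ℕ)
  | const (k : ℕ)
  | op (o : BinOp) (a b : Expr)
  | load (seg : ℕ) (a : Expr)
  | ifLt (a b p q : Expr)
  | ifEq (a b p q : Expr)

/-- `Ev m ρ e x`: with the numbers `ρ` in the registers, `e` evaluates without overflow to `x`. -/
inductive Ev {w : ℕ} (m : Memory w) (ρ : ℕ → ℕ) : Expr → ℕ → Prop
  | var (r : ℕ) : Ev m ρ (.var r) (ρ r)
  | const (k : ℕ) (h : k < 2 ^ w) : Ev m ρ (.const k) k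
  | add {a b : Expr} {x y : ℕ} (ha : Ev m ρ a x) (hb : Ev m ρ b y) (h : x + y < 2 ^ w) :
      Ev m ρ (.op .add a b) (x + y)
  | sub {a b : Expr} {x y : ℕ} (ha : Ev m ρ a x) (hb : Ev m ρ b y) (h : y ≤ x) :
      Ev m ρ (.op .sub a b) (x - y)
  | mul {a b : Expr} {x y : ℕ} (ha : Ev m ρ a x) (hb : Ev m ρ b y) (h : x * y < 2 ^ w) :
      Ev m ρ (.op .mul a b) (x * y)
  | mod {a b : Expr} {x y : ℕ} (ha : Ev m ρ a x) (hb : Ev m ρ b y) :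
      Ev m ρ (.op .mod a b) (x % y)
  | shr {a b : Expr} {x y : ℕ} (ha : Ev m ρ a x) (hb : Ev m ρ b y) :
      Ev m ρ (.op .shr a b) (x / 2 ^ y)
  | load {seg : ℕ} {a : Expr} {x : ℕ} {y : BitVec w} (ha : Ev m ρ a x)
      (h : (m.array seg)[x]? = some y) : Ev m ρ (.load seg a) y.toNat
  | ifLt {a b p q : Expr} {x y z : ℕ} (ha : Ev m ρ a x) (hb : Ev m ρ b y)
      (hp : x < y → Ev m ρ p z) (hq : ¬ x < y → Ev m ρ q z) : Ev m ρ (.ifLt a b p q) z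
  | ifEq {a b p q : Expr} {x y z : ℕ} (ha : Ev m ρ a x) (hb : Ev m ρ b y)
      (hp : x = y → Ev m ρ p z) (hq : ¬ x = y → Ev m ρ q z) : Ev m ρ (.ifEq a b p q) z

namespace Expr

/-- The program that evaluates an expression into register `k`; it writes to no register
below `k`. -/
def compile : Expr → ℕ → Prog
  | .var r, k => .copy k r
  | .const c, k => .const k c
  | .op o a b, k => .seq (a.compile k) (.seq (b.compile (k + 1)) (.op o k k (k + 1)))
  | .load seg a, k => .seq (a.compile k) (.load k seg k)
  | .ifLt a b p q, k => .seq (a.compile k) (.seq (b.compile (k + 1))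
      (.ite (.lt k (k + 1)) (p.compile k) (q.compile k)))
  | .ifEq a b p q, k => .seq (a.compile k) (.seq (b.compile (k + 1))
      (.ite (.eq k (k + 1)) (p.compile k) (q.compile k)))

/-- An upper bound for the number of steps of an evaluation. -/
def cost : Expr → ℕ
  | .var _ => 1
  | .const _ => 1
  | .op _ a b => a.cost + b.cost + 1
  | .load _ a => a.cost + 1
  | .ifLt a b p q => a.cost + b.cost + p.cost + q.cost + 1
  | .ifEq a b p q => a.cost + b.cost + p.cost + q.cost + 1

/-- All registers that are read are below `k`. -/
def Below (k : ℕ) : Expr → Prop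
  | .var r => r < k
  | .const _ => True
  | .op _ a b => a.Below k ∧ b.Below k
  | .load _ a => a.Below k
  | .ifLt a b p q => a.Below k ∧ b.Below k ∧ p.Below k ∧ q.Below k
  | .ifEq a b p q => a.Below k ∧ b.Below k ∧ p.Below k ∧ q.Below k

end Expr

/-- Induction on the evaluation. The second operand is computed one register higher, so the first
one and all inputs survive; since evaluation is free of overflow, word operations agree with those
on natural numbers. -/
theorem Ev.compile_aux {w : ℕ} {m : Memory w} {ρ : ℕ → ℕ} {b : ℕ} {e : Expr} {x : ℕ}
    (h : Ev m ρ e x) (hb : e.Below b) : ∀ (k : ℕ) (s : State w), b ≤ k → s.mem = m →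
      (∀ r < b, (s.regs r).toNat = ρ r) →
      ∃ (s' : State w) (t : ℕ), Exec (e.compile k) s s' t ∧ t ≤ e.cost ∧ s'.mem = m ∧
        (s'.regs k).toNat = x ∧ ∀ r < k, s'.regs r = s.regs r := by
  induction h with
  | var r =>
    intro k s hk hm hr
    exact ⟨_, _, .copy s k r, le_rfl, hm, by simpa [State.setReg] using hr r hb,
      fun r hr => by simp [State.setReg, hr.ne]⟩
  | const c hc =>
    intro k s hk hm hr
    exact ⟨_, _, .const s k c, le_rfl, hm, by simp [State.setReg, Nat.mod_eq_of_lt hc],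
      fun r hr => by simp [State.setReg, hr.ne]⟩
  | @add a c x y ha hc h iha ihc =>
    intro k s hk hm hr
    obtain ⟨s₁, t₁, e₁, c₁, m₁, v₁, r₁⟩ := iha hb.1 k s hk hm hr
    obtain ⟨s₂, t₂, e₂, c₂, m₂, v₂, r₂⟩ := ihc hb.2 (k + 1) s₁ (by omega) m₁
      (fun r hr' => by rw [r₁ r (by omega)]; exact hr r hr')
    refine ⟨_, _, .seq _ _ _ _ _ _ _ e₁ (.seq _ _ _ _ _ _ _ e₂ (.op _ _ _ _ _)),
      by simp only [Expr.cost]; omega, m₂, ?_, fun r hr => ?_⟩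
    · simp [State.setReg, BinOp.eval, r₂ k (by omega), v₁, v₂, Nat.mod_eq_of_lt h]
    · simp [State.setReg, hr.ne, r₂ r (by omega), r₁ r hr]
  | @sub a c x y ha hc h iha ihc =>
    intro k s hk hm hr
    obtain ⟨s₁, t₁, e₁, c₁, m₁, v₁, r₁⟩ := iha hb.1 k s hk hm hr
    obtain ⟨s₂, t₂, e₂, c₂, m₂, v₂, r₂⟩ := ihc hb.2 (k + 1) s₁ (by omega) m₁
      (fun r hr' => by rw [r₁ r (by omega)]; exact hr r hr')
    refine ⟨_, _, .seq _ _ _ _ _ _ _ e₁ (.seq _ _ _ _ _ _ _ e₂ (.op _ _ _ _ _)),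
      by simp only [Expr.cost]; omega, m₂, ?_, fun r hr => ?_⟩
    · have h' : s₂.regs (k + 1) ≤ s₁.regs k := by rw [BitVec.le_def]; omega
      simp [State.setReg, BinOp.eval, r₂ k (by omega), BitVec.toNat_sub_of_le h', v₁, v₂]
    · simp [State.setReg, hr.ne, r₂ r (by omega), r₁ r hr]
  | @mul a c x y ha hc h iha ihc =>
    intro k s hk hm hr
    obtain ⟨s₁, t₁, e₁, c₁, m₁, v₁, r₁⟩ := iha hb.1 k s hk hm hr
    obtain ⟨s₂, t₂, e₂, c₂, m₂, v₂, r₂⟩ := ihc hb.2 (k + 1) s₁ (by omega) m₁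
      (fun r hr' => by rw [r₁ r (by omega)]; exact hr r hr')
    refine ⟨_, _, .seq _ _ _ _ _ _ _ e₁ (.seq _ _ _ _ _ _ _ e₂ (.op _ _ _ _ _)),
      by simp only [Expr.cost]; omega, m₂, ?_, fun r hr => ?_⟩
    · simp [State.setReg, BinOp.eval, r₂ k (by omega), v₁, v₂, Nat.mod_eq_of_lt h]
    · simp [State.setReg, hr.ne, r₂ r (by omega), r₁ r hr]
  | @mod a c x y ha hc iha ihc =>
    intro k s hk hm hr
    obtain ⟨s₁, t₁, e₁, c₁, m₁, v₁, r₁⟩ := iha hb.1 k s hk hm hr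
    obtain ⟨s₂, t₂, e₂, c₂, m₂, v₂, r₂⟩ := ihc hb.2 (k + 1) s₁ (by omega) m₁
      (fun r hr' => by rw [r₁ r (by omega)]; exact hr r hr')
    refine ⟨_, _, .seq _ _ _ _ _ _ _ e₁ (.seq _ _ _ _ _ _ _ e₂ (.op _ _ _ _ _)),
      by simp only [Expr.cost]; omega, m₂, ?_, fun r hr => ?_⟩
    · simp [State.setReg, BinOp.eval, r₂ k (by omega), v₁, v₂]
    · simp [State.setReg, hr.ne, r₂ r (by omega), r₁ r hr]
  | @shr a c x y ha hc iha ihc =>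
    intro k s hk hm hr
    obtain ⟨s₁, t₁, e₁, c₁, m₁, v₁, r₁⟩ := iha hb.1 k s hk hm hr
    obtain ⟨s₂, t₂, e₂, c₂, m₂, v₂, r₂⟩ := ihc hb.2 (k + 1) s₁ (by omega) m₁
      (fun r hr' => by rw [r₁ r (by omega)]; exact hr r hr')
    refine ⟨_, _, .seq _ _ _ _ _ _ _ e₁ (.seq _ _ _ _ _ _ _ e₂ (.op _ _ _ _ _)),
      by simp only [Expr.cost]; omega, m₂, ?_, fun r hr => ?_⟩
    · simp [State.setReg, BinOp.eval, r₂ k (by omega), v₁, v₂, Nat.shiftRight_eq_div_pow]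
    · simp [State.setReg, hr.ne, r₂ r (by omega), r₁ r hr]
  | @load seg a x y ha h iha =>
    intro k s hk hm hr
    obtain ⟨s₁, t₁, e₁, c₁, m₁, v₁, r₁⟩ := iha hb k s hk hm hr
    refine ⟨_, _, .seq _ _ _ _ _ _ _ e₁ (.load _ _ _ _ y (by rw [m₁, v₁, h])),
      by simp only [Expr.cost]; omega, m₁, ?_, fun r hr => ?_⟩
    · simp [State.setReg]
    · simp [State.setReg, hr.ne, r₁ r hr]
  | @ifLt a c p q x y z ha hc hp hq iha ihc ihp ihq =>
    intro k s hk hm hr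
    obtain ⟨s₁, t₁, e₁, c₁, m₁, v₁, r₁⟩ := iha hb.1 k s hk hm hr
    obtain ⟨s₂, t₂, e₂, c₂, m₂, v₂, r₂⟩ := ihc hb.2.1 (k + 1) s₁ (by omega) m₁
      (fun r hr' => by rw [r₁ r (by omega)]; exact hr r hr')
    have hr₂ : ∀ r < b, (s₂.regs r).toNat = ρ r := fun r hr' => by
      rw [r₂ r (by omega), r₁ r (by omega)]; exact hr r hr'
    have hv : (s₂.regs k).toNat = x := by rw [r₂ k (by omega), v₁]
    by_cases hxy : x < y
    · obtain ⟨s₃, t₃, e₃, c₃, m₃, v₃, r₃⟩ := ihp hxy hb.2.2.1 k s₂ hk m₂ hr₂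
      refine ⟨_, _, .seq _ _ _ _ _ _ _ e₁ (.seq _ _ _ _ _ _ _ e₂
        (.ite_true _ _ _ _ _ _ ?_ e₃)), by simp only [Expr.cost]; omega, m₃, v₃,
        fun r hr => by rw [r₃ r hr, r₂ r (by omega), r₁ r hr]⟩
      simpa [Test.holds, BitVec.lt_def, hv, v₂] using hxy
    · obtain ⟨s₃, t₃, e₃, c₃, m₃, v₃, r₃⟩ := ihq hxy hb.2.2.2 k s₂ hk m₂ hr₂
      refine ⟨_, _, .seq _ _ _ _ _ _ _ e₁ (.seq _ _ _ _ _ _ _ e₂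
        (.ite_false _ _ _ _ _ _ ?_ e₃)), by simp only [Expr.cost]; omega, m₃, v₃,
        fun r hr => by rw [r₃ r hr, r₂ r (by omega), r₁ r hr]⟩
      simpa [Test.holds, BitVec.lt_def, hv, v₂] using hxy
  | @ifEq a c p q x y z ha hc hp hq iha ihc ihp ihq =>
    intro k s hk hm hr
    obtain ⟨s₁, t₁, e₁, c₁, m₁, v₁, r₁⟩ := iha hb.1 k s hk hm hr
    obtain ⟨s₂, t₂, e₂, c₂, m₂, v₂, r₂⟩ := ihc hb.2.1 (k + 1) s₁ (by omega) m₁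
      (fun r hr' => by rw [r₁ r (by omega)]; exact hr r hr')
    have hr₂ : ∀ r < b, (s₂.regs r).toNat = ρ r := fun r hr' => by
      rw [r₂ r (by omega), r₁ r (by omega)]; exact hr r hr'
    have hv : (s₂.regs k).toNat = x := by rw [r₂ k (by omega), v₁]
    by_cases hxy : x = y
    · obtain ⟨s₃, t₃, e₃, c₃, m₃, v₃, r₃⟩ := ihp hxy hb.2.2.1 k s₂ hk m₂ hr₂
      refine ⟨_, _, .seq _ _ _ _ _ _ _ e₁ (.seq _ _ _ _ _ _ _ e₂
        (.ite_true _ _ _ _ _ _ ?_ e₃)), by simp only [Expr.cost]; omega, m₃, v₃,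
        fun r hr => by rw [r₃ r hr, r₂ r (by omega), r₁ r hr]⟩
      simpa [Test.holds, BitVec.toNat_eq, hv, v₂] using hxy
    · obtain ⟨s₃, t₃, e₃, c₃, m₃, v₃, r₃⟩ := ihq hxy hb.2.2.2 k s₂ hk m₂ hr₂
      refine ⟨_, _, .seq _ _ _ _ _ _ _ e₁ (.seq _ _ _ _ _ _ _ e₂
        (.ite_false _ _ _ _ _ _ ?_ e₃)), by simp only [Expr.cost]; omega, m₃, v₃,
        fun r hr => by rw [r₃ r hr, r₂ r (by omega), r₁ r hr]⟩
      simpa [Test.holds, BitVec.toNat_eq, hv, v₂] using hxy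

/-- `p` runs from `s` in at most `t` steps to a state with the property `Q`. -/
def Runs {w : ℕ} (p : Prog) (s : State w) (t : ℕ) (Q : State w → Prop) : Prop :=
  ∃ (s' : State w) (k : ℕ), Exec p s s' k ∧ k ≤ t ∧ Q s'

theorem Runs.seq {w : ℕ} {p q : Prog} {s : State w} {t₁ t₂ : ℕ} {Q R : State w → Prop}
    (hp : Runs p s t₁ Q) (hq : ∀ s', Q s' → Runs q s' t₂ R) : Runs (.seq p q) s (t₁ + t₂) R := by
  obtain ⟨s₁, k₁, e₁, h₁, q₁⟩ := hp
  obtain ⟨s₂, k₂, e₂, h₂, q₂⟩ := hq s₁ q₁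
  exact ⟨s₂, _, .seq _ _ _ _ _ _ _ e₁ e₂, by omega, q₂⟩

theorem Runs.mono {w : ℕ} {p : Prog} {s : State w} {t₁ t₂ : ℕ} {Q R : State w → Prop}
    (hp : Runs p s t₁ Q) (ht : t₁ ≤ t₂) (h : ∀ s', Q s' → R s') : Runs p s t₂ R := by
  obtain ⟨s₁, k₁, e₁, h₁, q₁⟩ := hp
  exact ⟨s₁, _, e₁, h₁.trans ht, h _ q₁⟩

theorem Ev.runs {w : ℕ} {m : Memory w} {ρ : ℕ → ℕ} {b : ℕ} {e : Expr} {x : ℕ}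
    (h : Ev m ρ e x) (hb : e.Below b) (k : ℕ) (s : State w) (hk : b ≤ k) (hm : s.mem = m)
    (hr : ∀ r < b, (s.regs r).toNat = ρ r) :
    Runs (e.compile k) s e.cost fun s' => s'.mem = m ∧ (s'.regs k).toNat = x ∧
      ∀ r < k, s'.regs r = s.regs r :=
  h.compile_aux hb k s hk hm hr

/-- The array of the values `f 0, …, f (len - 1)`. -/
def tab (w len : ℕ) (f : ℕ → ℕ) : List (BitVec w) :=
  (List.range len).map fun i => BitVec.ofNat w (f i)

@[simp] theorem length_tab (w len : ℕ) (f : ℕ → ℕ) : (tab w len f).length = len := by simp [tab]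

theorem Ev.load_tab {w : ℕ} {m : Memory w} {ρ : ℕ → ℕ} {seg len : ℕ} {f : ℕ → ℕ} {a : Expr} {x : ℕ}
    (hm : m.array seg = tab w len f) (ha : Ev m ρ a x) (hx : x < len) (hf : f x < 2 ^ w) :
    Ev m ρ (.load seg a) (f x) := by
  have := Ev.load (seg := seg) (y := BitVec.ofNat w (f x)) ha (by simp [hm, tab, hx])
  simpa [Nat.mod_eq_of_lt hf] using this

/-- The arrays `l` stand in the memory `m` from the name `o` on. -/
def Slice {w : ℕ} (m : Memory w) (o : ℕ) (l : Memory w) : Prop :=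
  ∃ pre post : Memory w, m = pre ++ l ++ post ∧ pre.length = o

theorem Slice.refl {w : ℕ} (m : Memory w) : Slice m 0 m := ⟨[], [], by simp, rfl⟩

theorem Slice.left {w : ℕ} {m : Memory w} {o : ℕ} {l₁ l₂ : Memory w} (h : Slice m o (l₁ ++ l₂)) :
    Slice m o l₁ := by
  obtain ⟨pre, post, h, ho⟩ := h
  exact ⟨pre, l₂ ++ post, by simp [h], ho⟩

theorem Slice.right {w : ℕ} {m : Memory w} {o o' : ℕ} {l₁ l₂ : Memory w}
    (h : Slice m o (l₁ ++ l₂)) (ho' : o' = o + l₁.length) : Slice m o' l₂ := by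
  obtain ⟨pre, post, h, ho⟩ := h
  exact ⟨pre ++ l₁, post, by simp [h], by simp [ho, ho']⟩

theorem Slice.array {w : ℕ} {m : Memory w} {o : ℕ} {l : Memory w} (h : Slice m o l) {i : ℕ}
    (hi : i < l.length) : m.array (o + i) = l.array i := by
  obtain ⟨pre, post, rfl, rfl⟩ := h
  simp [Memory.array, List.getD_eq_getElem?_getD, List.getElem?_append, hi]

theorem Slice.array' {w : ℕ} {m : Memory w} {o : ℕ} {l : Memory w} (h : Slice m o l) (i : ℕ)
    {a : List (BitVec w)} (hi : l[i]? = some a) : m.array (o + i) = a := by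
  rw [h.array (by exact (List.getElem?_eq_some_iff.1 hi).1)]
  simp [Memory.array, List.getD_eq_getElem?_getD, hi]

theorem Memory.size_append {w : ℕ} (l₁ l₂ : Memory w) :
    Memory.size (l₁ ++ l₂) = Memory.size l₁ + Memory.size l₂ := by
  simp [Memory.size]

theorem Memory.size_flatten {w : ℕ} {l : List (Memory w)} {c : ℕ} (h : ∀ x ∈ l, Memory.size x ≤ c) :
    Memory.size l.flatten ≤ l.length * c := by
  induction l with
  | nil => simp [Memory.size]
  | cons a l ih =>
    rw [List.flatten_cons, Memory.size_append, List.length_cons, add_mul, one_mul, add_comm]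
    exact add_le_add (ih fun x hx => h x (by simp [hx])) (h a (by simp))

theorem Slice.flatten {w : ℕ} {m : Memory w} {o A : ℕ} {l : List (Memory w)}
    (h : Slice m o l.flatten) (hl : ∀ x ∈ l, x.length = A) {i : ℕ} {x : Memory w}
    (hi : l[i]? = some x) : Slice m (o + i * A) x := by
  induction l generalizing o i with
  | nil => simp at hi
  | cons a l ih =>
    have ha : List.length a = A := hl a (by simp)
    rw [List.flatten_cons] at h
    cases i with
    | zero =>
      obtain rfl : a = x := by simpa using hi
      simpa using h.left
    | succ i =>
      have := ih (h.right rfl) (fun x hx => hl x (by simp [hx])) (by simpa using hi)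
      rw [ha] at this
      rwa [show o + (i + 1) * A = o + A + i * A by ring]

/-- Storage allocation: disjoint blocks of the given lengths in an array. -/
theorem exists_allocation {ι : Type*} (s : Finset ι) (len : ι → ℕ) (N : ℕ)
    (h : ∑ a ∈ s, len a ≤ N) : ∃ (base : ι → ℕ) (owner : ℕ → Option (ι × ℕ)),
      (∀ a ∈ s, ∀ i < len a, owner (base a + i) = some (a, i)) ∧
      (∀ p a i, owner p = some (a, i) → a ∈ s ∧ i < len a ∧ p = base a + i) ∧
      (∀ a ∈ s, base a + len a ≤ N) := by
  classical
  suffices H : ∃ (base : ι → ℕ) (owner : ℕ → Option (ι × ℕ)),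
      (∀ a ∈ s, ∀ i < len a, owner (base a + i) = some (a, i)) ∧
      (∀ p a i, owner p = some (a, i) → a ∈ s ∧ i < len a ∧ p = base a + i) ∧
      (∀ a ∈ s, base a + len a ≤ ∑ a ∈ s, len a) by
    obtain ⟨b, o, h1, h2, h3⟩ := H
    exact ⟨b, o, h1, h2, fun a ha => (h3 a ha).trans h⟩
  clear h
  induction s using Finset.induction_on with
  | empty => exact ⟨fun _ => 0, fun _ => none, by simp, by simp, by simp⟩
  | insert c s hc ih =>
    obtain ⟨b, o, h1, h2, h3⟩ := ih
    set S := ∑ a ∈ s, len a with hS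
    have hne : ∀ a ∈ s, a ≠ c := fun a ha hac => hc (hac ▸ ha)
    refine ⟨Function.update b c S,
      fun p => if p < S then o p else if p < S + len c then some (c, p - S) else none, ?_, ?_, ?_⟩
    · intro a ha i hi
      rcases Finset.mem_insert.1 ha with rfl | ha
      · simp [hi]
      · have := h3 a ha
        simp [hne a ha, h1 a ha i hi, show b a + i < S by omega]
    · intro p a i hp
      dsimp only at hp
      split_ifs at hp with h4 h5
      · obtain ⟨h6, h7, h8⟩ := h2 p a i hp
        exact ⟨by simp [h6], h7, by simp [hne a h6, h8]⟩
      · obtain ⟨rfl, rfl⟩ : c = a ∧ p - S = i := by simpa using hp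
        exact ⟨by simp, by omega, by simp; omega⟩
    · intro a ha
      rw [Finset.sum_insert hc]
      rcases Finset.mem_insert.1 ha with rfl | ha
      · simp [← hS, add_comm]
      · have := h3 a ha
        simp only [ne_eq, hne a ha, not_false_eq_true, Function.update_of_ne]
        omega

/-- The contents of an array with allocated blocks. -/
def blocks {ι : Type*} (owner : ℕ → Option (ι × ℕ)) (f : ι → ℕ → ℕ) (p : ℕ) : ℕ :=
  match owner p with
  | some (a, i) => f a i
  | none => 0

theorem blocks_eq {ι : Type*} {owner : ℕ → Option (ι × ℕ)} {f : ι → ℕ → ℕ} {p : ℕ} {a : ι} {i : ℕ}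
    (h : owner p = some (a, i)) : blocks owner f p = f a i := by
  simp [blocks, h]

end WordRAM

/-! ## Blind search in sorted sequences -/

namespace Fusion

theorem exists_div_pow_eq (a b : ℕ) : ∃ t, a / 2 ^ t = b / 2 ^ t :=
  ⟨a + b, by
    rw [Nat.div_eq_of_lt, Nat.div_eq_of_lt]
    · exact lt_of_le_of_lt (Nat.le_add_left b a) Nat.lt_two_pow_self
    · exact lt_of_le_of_lt (Nat.le_add_right a b) Nat.lt_two_pow_self⟩

/-- The number of low bits up to the highest bit where `a` and `b` differ. -/
def lvl (a b : ℕ) : ℕ := Nat.find (exists_div_pow_eq a b)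

/-- Agreement of the prefixes above bit `t` persists when `t` grows. All later comparisons of levels
are reduced to equalities of quotients through this equivalence. -/
theorem lvl_le_iff {a b t : ℕ} : lvl a b ≤ t ↔ a / 2 ^ t = b / 2 ^ t := by
  constructor
  · intro h
    have := Nat.find_spec (exists_div_pow_eq a b)
    change a / 2 ^ lvl a b = b / 2 ^ lvl a b at this
    obtain ⟨u, rfl⟩ := Nat.exists_eq_add_of_le h
    rw [pow_add, ← Nat.div_div_eq_div_mul, this, Nat.div_div_eq_div_mul]
  · intro h
    exact Nat.find_min' _ h

theorem lvl_le_of_lt {a b t : ℕ} (ha : a < 2 ^ t) (hb : b < 2 ^ t) : lvl a b ≤ t :=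
  lvl_le_iff.2 (by rw [Nat.div_eq_of_lt ha, Nat.div_eq_of_lt hb])

theorem lvl_comm (a b : ℕ) : lvl a b = lvl b a :=
  le_antisymm (lvl_le_iff.2 (lvl_le_iff.1 le_rfl).symm) (lvl_le_iff.2 (lvl_le_iff.1 le_rfl).symm)

theorem lvl_pos {a b : ℕ} (h : a ≠ b) : 0 < lvl a b := by
  rw [Nat.pos_iff_ne_zero]
  intro h0
  exact h (by simpa using lvl_le_iff.1 h0.le)

theorem div_two_pow_succ (a t : ℕ) : a / 2 ^ (t + 1) = a / 2 ^ t / 2 := by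
  rw [pow_succ, Nat.div_div_eq_div_mul]

/-- Blind search: a key that shares a longest prefix with `z` can be found from the levels of
adjacent keys. -/
theorem exists_blind_candidate (h : ℕ → ℕ) (z : ℕ) : ∀ (len a : ℕ), ∃ i, a ≤ i ∧ i ≤ a + len ∧
    ∀ y : ℕ → ℕ, (∀ j, a ≤ j → j < a + len → y j < y (j + 1)) →
      (∀ j, a ≤ j → j < a + len → lvl (y j) (y (j + 1)) = h j) →
      ∀ j, a ≤ j → j ≤ a + len → lvl (y i) z ≤ lvl (y j) z := by
  intro len
  induction len using Nat.strong_induction_on with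
  | _ len ih =>
  intro a
  rcases Nat.eq_zero_or_pos len with rfl | hlen
  · exact ⟨a, le_rfl, le_rfl, fun y _ _ j h1 h2 => by rw [show j = a by omega]⟩
  -- The gap of maximal level is the top branching of the compressed trie of the keys. It depends
  -- only on `h`, so the recursion never looks at the keys.
  obtain ⟨b, hb, hmax⟩ := Finset.exists_max_image (Finset.Ico a (a + len)) h ⟨a, by simp; omega⟩
  rw [Finset.mem_Ico] at hb
  simp only [Finset.mem_Ico] at hmax
  obtain ⟨i₀, hi₀, hi₀', h₀⟩ := ih (b - a) (by omega) a
  obtain ⟨i₁, hi₁, hi₁', h₁⟩ := ih (a + len - (b + 1)) (by omega) (b + 1)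
  rw [show a + (b - a) = b by omega] at hi₀' h₀
  rw [show b + 1 + (a + len - (b + 1)) = a + len by omega] at hi₁' h₁
  -- All keys agree above bit `t`; bit `t` is 0 up to `b` and 1 after it.
  have key : ∀ y : ℕ → ℕ, (∀ j, a ≤ j → j < a + len → y j < y (j + 1)) →
      (∀ j, a ≤ j → j < a + len → lvl (y j) (y (j + 1)) = h j) →
      ∃ t q, h b = t + 1 ∧ (∀ j, a ≤ j → j ≤ b → y j / 2 ^ t = 2 * q) ∧
        (∀ j, b < j → j ≤ a + len → y j / 2 ^ t = 2 * q + 1) := by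
    intro y hy hh
    have hmono : ∀ j k, a ≤ j → j ≤ k → k ≤ a + len → y j ≤ y k := by
      intro j k h1 h2
      induction k, h2 using Nat.le_induction with
      | base => simp
      | succ k hk ihk => exact fun h3 => (ihk (by omega)).trans (hy k (by omega) (by omega)).le
    obtain ⟨t, ht⟩ : ∃ t, h b = t + 1 := by
      have := lvl_pos (hy b (by omega) (by omega)).ne
      rw [hh b (by omega) (by omega)] at this
      exact ⟨h b - 1, by omega⟩
    have hconst : ∀ j, a ≤ j → j ≤ a + len → y j / 2 ^ (t + 1) = y a / 2 ^ (t + 1) := by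
      intro j h1
      induction j, h1 using Nat.le_induction with
      | base => simp
      | succ k hk ihk =>
        intro h3
        rw [← ihk (by omega), eq_comm, ← lvl_le_iff, hh k hk (by omega), ← ht]
        exact hmax k ⟨hk, by omega⟩
    have hne : y b / 2 ^ t ≠ y (b + 1) / 2 ^ t := by
      rw [Ne, ← lvl_le_iff, hh b (by omega) (by omega)]
      omega
    have hdiv : ∀ j k, a ≤ j → j ≤ k → k ≤ a + len → y j / 2 ^ t ≤ y k / 2 ^ t :=
      fun j k h1 h2 h3 => Nat.div_le_div_right (hmono j k h1 h2 h3)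
    refine ⟨t, y a / 2 ^ (t + 1), ht, fun j h1 h2 => ?_, fun j h1 h2 => ?_⟩
    all_goals
      have e1 := hconst b (by omega) (by omega)
      have e2 := hconst (b + 1) (by omega) (by omega)
      have e3 := hconst j (by omega) (by omega)
      have e4 := hdiv b (b + 1) (by omega) (by omega) (by omega)
      rw [div_two_pow_succ] at e1 e2 e3
    · have e5 := hdiv j b (by omega) (by omega) (by omega)
      omega
    · have e5 := hdiv (b + 1) j (by omega) (by omega) (by omega)
      omega
  -- Bit `t` of `z` chooses the side. If `z` shares the common prefix, every key of the other side
  -- is at level `t + 1` from `z`, and those of the chosen side are at most at level `t`. If it does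
  -- not, `z` leaves all keys at the same higher bit, and every candidate is equally good.
  by_cases hz : z / 2 ^ (h b - 1) % 2 = 0
  · refine ⟨i₀, hi₀, by omega, fun y hy hh j h1 h2 => ?_⟩
    obtain ⟨t, q, ht, k0, k1⟩ := key y hy hh
    rw [ht, Nat.add_sub_cancel] at hz
    rcases le_or_gt j b with hj | hj
    · exact h₀ y (fun j h1 h2 => hy j h1 (by omega)) (fun j h1 h2 => hh j h1 (by omega)) j h1 hj
    · by_cases hq : z / 2 ^ t = 2 * q
      · have : lvl (y i₀) z ≤ t := lvl_le_iff.2 (by rw [k0 i₀ hi₀ hi₀', hq])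
        have : ¬ lvl (y j) z ≤ t := by rw [lvl_le_iff, k1 j hj h2, hq]; omega
        omega
      · have h5 : ¬ lvl (y j) z ≤ t := by rw [lvl_le_iff, k1 j hj h2]; omega
        have h6 := lvl_le_iff.1 (le_refl (lvl (y j) z))
        rw [lvl_le_iff, ← h6]
        obtain ⟨u, hu⟩ := Nat.exists_eq_add_of_le (show t + 1 ≤ lvl (y j) z by omega)
        rw [hu, pow_add, ← Nat.div_div_eq_div_mul, ← Nat.div_div_eq_div_mul, div_two_pow_succ,
          div_two_pow_succ, k0 i₀ hi₀ hi₀', k1 j hj h2]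
        congr 1
        omega
  · refine ⟨i₁, by omega, by omega, fun y hy hh j h1 h2 => ?_⟩
    obtain ⟨t, q, ht, k0, k1⟩ := key y hy hh
    rw [ht, Nat.add_sub_cancel] at hz
    rcases lt_or_ge b j with hj | hj
    · exact h₁ y (fun j h1 h2 => hy j (by omega) (by omega))
        (fun j h1 h2 => hh j (by omega) (by omega)) j hj h2
    · by_cases hq : z / 2 ^ t = 2 * q + 1
      · have : lvl (y i₁) z ≤ t := lvl_le_iff.2 (by rw [k1 i₁ hi₁ hi₁', hq])
        have : ¬ lvl (y j) z ≤ t := by rw [lvl_le_iff, k0 j h1 hj, hq]; omega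
        omega
      · have h5 : ¬ lvl (y j) z ≤ t := by rw [lvl_le_iff, k0 j h1 hj]; omega
        have h6 := lvl_le_iff.1 (le_refl (lvl (y j) z))
        rw [lvl_le_iff, ← h6]
        obtain ⟨u, hu⟩ := Nat.exists_eq_add_of_le (show t + 1 ≤ lvl (y j) z by omega)
        rw [hu, pow_add, ← Nat.div_div_eq_div_mul, ← Nat.div_div_eq_div_mul, div_two_pow_succ,
          div_two_pow_succ, k1 i₁ hi₁ hi₁', k0 j h1 hj]
        congr 1
        omega

/-- Adjacent levels determine all levels. -/
theorem lvl_eq_of_adjacent {m : ℕ} {y y' : ℕ → ℕ} (hy : ∀ i j, i < j → j < m → y i < y j)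
    (hy' : ∀ i j, i < j → j < m → y' i < y' j)
    (h : ∀ i, i + 1 < m → lvl (y i) (y (i + 1)) = lvl (y' i) (y' (i + 1))) (i j : ℕ) (hij : i ≤ j)
    (hj : j < m) : lvl (y i) (y j) = lvl (y' i) (y' j) := by
  -- For increasing sequences the level is the maximum of the levels in between: quotients are
  -- monotone, so the outer two agree only if the middle one agrees with both.
  have key : ∀ {y : ℕ → ℕ}, (∀ i j, i < j → j < m → y i < y j) → ∀ i j, i ≤ j → j + 1 < m →
      lvl (y i) (y (j + 1)) = max (lvl (y i) (y j)) (lvl (y j) (y (j + 1))) := by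
    intro y hy i j hij hj
    have h1 : y i ≤ y j := by
      rcases hij.eq_or_lt with rfl | h
      · rfl
      · exact (hy i j h (by omega)).le
    have h2 : y j ≤ y (j + 1) := (hy j (j + 1) (by omega) hj).le
    apply eq_of_forall_ge_iff
    intro t
    rw [max_le_iff, lvl_le_iff, lvl_le_iff, lvl_le_iff]
    have h3 := Nat.div_le_div_right (c := 2 ^ t) h1
    have h4 := Nat.div_le_div_right (c := 2 ^ t) h2
    omega
  induction j, hij using Nat.le_induction with
  | base =>
    have : ∀ a, lvl a a = 0 := fun a => Nat.le_zero.1 (lvl_le_iff.2 rfl)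
    simp [this]
  | succ j hij ih => rw [key hy i j hij hj, key hy' i j hij hj, ih (by omega), h j hj]

/-- Given a key `p` that shares a longest prefix with `z`, the order of `q` and `z` is determined by
the level of `p` and `q`. -/
theorem le_iff_of_candidate {p q z : ℕ} (h : lvl p z ≤ lvl q z) :
    q ≤ z ↔ (p ≤ z ∧ q ≤ p) ∨ (p < z ∧ lvl p q < lvl p z) ∨
      (z < p ∧ q < p ∧ lvl p z ≤ lvl p q) := by
  rcases eq_or_ne p z with rfl | hne
  · simp
  -- The quotients of `p` and `z` by `2 ^ t` are adjacent numbers `2a` and `2a + 1`, and that of `q`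
  -- differs from that of `z`. If it equals that of `p`, then `q` lies on the side of `p`. Otherwise
  -- it lies outside both, and `q` compares with `z` as with `p`.
  obtain ⟨t, ht⟩ : ∃ t, lvl p z = t + 1 := ⟨lvl p z - 1, by have := lvl_pos hne; omega⟩
  have h5 : ¬ lvl p z ≤ t := by omega
  have h6 : ¬ lvl q z ≤ t := by omega
  have h7 : lvl p z ≤ t + 1 := by omega
  have e1 : lvl p q < lvl p z ↔ lvl p q ≤ t := by omega
  have e2 : lvl p z ≤ lvl p q ↔ ¬ lvl p q ≤ t := by omega
  rw [e1, e2]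
  have m1 : ∀ {a b : ℕ}, a ≤ b → a / 2 ^ t ≤ b / 2 ^ t := fun h => Nat.div_le_div_right h
  have m2 : p ≤ q → p / 2 ^ t ≤ q / 2 ^ t := m1
  have m3 : q ≤ p → q / 2 ^ t ≤ p / 2 ^ t := m1
  have m4 : z ≤ q → z / 2 ^ t ≤ q / 2 ^ t := m1
  have m5 : q ≤ z → q / 2 ^ t ≤ z / 2 ^ t := m1
  have m6 : p ≤ z → p / 2 ^ t ≤ z / 2 ^ t := m1
  have m7 : z ≤ p → z / 2 ^ t ≤ p / 2 ^ t := m1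
  rw [lvl_le_iff] at h5 h6 h7 ⊢
  rw [div_two_pow_succ, div_two_pow_succ] at h7
  omega

/-- Tables for the search in a sequence of at most `B` keys of `δ` bits: from a short code of the
sequence, `cand` finds the index of a key, and this key then determines the rank. -/
theorem exists_tables (δ B : ℕ) : ∃ (code : ℕ → (ℕ → ℕ) → ℕ) (cand : ℕ → ℕ → ℕ)
    (rank : ℕ → ℕ → ℕ → ℕ), ∀ (m : ℕ) (y : ℕ → ℕ), 0 < m → m ≤ B →
      (∀ i j, i < j → j < m → y i < y j) → (∀ i < m, y i < 2 ^ δ) →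
      code m y < (B + 1) * (δ + 1) ^ B ∧
      ∀ z, cand (code m y) z < m ∧
        rank (code m y) (y (cand (code m y) z)) z = ((Finset.range m).filter (y · ≤ z)).card := by
  classical
  let D := Fin (B + 1) × (Fin B → Fin (δ + 1))
  have hD : Fintype.card D = (B + 1) * (δ + 1) ^ B := by simp [D]
  let e : D ≃ Fin ((B + 1) * (δ + 1) ^ B) := Fintype.equivFinOfCardEq hD
  -- The reductions by `Fin.ofNat` lose nothing on the length and on the levels inside the sequence.
  -- The entries beyond the sequence are arbitrary and never compared.
  let dsc : ℕ → (ℕ → ℕ) → D := fun m y =>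
    (Fin.ofNat _ m, fun i => Fin.ofNat _ (lvl (y i) (y (i + 1))))
  let code : ℕ → (ℕ → ℕ) → ℕ := fun m y => e (dsc m y)
  let Good : ℕ → (ℕ → ℕ) → Prop := fun m y => 0 < m ∧ m ≤ B ∧
      (∀ i j, i < j → j < m → y i < y j) ∧ (∀ i < m, y i < 2 ^ δ)
  have hcode : ∀ m y m' y', Good m y → Good m' y' → code m y = code m' y' →
      m = m' ∧ ∀ i, i + 1 < m → lvl (y i) (y (i + 1)) = lvl (y' i) (y' (i + 1)) := by
    rintro m y m' y' ⟨h1, h2, h3, h4⟩ ⟨h1', h2', h3', h4'⟩ h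
    have h := e.injective (Fin.ext h)
    rw [Prod.ext_iff] at h
    obtain ⟨ha, hb⟩ := h
    have hm : m = m' := by
      have := congrArg Fin.val ha
      simpa [dsc, Nat.mod_eq_of_lt (show m < B + 1 by omega),
        Nat.mod_eq_of_lt (show m' < B + 1 by omega)] using this
    subst hm
    refine ⟨rfl, fun i hi => ?_⟩
    have := congrArg Fin.val (congrFun hb ⟨i, by omega⟩)
    have l1 := lvl_le_of_lt (h4 i (by omega)) (h4 (i + 1) hi)
    have l2 := lvl_le_of_lt (h4' i (by omega)) (h4' (i + 1) hi)
    simpa [dsc, Nat.mod_eq_of_lt (Nat.lt_succ_of_le l1),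
      Nat.mod_eq_of_lt (Nat.lt_succ_of_le l2)] using this
  -- One index serves all sequences with the same code. Codes that do not occur get a default value,
  -- here and for the ranks.
  have hcand : ∀ k z, ∃ i, ∀ m y, Good m y → code m y = k →
      i < m ∧ ∀ j < m, lvl (y i) z ≤ lvl (y j) z := by
    intro k z
    by_cases hk : ∃ m y, Good m y ∧ code m y = k
    · obtain ⟨m, y, hg, rfl⟩ := hk
      obtain ⟨i, -, hi, h⟩ := exists_blind_candidate (fun i => lvl (y i) (y (i + 1))) z (m - 1) 0
      refine ⟨i, fun m' y' hg' h' => ?_⟩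
      obtain ⟨rfl, hl⟩ := hcode _ _ _ _ hg' hg h'
      have := hg.1
      refine ⟨by omega, fun j hj => h y' (fun j _ hj => hg'.2.2.1 j (j + 1) (by omega) (by omega))
        (fun j _ hj => hl j (by omega)) j (by omega) (by omega)⟩
    · exact ⟨0, fun m y hg h => (hk ⟨m, y, hg, h⟩).elim⟩
  choose cand hcand using hcand
  -- The rank depends only on the code, the candidate key and `z`: adjacent levels give the level of
  -- every key relative to the candidate, and positions give the order.
  have hrank : ∀ k x z, ∃ r, ∀ m y, Good m y → code m y = k → y (cand k z) = x →
      r = ((Finset.range m).filter (y · ≤ z)).card := by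
    intro k x z
    by_cases hk : ∃ m y, Good m y ∧ code m y = k ∧ y (cand k z) = x
    · obtain ⟨m, y, hg, hc, hx⟩ := hk
      refine ⟨((Finset.range m).filter (y · ≤ z)).card, fun m' y' hg' hc' hx' => ?_⟩
      obtain ⟨rfl, hl⟩ := hcode _ _ _ _ hg' hg (hc'.trans hc.symm)
      congr 1
      apply Finset.filter_congr
      intro j hj
      rw [Finset.mem_range] at hj
      obtain ⟨c1, c2⟩ := hcand k z m' y hg hc
      obtain ⟨-, c2'⟩ := hcand k z m' y' hg' hc'
      rw [le_iff_of_candidate (c2 j hj), le_iff_of_candidate (c2' j hj), hx, hx']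
      have hll : lvl x (y j) = lvl x (y' j) := by
        rcases le_total (cand k z) j with hle | hle
        · have := lvl_eq_of_adjacent hg'.2.2.1 hg.2.2.1 hl _ j hle hj
          rw [hx, hx'] at this
          exact this.symm
        · have := lvl_eq_of_adjacent hg'.2.2.1 hg.2.2.1 hl j _ hle c1
          rw [hx, hx'] at this
          rw [lvl_comm, ← this, lvl_comm]
      have mono : ∀ {y : ℕ → ℕ}, Good m' y → (y j ≤ y (cand k z) ↔ j ≤ cand k z) ∧
          (y j < y (cand k z) ↔ j < cand k z) := by
        intro y hy
        rcases lt_trichotomy j (cand k z) with h | h | h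
        · have := hy.2.2.1 _ _ h c1; omega
        · rw [← h]; omega
        · have := hy.2.2.1 _ _ h hj; omega
      have mo := mono hg
      have mo' := mono hg'
      rw [hx] at mo
      rw [hx'] at mo'
      rw [mo.1, mo.2, mo'.1, mo'.2, hll]
    · exact ⟨0, fun m y hg h1 h2 => (hk ⟨m, y, hg, h1, h2⟩).elim⟩
  choose rank hrank using hrank
  refine ⟨code, cand, rank, fun m y h1 h2 h3 h4 => ⟨(e (dsc m y)).2, fun z => ?_⟩⟩
  exact ⟨(hcand _ z m y ⟨h1, h2, h3, h4⟩ rfl).1, hrank _ _ z m y ⟨h1, h2, h3, h4⟩ rfl rfl⟩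

end Fusion

/-! ## Constant time search in small sets of keys -/

namespace Fusion

/-- Parameters of the search structure: a word of `w` bits is cut into `D` chunks of `δ` bits, and
`B` chunks can be searched at once with tables of at most `n` words. -/
structure Params (δ B D n w : ℕ) : Prop where
  code_le : (B + 1) * (δ + 1) ^ B ≤ 2 ^ δ
  table_le : 2 ^ (3 * δ) ≤ n
  lt_word : n < 2 ^ w
  word_le : w ≤ δ * D
  shift_lt : δ * D < 2 ^ w
  levels_lt : D + 2 < 2 ^ w
  pos : 0 < B

/-- The elements of a finite set in increasing order. -/
def enum (Y : Finset ℕ) (i : ℕ) : ℕ := if h : i < Y.card then Y.orderEmbOfFin rfl ⟨i, h⟩ else 0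

theorem enum_lt_enum {Y : Finset ℕ} {i j : ℕ} (hij : i < j) (hj : j < Y.card) :
    enum Y i < enum Y j := by
  simp [enum, hj, hij.trans hj, hij]

theorem enum_mem {Y : Finset ℕ} {i : ℕ} (hi : i < Y.card) : enum Y i ∈ Y := by
  simp [enum, hi]

theorem exists_enum_eq {Y : Finset ℕ} {a : ℕ} (ha : a ∈ Y) : ∃ i < Y.card, enum Y i = a := by
  have : a ∈ Set.range (Y.orderEmbOfFin rfl) := by simpa using ha
  obtain ⟨⟨i, hi⟩, h⟩ := this
  exact ⟨i, hi, by simp [enum, hi, h]⟩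

theorem le_iff_lt_card {m : ℕ} {y : ℕ → ℕ} (hy : ∀ i j, i < j → j < m → y i < y j) (z : ℕ) :
    ((Finset.range m).filter (y · ≤ z)).card ≤ m ∧
      ∀ i < m, y i ≤ z ↔ i < ((Finset.range m).filter (y · ≤ z)).card := by
  obtain ⟨r, hr, h⟩ : ∃ r ≤ m, ∀ i < m, y i ≤ z ↔ i < r := by
    induction m with
    | zero => exact ⟨0, le_rfl, by simp⟩
    | succ m ih =>
      obtain ⟨r, hr, h⟩ := ih fun i j h1 h2 => hy i j h1 (by omega)
      by_cases hz : y m ≤ z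
      · refine ⟨m + 1, le_rfl, fun i hi => ⟨fun _ => hi, fun _ => ?_⟩⟩
        rcases Nat.lt_succ_iff_lt_or_eq.1 hi with hi | rfl
        · exact (hy i m hi (by omega)).le.trans hz
        · exact hz
      · refine ⟨r, by omega, fun i hi => ?_⟩
        rcases Nat.lt_succ_iff_lt_or_eq.1 hi with hi | rfl
        · exact h i hi
        · constructor <;> intro <;> omega
  have : (Finset.range m).filter (y · ≤ z) = Finset.range r := by
    ext i
    simp only [Finset.mem_filter, Finset.mem_range]
    exact ⟨fun hi => (h i hi.1).1 hi.2, fun hi => ⟨by omega, (h i (by omega)).2 hi⟩⟩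
  rw [this, Finset.card_range]
  exact ⟨hr, h⟩

/-- The rank of `z` in the sequence with code `dsc` that starts at `base` in the array `seg`. -/
def stage (o seg : ℕ) (base dsc z : Expr) : Expr :=
  .load (o + 2) (.op .add (.op .mul (.op .add (.op .mul dsc (.load o (.const 0)))
    (.load seg (.op .add base (.load (o + 1) (.op .add (.op .mul dsc (.load o (.const 0))) z)))))
    (.load o (.const 0))) z)

/-- The search along the levels of a trie, with `s` chunks left. -/
def query (o : ℕ) : ℕ → Expr → Expr → Expr
  | 0, h, _ => h
  | s + 1, h, d =>
    -- Three global arrays precede seven arrays per level: chunks, group leaders, code of the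
    -- leaders, codes of the groups, value before the first chunk, value after each chunk, and
    -- handle of each child. Entry `s + 2` of the parameters is the shift `δ * s`.
    let g := o + 3 + s * 7
    let z := .op .mod (.op .shr d (.load o (.const (s + 2)))) (.load o (.const 0))
    let q := .op .sub (stage o (g + 1) h (.load (g + 2) h) z) (.const 1)
    let b := .op .add h (.op .mul q (.load o (.const 1)))
    let e := .op .sub (.op .add b (stage o g b (.load (g + 3) (.op .add h q)) z)) (.const 1)
    .ifLt z (.load g h) (.load (g + 4) h)
      (.ifEq (.load g e) z (query o s (.load (g + 6) e) d) (.load (g + 5) e))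

/-- The numbers that the programs take from memory. -/
def parameters (w δ B D : ℕ) : List (BitVec w) :=
  tab w (D + 2) fun i => if i = 0 then 2 ^ δ else if i = 1 then B else δ * (i - 2)

def candTable (w δ : ℕ) (cand : ℕ → ℕ → ℕ) : List (BitVec w) :=
  tab w (2 ^ (2 * δ)) fun x => cand (x / 2 ^ δ) (x % 2 ^ δ)

def rankTable (w δ : ℕ) (rank : ℕ → ℕ → ℕ → ℕ) : List (BitVec w) :=
  tab w (2 ^ (3 * δ)) fun x => rank (x / 2 ^ δ / 2 ^ δ) (x / 2 ^ δ % 2 ^ δ) (x % 2 ^ δ)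

theorem mul_add_lt {a b P Q : ℕ} (ha : a < Q) (hb : b < P) : a * P + b < Q * P := by
  calc a * P + b < a * P + P := by omega
    _ = (a + 1) * P := by ring
    _ ≤ Q * P := Nat.mul_le_mul_right _ ha

theorem Params.pow_le {δ B D n w : ℕ} (hp : Params δ B D n w) {i : ℕ} (hi : i ≤ 3) :
    2 ^ (i * δ) ≤ n :=
  (Nat.pow_le_pow_right (by norm_num) (Nat.mul_le_mul_right _ hi)).trans hp.table_le

theorem Params.lt_pow {δ B D n w : ℕ} (hp : Params δ B D n w) : B < 2 ^ δ := by
  have h1 := hp.code_le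
  have h2 : 0 < (δ + 1) ^ B := by positivity
  nlinarith

theorem Params.ev_chunk {δ B D n w : ℕ} (hp : Params δ B D n w) {m : Memory w} {ρ : ℕ → ℕ} {o : ℕ}
    (h0 : m.array o = parameters w δ B D) : Ev m ρ (.load o (.const 0)) (2 ^ δ) := by
  have h1 := hp.pow_le (show 1 ≤ 3 by norm_num)
  have h2 := hp.lt_word
  have h3 := hp.levels_lt
  rw [one_mul] at h1
  simpa using Ev.load_tab h0 (.const 0 (by positivity)) (by omega) (by simp; omega)

theorem Params.ev_width {δ B D n w : ℕ} (hp : Params δ B D n w) {m : Memory w} {ρ : ℕ → ℕ} {o : ℕ}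
    (h0 : m.array o = parameters w δ B D) : Ev m ρ (.load o (.const 1)) B := by
  have h1 := hp.pow_le (show 1 ≤ 3 by norm_num)
  have h2 := hp.lt_word
  have h3 := hp.levels_lt
  have h4 := hp.lt_pow
  rw [one_mul] at h1
  simpa using Ev.load_tab h0 (.const 1 (by omega)) (by omega) (by simp; omega)

theorem Params.ev_shift {δ B D n w : ℕ} (hp : Params δ B D n w) {m : Memory w} {ρ : ℕ → ℕ} {o : ℕ}
    (h0 : m.array o = parameters w δ B D) {s : ℕ} (hs : s < D) :
    Ev m ρ (.load o (.const (s + 2))) (δ * s) := by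
  have h3 := hp.levels_lt
  have h4 : δ * s ≤ δ * D := Nat.mul_le_mul_left _ hs.le
  have h5 := hp.shift_lt
  simpa using Ev.load_tab h0 (.const (s + 2) (by omega)) (by omega) (by simp; omega)

/-- The first table names a candidate, one access fetches this key, and the second table turns it
into the rank. Code, key and query are `δ`-bit digits of the table index, so the index stays below
`2 ^ (3 * δ) ≤ n` and cannot overflow. -/
theorem ev_stage {δ B D n w : ℕ} (hp : Params δ B D n w) {code : ℕ → (ℕ → ℕ) → ℕ}
    {cand : ℕ → ℕ → ℕ} {rank : ℕ → ℕ → ℕ → ℕ}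
    (htab : ∀ (m : ℕ) (y : ℕ → ℕ), 0 < m → m ≤ B →
      (∀ i j, i < j → j < m → y i < y j) → (∀ i < m, y i < 2 ^ δ) →
      code m y < (B + 1) * (δ + 1) ^ B ∧
      ∀ z, cand (code m y) z < m ∧
        rank (code m y) (y (cand (code m y) z)) z = ((Finset.range m).filter (y · ≤ z)).card)
    {m : Memory w} {ρ : ℕ → ℕ} {o seg : ℕ} (h0 : m.array o = parameters w δ B D)
    (h1 : m.array (o + 1) = candTable w δ cand) (h2 : m.array (o + 2) = rankTable w δ rank)
    {f : ℕ → ℕ} (hf : m.array seg = tab w n f) {b k : ℕ} {y : ℕ → ℕ} (hk : 0 < k) (hkB : k ≤ B)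
    (hb : b + k ≤ n) (hy : ∀ i j, i < j → j < k → y i < y j) (hyδ : ∀ i < k, y i < 2 ^ δ)
    (hfy : ∀ i < k, f (b + i) = y i) {eb ec ez : Expr} {z : ℕ} (hz : z < 2 ^ δ)
    (heb : Ev m ρ eb b) (hec : Ev m ρ ec (code k y)) (hez : Ev m ρ ez z) :
    Ev m ρ (stage o seg eb ec ez) ((Finset.range k).filter (y · ≤ z)).card := by
  obtain ⟨t1, t2⟩ := htab k y hk hkB hy hyδ
  obtain ⟨t2, t3⟩ := t2 z
  have hc : code k y < 2 ^ δ := t1.trans_le hp.code_le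
  have b1 := hp.pow_le (show 1 ≤ 3 by norm_num)
  have b2 := hp.pow_le (show 2 ≤ 3 by norm_num)
  have b3 := hp.pow_le (show 3 ≤ 3 by norm_num)
  have b4 := hp.lt_word
  have b5 := hp.lt_pow
  have e2 : 2 ^ δ * 2 ^ δ = 2 ^ (2 * δ) := by rw [← pow_add]; congr 1; ring
  have e3 : 2 ^ δ * 2 ^ δ * 2 ^ δ = 2 ^ (3 * δ) := by rw [← pow_add, ← pow_add]; congr 1; ring
  rw [one_mul] at b1
  have l1 : ∀ {u}, u < 2 ^ δ → code k y * 2 ^ δ + u < 2 ^ (2 * δ) := fun hu => by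
    rw [← e2]; exact mul_add_lt hc hu
  have P0 : (0 : ℕ) < 2 ^ δ := by positivity
  have hcand : Ev m ρ (.load (o + 1) (.op .add (.op .mul ec (.load o (.const 0))) ez))
      (cand (code k y) z) := by
    have h := l1 hz
    have := Ev.load_tab (ρ := ρ) h1 (.add (.mul hec (hp.ev_chunk h0) (by omega)) hez (by omega)) h
    rw [Nat.mul_add_mod_of_lt hz, Nat.mul_comm (code k y), Nat.mul_add_div P0,
      Nat.div_eq_of_lt hz, add_zero] at this
    exact this (by omega)
  have hkey : Ev m ρ (.load seg (.op .add eb (.load (o + 1) (.op .add (.op .mul ec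
      (.load o (.const 0))) ez)))) (y (cand (code k y) z)) := by
    have hyc := hyδ _ t2
    rw [← hfy _ t2] at hyc ⊢
    exact Ev.load_tab hf (.add heb hcand (by omega)) (by omega) (by omega)
  set x := y (cand (code k y) z) with hx
  have hxδ : x < 2 ^ δ := hyδ _ t2
  have h := l1 hxδ
  have h' : (code k y * 2 ^ δ + x) * 2 ^ δ + z < 2 ^ (3 * δ) := by
    rw [← e3, e2]; exact mul_add_lt h hz
  have := Ev.load_tab (ρ := ρ) h2 (.add (.mul (.add (.mul hec (hp.ev_chunk h0) (by omega)) hkey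
    (by omega)) (hp.ev_chunk h0) (by omega)) hez (by omega)) h'
  have q1 : ((code k y * 2 ^ δ + x) * 2 ^ δ + z) / 2 ^ δ = code k y * 2 ^ δ + x := by
    rw [Nat.mul_comm _ (2 ^ δ), Nat.mul_add_div P0, Nat.div_eq_of_lt hz, add_zero]
  have q2 : (code k y * 2 ^ δ + x) / 2 ^ δ = code k y := by
    rw [Nat.mul_comm _ (2 ^ δ), Nat.mul_add_div P0, Nat.div_eq_of_lt hxδ, add_zero]
  rw [q1, q2, Nat.mul_add_mod_of_lt hz, Nat.mul_add_mod_of_lt hxδ, t3] at this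
  refine this ?_
  have := (le_iff_lt_card hy z).1
  omega

end Fusion

/-! ### Tries of constant depth for families of step functions -/

namespace Fusion

variable {ι : Type*}

/-- The keys of a job with a given prefix, when `s` chunks are left. -/
def keysAt (δ : ℕ) (K : ι → Finset ℕ) (s : ℕ) (a : (_ : ι) × ℕ) : Finset ℕ :=
  (K a.1).filter fun x => x / 2 ^ (δ * s) = a.2

/-- The chunks that continue a given prefix, when `s + 1` chunks are left. -/
def chunks (δ : ℕ) (K : ι → Finset ℕ) (s : ℕ) (a : (_ : ι) × ℕ) : Finset ℕ :=
  (keysAt δ K (s + 1) a).image fun x => x / 2 ^ (δ * s) % 2 ^ δ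

/-- The nodes of the tries with `s + 1` chunks left. -/
def nodes (δ : ℕ) (J : Finset ι) (K : ι → Finset ℕ) (s : ℕ) : Finset ((_ : ι) × ℕ) :=
  J.sigma fun j => (K j).image fun x => x / 2 ^ (δ * (s + 1))

theorem card_chunks_le (δ : ℕ) (K : ι → Finset ℕ) (s : ℕ) (a : (_ : ι) × ℕ) :
    (chunks δ K s a).card ≤ (K a.1).card :=
  Finset.card_image_le.trans (Finset.card_filter_le _ _)

/-- The keys of a job are partitioned by their prefixes, and a trie node has at most as many
outgoing chunks as keys with its prefix. Hence each level of all tries together fits into one array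
with a cell per key. -/
theorem sum_card_chunks_le (δ : ℕ) (J : Finset ι) (K : ι → Finset ℕ) (s : ℕ) :
    ∑ a ∈ nodes δ J K s, (chunks δ K s a).card ≤ ∑ j ∈ J, (K j).card := by
  rw [nodes, Finset.sum_sigma]
  refine Finset.sum_le_sum fun j _ => ?_
  rw [Finset.card_eq_sum_card_image (fun x => x / 2 ^ (δ * (s + 1))) (K j)]
  exact Finset.sum_le_sum fun p _ => Finset.card_image_le

theorem div_pow_mul_succ (δ s x : ℕ) : x / 2 ^ (δ * (s + 1)) = x / 2 ^ (δ * s) / 2 ^ δ := by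
  rw [Nat.div_div_eq_div_mul, ← pow_add, mul_add, mul_one]

theorem div_pow_eq (δ s x : ℕ) :
    x / 2 ^ (δ * s) = x / 2 ^ (δ * (s + 1)) * 2 ^ δ + x / 2 ^ (δ * s) % 2 ^ δ := by
  rw [div_pow_mul_succ, Nat.div_add_mod']

theorem chunks_lt {δ : ℕ} {K : ι → Finset ℕ} {s : ℕ} {a : (_ : ι) × ℕ} {y : ℕ}
    (hy : y ∈ chunks δ K s a) : y < 2 ^ δ := by
  obtain ⟨x, -, rfl⟩ := Finset.mem_image.1 hy
  exact Nat.mod_lt _ (by positivity)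

theorem nonempty_of_mem_chunks {δ : ℕ} {K : ι → Finset ℕ} {s : ℕ} {a : (_ : ι) × ℕ} {y : ℕ}
    (hy : y ∈ chunks δ K s a) : (keysAt δ K s ⟨a.1, a.2 * 2 ^ δ + y⟩).Nonempty := by
  obtain ⟨x, hx, rfl⟩ := Finset.mem_image.1 hy
  obtain ⟨h1, h2⟩ := Finset.mem_filter.1 hx
  exact ⟨x, Finset.mem_filter.2 ⟨h1, by rw [div_pow_eq δ s x, h2]; simp⟩⟩

theorem mem_nodes_of_nonempty {δ : ℕ} {J : Finset ι} {K : ι → Finset ℕ} {s : ℕ} {j : ι} {p : ℕ}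
    (hj : j ∈ J) (h : (keysAt δ K (s + 1) ⟨j, p⟩).Nonempty) : (⟨j, p⟩ : (_ : ι) × ℕ) ∈ nodes δ J K s := by
  obtain ⟨x, hx⟩ := h
  obtain ⟨h1, h2⟩ := Finset.mem_filter.1 hx
  simp only [nodes, Finset.mem_sigma, Finset.mem_image]
  exact ⟨hj, x, h1, h2⟩

/-- Numbers in a gap between chunks have the same smaller keys. -/
theorem lt_iff_of_gap {δ : ℕ} {K : ι → Finset ℕ} {s : ℕ} {j : ι} {d u : ℕ}
    (hu : u ≤ d / 2 ^ (δ * s) % 2 ^ δ)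
    (hgap : ∀ c ∈ chunks δ K s ⟨j, d / 2 ^ (δ * (s + 1))⟩, ¬ (u ≤ c ∧ c ≤ d / 2 ^ (δ * s) % 2 ^ δ))
    (x : ℕ) (hx : x ∈ K j) :
    x < (d / 2 ^ (δ * (s + 1)) * 2 ^ δ + u) * 2 ^ (δ * s) ↔ x < d + 1 := by
  have P0 : 0 < 2 ^ (δ * s) := by positivity
  have hd := div_pow_eq δ s d
  have hxe := div_pow_eq δ s x
  rw [← Nat.div_lt_iff_lt_mul P0]
  constructor
  · intro h
    by_contra h'
    have := Nat.div_le_div_right (c := 2 ^ (δ * s)) (show d ≤ x by omega)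
    by_cases hq : x / 2 ^ (δ * (s + 1)) = d / 2 ^ (δ * (s + 1))
    · refine hgap (x / 2 ^ (δ * s) % 2 ^ δ) (Finset.mem_image_of_mem _
        (Finset.mem_filter.2 ⟨hx, hq⟩)) ⟨?_, ?_⟩ <;> rw [hq] at hxe <;> omega
    · have h1 := Nat.div_le_div_right (c := 2 ^ (δ * (s + 1))) (show d ≤ x by omega)
      have h2 : (d / 2 ^ (δ * (s + 1)) + 1) * 2 ^ δ ≤ x / 2 ^ (δ * (s + 1)) * 2 ^ δ :=
        Nat.mul_le_mul_right _ (by omega)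
      rw [add_mul] at h2
      have := Nat.mod_lt (d / 2 ^ (δ * s)) (show 0 < 2 ^ δ by positivity)
      omega
  · intro h
    by_contra h'
    have h1 := Nat.div_le_div_right (c := 2 ^ (δ * s)) (show x ≤ d by omega)
    have h2 := Nat.div_le_div_right (c := 2 ^ (δ * (s + 1))) (show x ≤ d by omega)
    have hq : x / 2 ^ (δ * (s + 1)) = d / 2 ^ (δ * (s + 1)) := by
      refine le_antisymm h2 ?_
      rw [div_pow_mul_succ, div_pow_mul_succ]
      calc d / 2 ^ (δ * s) / 2 ^ δ ≤ (d / 2 ^ (δ * (s + 1)) * 2 ^ δ + u) / 2 ^ δ := by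
            rw [Nat.mul_comm (d / 2 ^ (δ * (s + 1))) (2 ^ δ), Nat.mul_add_div (by positivity),
              div_pow_mul_succ]
            exact Nat.le_add_right _ _
        _ ≤ _ := Nat.div_le_div_right (by omega)
    refine hgap (x / 2 ^ (δ * s) % 2 ^ δ) (Finset.mem_image_of_mem _
        (Finset.mem_filter.2 ⟨hx, hq⟩)) ⟨?_, ?_⟩ <;> rw [hq] at hxe <;> omega

/-- The arrays for the trie nodes with `s + 1` chunks left; `val a y` is the value for the edge with
chunk `y` at the node `a`. -/
def level (w n δ B : ℕ) (K : ι → Finset ℕ) (F : ι → ℕ → ℕ) (code : ℕ → (ℕ → ℕ) → ℕ) (s : ℕ)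
    (owner : ℕ → Option (((_ : ι) × ℕ) × ℕ)) (val : ((_ : ι) × ℕ) → ℕ → ℕ) : Memory w :=
  [tab w n (blocks owner fun a i => enum (chunks δ K s a) i),
   tab w n (blocks owner fun a i => enum (chunks δ K s a) (i * B)),
   tab w n (blocks owner fun a _ => code (((chunks δ K s a).card + B - 1) / B)
      fun k => enum (chunks δ K s a) (k * B)),
   tab w n (blocks owner fun a i => code (min B ((chunks δ K s a).card - i * B))
      fun k => enum (chunks δ K s a) (i * B + k)),
   tab w n (blocks owner fun a _ => F a.1 (a.2 * 2 ^ δ * 2 ^ (δ * s))),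
   tab w n (blocks owner fun a i =>
      F a.1 ((a.2 * 2 ^ δ + (enum (chunks δ K s a) i + 1)) * 2 ^ (δ * s))),
   tab w n (blocks owner fun a i => val a (enum (chunks δ K s a) i))]

/-- One step of the search: the trie node `a` is left through an edge or through a gap. -/
theorem ev_query_succ {δ B D n w : ℕ} (hp : Params δ B D n w) {code : ℕ → (ℕ → ℕ) → ℕ}
    {cand : ℕ → ℕ → ℕ} {rank : ℕ → ℕ → ℕ → ℕ}
    (htab : ∀ (m : ℕ) (y : ℕ → ℕ), 0 < m → m ≤ B →
      (∀ i j, i < j → j < m → y i < y j) → (∀ i < m, y i < 2 ^ δ) →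
      code m y < (B + 1) * (δ + 1) ^ B ∧
      ∀ z, cand (code m y) z < m ∧
        rank (code m y) (y (cand (code m y) z)) z = ((Finset.range m).filter (y · ≤ z)).card)
    {K : ι → Finset ℕ} {F : ι → ℕ → ℕ} {s : ℕ} {owner : ℕ → Option (((_ : ι) × ℕ) × ℕ)}
    {val : ((_ : ι) × ℕ) → ℕ → ℕ} {base : ((_ : ι) × ℕ) → ℕ} {a : (_ : ι) × ℕ}
    (howner : ∀ i < (chunks δ K s a).card, owner (base a + i) = some (a, i))
    (hbase : base a + (chunks δ K s a).card ≤ n)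
    (hne : 0 < (chunks δ K s a).card) (hBB : (chunks δ K s a).card ≤ B * B)
    {m : Memory w} {ρ : ℕ → ℕ} {o : ℕ} (h0 : m.array o = parameters w δ B D)
    (h1 : m.array (o + 1) = candTable w δ cand) (h2 : m.array (o + 2) = rankTable w δ rank)
    (hlev : Slice m (o + 3 + s * 7) (level w n δ B K F code s owner val))
    (hF : ∀ e, F a.1 e < 2 ^ w)
    (hval : ∀ y ∈ chunks δ K s a, val a y < 2 ^ w)
    {eh ed : Expr} {d z : ℕ} (hs : s < D) (heh : Ev m ρ eh (base a))
    (hed : Ev m ρ ed d) (hz : z = d / 2 ^ (δ * s) % 2 ^ δ) {r : ℕ}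
    (hlow : (∀ c ∈ chunks δ K s a, z < c) → F a.1 (a.2 * 2 ^ δ * 2 ^ (δ * s)) = r)
    (hgap : ∀ y ∈ chunks δ K s a, y < z → (∀ c ∈ chunks δ K s a, c ≤ z → c ≤ y) →
      F a.1 ((a.2 * 2 ^ δ + (y + 1)) * 2 ^ (δ * s)) = r)
    (hedge : z ∈ chunks δ K s a → ∀ e, Ev m ρ e (val a z) → Ev m ρ (query o s e ed) r) :
    Ev m ρ (query o (s + 1) eh ed) r := by
  set Y := chunks δ K s a with hY
  set b := base a with hb
  have a0 := hlev.array' 0 rfl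
  have a1 := hlev.array' 1 rfl
  have a2 := hlev.array' 2 rfl
  have a3 := hlev.array' 3 rfl
  have a4 := hlev.array' 4 rfl
  have a5 := hlev.array' 5 rfl
  have a6 := hlev.array' 6 rfl
  rw [add_zero] at a0
  have hw := hp.lt_word
  have hP := hp.pow_le (show 1 ≤ 3 by norm_num)
  rw [one_mul] at hP
  have hBpos := hp.pos
  have hBlt := hp.lt_pow
  have hzδ : z < 2 ^ δ := by rw [hz]; exact Nat.mod_lt _ (by positivity)
  have hYδ : ∀ i < Y.card, enum Y i < 2 ^ δ := fun i hi => chunks_lt (enum_mem hi)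
  have hblk : ∀ (f : ((_ : ι) × ℕ) → ℕ → ℕ), ∀ i < Y.card, blocks owner f (b + i) = f a i :=
    fun f i hi => blocks_eq (howner i hi)
  have hblk0 : ∀ (f : ((_ : ι) × ℕ) → ℕ → ℕ), blocks owner f b = f a 0 := fun f => hblk f 0 hne
  have ez : Ev m ρ (.op .mod (.op .shr ed (.load o (.const (s + 2)))) (.load o (.const 0))) z := by
    rw [hz]
    exact (hed.shr (hp.ev_shift h0 hs)).mod (hp.ev_chunk h0)
  have e0 : Ev m ρ (.load (o + 3 + s * 7) eh) (enum Y 0) := by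
    have := Ev.load_tab a0 heh (by omega) (by
      rw [hblk0]; exact (hYδ 0 hne).trans_le (by omega))
    rwa [hblk0] at this
  have e4 : Ev m ρ (.load (o + 3 + s * 7 + 4) eh) (F a.1 (a.2 * 2 ^ δ * 2 ^ (δ * s))) := by
    have := Ev.load_tab a4 heh (by omega) (by rw [hblk0]; exact hF _)
    rwa [hblk0] at this
  refine Ev.ifLt ez e0 (fun hlt => ?_) fun hle => ?_
  · rw [hlow] at e4
    · exact e4
    · intro c hc
      obtain ⟨i, hi, rfl⟩ := exists_enum_eq hc
      rcases Nat.eq_zero_or_pos i with rfl | h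
      · exact hlt
      · exact hlt.trans (enum_lt_enum h hi)
  rw [not_lt] at hle
  -- the number of groups of `B` keys
  set G := (Y.card + B - 1) / B with hG
  have G1 : ∀ {k}, k < G ↔ k * B < Y.card := by
    intro k
    rw [hG, ← Nat.succ_le_iff, Nat.le_div_iff_mul_le hBpos, Nat.succ_mul]
    omega
  have G2 : 0 < G := G1.2 (by omega)
  -- This is where `card ≤ B * B` enters: two rounds of width `B` suffice.
  have G3 : G ≤ B := by
    by_contra h
    have := G1.1 (not_le.1 h)
    omega
  have G4 : G ≤ Y.card := by
    by_contra h
    have := G1.1 (not_le.1 h)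
    nlinarith
  have e2 : Ev m ρ (.load (o + 3 + s * 7 + 2) eh) (code G fun k => enum Y (k * B)) := by
    have := Ev.load_tab a2 heh (by omega) (by
      rw [hblk0]
      change code G (fun k => enum Y (k * B)) < 2 ^ w
      have := (htab G (fun k => enum Y (k * B)) G2 G3 (fun i j hij hj => enum_lt_enum
        (Nat.mul_lt_mul_of_pos_right hij hBpos) (G1.1 hj)) fun i hi => hYδ _ (G1.1 hi)).1
      have := hp.code_le
      omega)
    rwa [hblk0] at this
  have s1 := ev_stage hp htab h0 h1 h2 a1 G2 G3 (by omega) (fun i j hij hj => enum_lt_enum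
        (Nat.mul_lt_mul_of_pos_right hij hBpos) (G1.1 hj)) (fun i hi => hYδ _ (G1.1 hi))
        (fun i hi => hblk _ i (by omega)) hzδ heh e2 ez
  obtain ⟨c1, c2⟩ := le_iff_lt_card (m := G) (y := fun k => enum Y (k * B)) (fun i j hij hj =>
    enum_lt_enum (Nat.mul_lt_mul_of_pos_right hij hBpos) (G1.1 hj)) z
  set r₁ := ((Finset.range G).filter fun k => enum Y (k * B) ≤ z).card with hr₁
  -- The smallest chunk is the first leader and is at most `z`, so the ranks in both rounds are
  -- positive and subtracting one gives the last position at most `z`.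
  have r₁pos : 0 < r₁ := (c2 0 G2).1 (by simpa using hle)
  have eq := s1.sub (.const 1 (by omega)) r₁pos
  obtain ⟨q, hq⟩ : ∃ q, r₁ = q + 1 := ⟨r₁ - 1, by omega⟩
  rw [hq, Nat.add_sub_cancel] at eq
  have qG : q < G := by omega
  have qY := G1.1 qG
  have eb := heh.add (eq.mul (hp.ev_width h0) (by omega)) (by omega)
  set k := min B (Y.card - q * B) with hk
  have hk0 : 0 < k := by omega
  have hmono : ∀ i j, i < j → j < k → enum Y (q * B + i) < enum Y (q * B + j) :=
    fun i j hij hj => enum_lt_enum (by omega) (by omega)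
  have hYδ' : ∀ i < k, enum Y (q * B + i) < 2 ^ δ := fun i hi => hYδ _ (by omega)
  have e3 : Ev m ρ (.load (o + 3 + s * 7 + 3) (.op .add eh (.op .sub (stage o (o + 3 + s * 7 + 1) eh
      (.load (o + 3 + s * 7 + 2) eh) (.op .mod (.op .shr ed (.load o (.const (s + 2))))
      (.load o (.const 0)))) (.const 1)))) (code k fun i => enum Y (q * B + i)) := by
    have hqY : q < Y.card := by omega
    have := Ev.load_tab a3 (heh.add eq (by omega)) (by omega) (by
      rw [hblk _ _ hqY]
      change code k (fun i => enum Y (q * B + i)) < 2 ^ w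
      have := (htab k (fun i => enum Y (q * B + i)) hk0 (by omega) hmono hYδ').1
      have := hp.code_le
      omega)
    rwa [hblk _ _ hqY] at this
  have s2 := ev_stage hp htab h0 h1 h2 a0 hk0 (by omega) (by omega) hmono hYδ'
    (fun i hi => by rw [add_assoc, hblk _ _ (by omega)]) hzδ eb e3 ez
  obtain ⟨c3, c4⟩ := le_iff_lt_card hmono z
  set r₂ := ((Finset.range k).filter fun i => enum Y (q * B + i) ≤ z).card with hr₂
  have r₂pos : 0 < r₂ := (c4 0 hk0).1 (by simpa using (c2 q qG).2 (by omega))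
  have ee := (eb.add s2 (by omega)).sub (.const 1 (by omega)) (by omega)
  obtain ⟨r', hr'⟩ : ∃ r', r₂ = r' + 1 := ⟨r₂ - 1, by omega⟩
  set e := q * B + r' with he
  rw [show b + q * B + r₂ - 1 = b + e by omega] at ee
  have heY : e < Y.card := by omega
  have hele : enum Y e ≤ z := (c4 r' (by omega)).2 (by omega)
  have hmax : ∀ c ∈ Y, c ≤ z → c ≤ enum Y e := by
    intro c hc hcz
    obtain ⟨i, hi, rfl⟩ := exists_enum_eq hc
    by_contra hlt
    have hei : e < i := by
      by_contra hie
      rcases (not_lt.1 hie).eq_or_lt with rfl | h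
      · exact hlt le_rfl
      · exact hlt (enum_lt_enum h heY).le
    have hle' : ∀ i', i' ≤ i → enum Y i' ≤ z := by
      intro i' hi'
      rcases hi'.eq_or_lt with rfl | h
      · exact hcz
      · exact (enum_lt_enum h hi).le.trans hcz
    -- A larger chunk that is at most `z` would put either the next chunk of the group into the
    -- count `r₂`, or, if the group is exhausted, the next leader into the count `r₁`.
    by_cases hr'k : r' + 1 < k
    · have := (c4 (r' + 1) hr'k).1 (hle' _ (by omega))
      omega
    · have hq1 : (q + 1) * B ≤ i := by rw [add_mul]; omega
      have hq2 : q + 1 < G := G1.2 (by omega)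
      have := (c2 (q + 1) hq2).1 (hle' _ hq1)
      omega
  have f0 := Ev.load_tab a0 ee (by omega) (by
    rw [hblk _ _ heY]; exact (hYδ _ heY).trans_le (by omega))
  rw [hblk _ _ heY] at f0
  have f5 := Ev.load_tab a5 ee (by omega) (by rw [hblk _ _ heY]; exact hF _)
  rw [hblk _ _ heY] at f5
  have f6 := Ev.load_tab a6 ee (by omega) (by rw [hblk _ _ heY]; exact hval _ (enum_mem heY))
  rw [hblk _ _ heY] at f6
  refine Ev.ifEq f0 ez (fun heq => ?_) fun hneq => ?_
  · have f6' := f6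
    rw [← hY, heq] at f6'
    exact hedge (heq ▸ enum_mem heY) _ f6'
  · rw [← hY, hgap _ (enum_mem heY) (lt_of_le_of_ne hele hneq) hmax] at f5
    exact f5

/-- The handle of a prefix when `s` chunks are left: the position of its trie node, or the
value if nothing is left. -/
def handle (F : ι → ℕ → ℕ) (base : ℕ → ((_ : ι) × ℕ) → ℕ) : ℕ → ((_ : ι) × ℕ) → ℕ
  | 0, a => F a.1 (a.2 + 1)
  | s + 1, a => base s a

/-- A family of step functions `F j`, the steps of `F j` being among the keys `K j`, can be stored
in linear space and evaluated in constant time, if the sets of keys are small. -/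
theorem exists_rank_structure {δ B D n w : ℕ} (hp : Params δ B D n w) (J : Finset ι)
    (K : ι → Finset ℕ) (F : ι → ℕ → ℕ) (hne : ∀ j ∈ J, (K j).Nonempty)
    (hBB : ∀ j ∈ J, (K j).card ≤ B * B) (hsum : ∑ j ∈ J, (K j).card ≤ n)
    (hK : ∀ j ∈ J, ∀ x ∈ K j, x < 2 ^ w) (hF : ∀ j ∈ J, ∀ e, F j e < 2 ^ w)
    (hstep : ∀ j ∈ J, ∀ e e', (∀ x ∈ K j, x < e ↔ x < e') → F j e = F j e') :
    ∃ (arrs : Memory w) (hd : ι → ℕ), arrs.length = 3 + D * 7 ∧ arrs.size ≤ (D * 8 + 4) * n ∧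
      (∀ j ∈ J, hd j < 2 ^ w) ∧
      ∀ (m : Memory w) (o : ℕ) (ρ : ℕ → ℕ) (eh ed : Expr), Slice m o arrs → ∀ j ∈ J, ∀ d < 2 ^ w,
        Ev m ρ eh (hd j) → Ev m ρ ed d → Ev m ρ (query o D eh ed) (F j (d + 1)) := by
  obtain ⟨code, cand, rank, htab⟩ := exists_tables δ B
  choose base owner g1 g2 g3 using fun s => exists_allocation (nodes δ J K s)
    (fun a => (chunks δ K s a).card) n ((sum_card_chunks_le δ J K s).trans hsum)
  -- An edge carries the position of the child's block one level down; an edge of the last level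
  -- carries the final value itself.
  let val : ℕ → ((_ : ι) × ℕ) → ℕ → ℕ := fun s a y => handle F base s ⟨a.1, a.2 * 2 ^ δ + y⟩
  let lev : ℕ → Memory w := fun s => level w n δ B K F code s (owner s) (val s)
  have hnodes : ∀ s j p, j ∈ J → (keysAt δ K (s + 1) ⟨j, p⟩).Nonempty →
      base s ⟨j, p⟩ + (chunks δ K s ⟨j, p⟩).card ≤ n ∧ 0 < (chunks δ K s ⟨j, p⟩).card :=
    fun s j p hj h => ⟨g3 s _ (mem_nodes_of_nonempty hj h), Finset.card_pos.2 (h.image _)⟩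
  have hhandle : ∀ s j p, j ∈ J → (keysAt δ K s ⟨j, p⟩).Nonempty →
      handle F base s ⟨j, p⟩ < 2 ^ w := by
    intro s j p hj h
    cases s with
    | zero => exact hF j hj _
    | succ s =>
      have := hnodes s j p hj h
      have := hp.lt_word
      simp only [handle]
      omega
  -- Since `w ≤ δ * D`, every word has the empty prefix 0 when `D` chunks are left, so the search
  -- starts at the root of the trie.
  have hK0 : ∀ j ∈ J, ∀ d < 2 ^ w, (keysAt δ K D ⟨j, d / 2 ^ (δ * D)⟩).Nonempty := by
    intro j hj d hd
    obtain ⟨x, hx⟩ := hne j hj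
    have h2 : (2 : ℕ) ^ w ≤ 2 ^ (δ * D) := Nat.pow_le_pow_right (by norm_num) hp.word_le
    refine ⟨x, Finset.mem_filter.2 ⟨hx, ?_⟩⟩
    dsimp only
    rw [Nat.div_eq_of_lt, Nat.div_eq_of_lt]
    · omega
    · exact (hK j hj x hx).trans_le h2
  refine ⟨[parameters w δ B D, candTable w δ cand, rankTable w δ rank] ++
    ((List.range D).map lev).flatten, fun j => handle F base D ⟨j, 0⟩, ?_, ?_, ?_, ?_⟩
  · rw [List.length_append, List.length_flatten]
    simp [lev, level, Function.comp_def]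
  · rw [Memory.size_append]
    have h1 : Memory.size ((List.range D).map lev).flatten ≤ D * (7 * n) := by
      refine (Memory.size_flatten (c := 7 * n) ?_).trans (by simp)
      simp only [List.mem_map, forall_exists_index, and_imp]
      rintro x s - rfl
      simp [lev, level, Memory.size]
      omega
    have h2 : Memory.size [parameters w δ B D, candTable w δ cand, rankTable w δ rank] =
        D + 2 + 2 ^ (2 * δ) + 2 ^ (3 * δ) := by
      simp [Memory.size, parameters, candTable, rankTable]
      omega
    have h3 := hp.pow_le (show 2 ≤ 3 by norm_num)
    have h4 := hp.table_le
    have h5 : 0 < 2 ^ (3 * δ) := by positivity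
    nlinarith
  · intro j hj
    have := hhandle D j _ hj (hK0 j hj 0 (by positivity))
    rwa [Nat.zero_div] at this
  · intro m o ρ eh ed hm j hj d hd heh hed
    have q0 := hm.left.array' 0 rfl
    have q1 := hm.left.array' 1 rfl
    have q2 := hm.left.array' 2 rfl
    rw [add_zero] at q0
    -- Invariant: the handle belongs to the prefix of `d`, and some key has this prefix. If the next
    -- chunk of `d` is missing, no key lies between `d` and the edge of the gap, and `hstep` makes
    -- the stored value correct.
    have key : ∀ s ≤ D, ∀ eh, (keysAt δ K s ⟨j, d / 2 ^ (δ * s)⟩).Nonempty →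
        Ev m ρ eh (handle F base s ⟨j, d / 2 ^ (δ * s)⟩) →
        Ev m ρ (query o s eh ed) (F j (d + 1)) := by
      intro s
      induction s with
      | zero =>
        intro _ eh _ h
        simpa [handle, query] using h
      | succ s ih =>
        intro hs eh hn h
        have hz := div_pow_eq δ s d
        obtain ⟨n1, n2⟩ := hnodes s j _ hj hn
        have hlev : Slice m (o + 3 + s * 7) (lev s) :=
          (hm.right rfl).flatten (A := 7) (i := s) (by simp [lev, level])
            (by simp [show s < D by omega])
        refine ev_query_succ hp htab (g1 s _ (mem_nodes_of_nonempty hj hn)) n1 n2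
          ((card_chunks_le _ _ _ _).trans (hBB j hj)) q0 q1 q2 hlev (hF j hj)
          (fun y hy => hhandle s j _ hj (nonempty_of_mem_chunks hy)) (show s < D by omega)
          h hed rfl
          (fun hlow => ?_) (fun y hy hyz hmax => ?_) fun hmem e he => ?_
        · have := hstep j hj _ _ (lt_iff_of_gap (δ := δ) (K := K) (s := s) (j := j) (d := d) (u := 0)
            (Nat.zero_le _) fun c hc hc' => absurd hc'.2 (not_le.2 (hlow c hc)))
          simpa using this
        · exact hstep j hj _ _ (lt_iff_of_gap (δ := δ) (K := K) (s := s) (j := j) (d := d)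
            (u := y + 1) hyz fun c hc hc' => by have := hmax c hc hc'.2; omega)
        · apply ih (by omega)
          · rw [hz]
            exact nonempty_of_mem_chunks hmem
          · rw [hz]
            exact he
    refine key D le_rfl eh (hK0 j hj d hd) ?_
    rw [Nat.div_eq_of_lt (hd.trans_le (Nat.pow_le_pow_right (by norm_num) hp.word_le))]
    exact heh

end Fusion

/-! ## Weighted trees -/

theorem exists_isPredecessor {ι : Type*} [Finite ι] (A : Set ι) (key : ι → ℕ) (d : ℕ) :
    ∃ ans, IsPredecessor A key d ans := by
  by_cases h : ∃ i ∈ A, key i ≤ d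
  · obtain ⟨i, hi⟩ := h
    obtain ⟨j, hj, hmax⟩ := (Set.toFinite {i | i ∈ A ∧ key i ≤ d}).exists_maximalFor key _ ⟨i, hi⟩
    exact ⟨some j, hj.1, hj.2, fun k hk hkd => by
      by_contra h
      exact h (hmax ⟨hk, hkd⟩ (by omega))⟩
  · push Not at h
    exact ⟨none, h⟩

theorem encodeAnswer_lt {n w : ℕ} (h : n < 2 ^ w) (a : Option (Fin n)) : encodeAnswer a < 2 ^ w := by
  cases a with
  | none => exact h
  | some i => exact i.2.trans h

namespace WeightedTree

variable {n : ℕ} (T : WeightedTree n)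

theorem mem_ancestors_self (v : Fin n) : v ∈ T.ancestors v := ⟨0, rfl⟩

theorem root_mem_ancestors (v : Fin n) : T.root ∈ T.ancestors v := T.reaches_root v

variable {T} {a b u v : Fin n}

theorem mem_ancestors_trans (h₁ : a ∈ T.ancestors b) (h₂ : b ∈ T.ancestors v) :
    a ∈ T.ancestors v := by
  obtain ⟨k, rfl⟩ := h₂
  obtain ⟨l, rfl⟩ := h₁
  exact ⟨l + k, Function.iterate_add_apply _ _ _ _⟩

theorem parent_mem_ancestors (h : a ∈ T.ancestors v) : T.parent a ∈ T.ancestors v :=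
  mem_ancestors_trans ⟨1, rfl⟩ h

theorem mem_ancestors_parent (h : a ∈ T.ancestors v) (hne : a ≠ v) :
    a ∈ T.ancestors (T.parent v) := by
  obtain ⟨k, rfl⟩ := h
  cases k with
  | zero => exact (hne rfl).elim
  | succ k => exact ⟨k, rfl⟩

theorem weight_parent_le (v : Fin n) : T.weight (T.parent v) ≤ T.weight v := by
  by_cases h : v = T.root
  · rw [h, T.parent_root]
  · exact (T.weight_parent_lt v h).le

theorem weight_le (h : a ∈ T.ancestors v) : T.weight a ≤ T.weight v := by
  obtain ⟨k, rfl⟩ := h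
  induction k with
  | zero => exact le_rfl
  | succ k ih =>
    rw [Function.iterate_succ_apply']
    exact (weight_parent_le _).trans ih

theorem mem_ancestors_root (h : a ∈ T.ancestors T.root) : a = T.root := by
  obtain ⟨k, rfl⟩ := h
  exact Function.iterate_fixed T.parent_root k

theorem weight_lt (h : a ∈ T.ancestors v) (hne : a ≠ v) : T.weight a < T.weight v := by
  by_cases hv : v = T.root
  · subst hv
    exact (hne (mem_ancestors_root h)).elim
  · exact (weight_le (mem_ancestors_parent h hne)).trans_lt (T.weight_parent_lt v hv)

theorem ancestors_total (ha : a ∈ T.ancestors v) (hb : b ∈ T.ancestors v) :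
    a ∈ T.ancestors b ∨ b ∈ T.ancestors a := by
  obtain ⟨k, rfl⟩ := ha
  obtain ⟨l, rfl⟩ := hb
  rcases le_total k l with h | h
  · obtain ⟨i, rfl⟩ := Nat.exists_eq_add_of_le' h
    exact .inr ⟨i, (Function.iterate_add_apply _ _ _ _).symm⟩
  · obtain ⟨i, rfl⟩ := Nat.exists_eq_add_of_le' h
    exact .inl ⟨i, (Function.iterate_add_apply _ _ _ _).symm⟩

/-- On the path from a node to the root, the order of weights is the order of ancestors. -/
theorem mem_ancestors_of_weight_le (ha : a ∈ T.ancestors v) (hb : b ∈ T.ancestors v)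
    (h : T.weight a ≤ T.weight b) : a ∈ T.ancestors b := by
  rcases ancestors_total ha hb with h' | h'
  · exact h'
  · by_cases hab : b = a
    · rw [hab]
      exact T.mem_ancestors_self _
    · have := weight_lt h' hab
      omega

theorem exists_child (h : a ∈ T.ancestors v) (hne : a ≠ v) :
    ∃ b ∈ T.ancestors v, T.parent b = a ∧ b ≠ T.root := by
  obtain ⟨k, hk⟩ := h
  induction k generalizing v with
  | zero => exact (hne hk.symm).elim
  | succ k ih =>
    rw [Function.iterate_succ_apply] at hk
    by_cases h : a = T.parent v
    · refine ⟨v, T.mem_ancestors_self v, h.symm, ?_⟩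
      rintro rfl
      exact hne (h.trans T.parent_root)
    · obtain ⟨b, hb, h⟩ := ih h hk
      exact ⟨b, mem_ancestors_trans hb ⟨1, rfl⟩, h⟩

variable (T) in
open Classical in
/-- The nodes of the subtree with root `v`. -/
noncomputable def sub (v : Fin n) : Finset (Fin n) := Finset.univ.filter fun u => v ∈ T.ancestors u

theorem mem_sub : u ∈ T.sub v ↔ v ∈ T.ancestors u := by simp [sub]

theorem sub_subset (h : a ∈ T.ancestors b) : T.sub b ⊆ T.sub a :=
  fun _ hu => mem_sub.2 (mem_ancestors_trans h (mem_sub.1 hu))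

theorem card_sub_le (h : a ∈ T.ancestors b) : (T.sub b).card ≤ (T.sub a).card :=
  Finset.card_le_card (sub_subset h)

theorem sub_root : T.sub T.root = Finset.univ := by
  ext u
  simp [mem_sub, T.root_mem_ancestors u]

theorem disjoint_sub (h₁ : a ∉ T.ancestors b) (h₂ : b ∉ T.ancestors a) :
    Disjoint (T.sub a) (T.sub b) := by
  rw [Finset.disjoint_left]
  intro u ha hb
  rcases ancestors_total (mem_sub.1 ha) (mem_sub.1 hb) with h | h
  · exact h₁ h
  · exact h₂ h

theorem sum_card_sub_le (J : Finset (Fin n))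
    (h : ∀ a ∈ J, ∀ b ∈ J, a ∈ T.ancestors b → a = b) : ∑ a ∈ J, (T.sub a).card ≤ n := by
  rw [← Finset.card_biUnion]
  · exact (Finset.card_le_univ _).trans (by simp)
  · intro a ha b hb hab
    exact disjoint_sub (fun h' => hab (h a ha b hb h')) fun h' => hab (h b hb a ha h').symm

variable (T) in
theorem exists_leaf (v : Fin n) : ∃ l, T.IsLeaf l ∧ v ∈ T.ancestors l := by
  obtain ⟨l, hl, hmax⟩ := Finset.exists_max_image (T.sub v) T.weight
    ⟨v, mem_sub.2 (T.mem_ancestors_self v)⟩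
  refine ⟨l, fun u hu hul => ?_, mem_sub.1 hl⟩
  have h1 := T.weight_parent_lt u hu
  rw [hul] at h1
  have h2 : l ∈ T.ancestors u := ⟨1, hul⟩
  have := hmax u (mem_sub.2 (mem_ancestors_trans (mem_sub.1 hl) h2))
  omega

variable (T) in
/-- Numbering of a set of nodes in the order of their weights. -/
theorem exists_numbering (s : Finset (Fin n)) : ∃ (num : Fin n → ℕ) (node : ℕ → ℕ),
    (∀ u ∈ s, num u < s.card) ∧ (∀ u ∈ s, node (num u) = u) ∧ (∀ i, node i ≤ n) ∧
    ∀ u ∈ s, ∀ v ∈ s, T.weight u < T.weight v → num u < num v := by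
  classical
  -- The node number breaks ties between equal weights.
  let σ : Fin n → ℕ := fun u => T.weight u * n + u
  have hσ : ∀ u v, T.weight u < T.weight v → σ u < σ v := by
    intro u v h
    have := u.2
    have h2 : (T.weight u + 1) * n ≤ T.weight v * n := Nat.mul_le_mul_right _ h
    simp only [σ]
    nlinarith
  have hinj : ∀ u v, σ u = σ v → u = v := by
    intro u v h
    rcases lt_trichotomy (T.weight u) (T.weight v) with h' | h' | h'
    · have := hσ u v h'; omega
    · simp only [σ, h'] at h
      exact Fin.ext (by omega)
    · have := hσ v u h'; omega
  let num : Fin n → ℕ := fun u => (s.filter fun x => σ x < σ u).card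
  have hnum : ∀ u ∈ s, ∀ v ∈ s, σ u < σ v → num u < num v := by
    intro u hu v hv h
    refine Finset.card_lt_card ⟨fun x hx => ?_, fun hsub => ?_⟩
    · rw [Finset.mem_filter] at hx ⊢
      exact ⟨hx.1, hx.2.trans h⟩
    · have := hsub (Finset.mem_filter.2 ⟨hu, h⟩)
      simp at this
  have hnuminj : ∀ u ∈ s, ∀ v ∈ s, num u = num v → u = v := by
    intro u hu v hv h
    rcases lt_trichotomy (σ u) (σ v) with h' | h' | h'
    · have := hnum u hu v hv h'; omega
    · exact hinj u v h'
    · have := hnum v hv u hu h'; omega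
  refine ⟨num, fun i => if h : ∃ u ∈ s, num u = i then (h.choose : ℕ) else 0, ?_, ?_, ?_, ?_⟩
  · intro u hu
    refine Finset.card_lt_card ⟨Finset.filter_subset _ _, fun hsub => ?_⟩
    have := hsub hu
    simp at this
  · intro u hu
    have h : ∃ u' ∈ s, num u' = num u := ⟨u, hu, rfl⟩
    dsimp only
    rw [dif_pos h, hnuminj _ h.choose_spec.1 u hu h.choose_spec.2]
  · intro i
    dsimp only
    split_ifs with h
    · exact h.choose.2.le
    · exact Nat.zero_le _
  · exact fun u hu v hv h => hnum u hu v hv (hσ u v h)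

end WeightedTree

/-- Subsets of `{0, …, δ - 1}` as numbers below `2 ^ δ`. -/
theorem exists_subset_code (δ : ℕ) : ∃ (enc : Finset ℕ → ℕ) (dec : ℕ → Finset ℕ),
    ∀ s ⊆ Finset.range δ, enc s < 2 ^ δ ∧ dec (enc s) = s := by
  classical
  have h : Fintype.card (Finset.range δ).powerset = 2 ^ δ := by simp
  let e := Fintype.equivFinOfCardEq h
  refine ⟨fun s => if hs : s ∈ (Finset.range δ).powerset then e ⟨s, hs⟩ else 0,
    fun x => if hx : x < 2 ^ δ then (e.symm ⟨x, hx⟩).1 else ∅, fun s hs => ?_⟩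
  have hs' : s ∈ (Finset.range δ).powerset := Finset.mem_powerset.2 hs
  simp only [dif_pos hs']
  refine ⟨(e ⟨s, hs'⟩).2, ?_⟩
  rw [dif_pos (e ⟨s, hs'⟩).2]
  simp

/-! ## Few marked ancestors -/

namespace WeightedTree

open Fusion

/-- The search among the marked nodes of large subtrees. -/
def upperQuery (o D : ℕ) (ev ed : Expr) : Expr :=
  query (o + 9 + (3 + D * 7)) D (.load (o + 6) ev)
    (.ifLt ed (.load (o + 7) ev) ed (.load (o + 7) ev))

/-- The search among the marked nodes, first in a small subtree. -/
def markedQuery (o D : ℕ) (ev ed : Expr) : Expr :=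
  let x : Expr := .load (o + 1) (.op .add (.op .mul (.load (o + 3) ev) (.load (o + 8) (.const 0)))
    (query (o + 9) D (.load (o + 4) ev) ed))
  .ifEq (.load o ev) (.const 0) (upperQuery o D ev ed)
    (.ifEq x (.const 0) (upperQuery o D ev ed)
      (.load (o + 2) (.op .sub (.op .add (.load (o + 5) ev) x) (.const 1))))

variable {n : ℕ} {T : WeightedTree n}

/-- The lowest nodes with more than `δ` descendants are pairwise incomparable, so their subtrees pay
for `δ + 1` keys each. A large node `p` uses the list of such a node below it: entries of weight at
most `d ≤ T.weight p` on that longer path are already ancestors of `p`. -/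
theorem exists_upper_structure {δ B D w : ℕ} (hp : Params δ B D n w) (hδB : δ + 1 ≤ B * B)
    (hw : ∀ v, T.weight v < 2 ^ w) (marked : Set (Fin n))
    (hm : ∀ v, (T.ancestors v ∩ marked).ncard ≤ δ) :
    ∃ (arrs : Memory w) (hd : Fin n → ℕ), arrs.length = 3 + D * 7 ∧
      arrs.size ≤ (D * 8 + 4) * n ∧ (∀ v, hd v < 2 ^ w) ∧
      ∀ (m : Memory w) (o : ℕ) (ρ : ℕ → ℕ) (eh ed : Expr), Slice m o arrs →
        ∀ p, δ < (T.sub p).card → ∀ d ≤ T.weight p, Ev m ρ eh (hd p) → Ev m ρ ed d →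
          ∃ ans, IsPredecessor (T.ancestors p ∩ marked) T.weight d ans ∧
            Ev m ρ (query o D eh ed) (encodeAnswer ans) := by
  classical
  let J : Finset (Fin n) := Finset.univ.filter fun l => δ < (T.sub l).card ∧
    ∀ u, l ∈ T.ancestors u → δ < (T.sub u).card → l = u
  have hJ : ∀ p, ∃ l, δ < (T.sub p).card → l ∈ J ∧ p ∈ T.ancestors l := by
    intro p
    by_cases hpp : δ < (T.sub p).card
    swap
    · exact ⟨p, fun h => (hpp h).elim⟩
    obtain ⟨l, hl, hmax⟩ := Finset.exists_max_image
      (Finset.univ.filter fun l => p ∈ T.ancestors l ∧ δ < (T.sub l).card) T.weight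
      ⟨p, by simp [T.mem_ancestors_self, hpp]⟩
    simp only [Finset.mem_filter, Finset.mem_univ, true_and] at hl hmax
    refine ⟨l, fun _ => ⟨?_, hl.1⟩⟩
    simp only [J, Finset.mem_filter, Finset.mem_univ, true_and]
    refine ⟨hl.2, fun u hu hu' => ?_⟩
    by_contra hne
    have h1 := hmax u ⟨mem_ancestors_trans hl.1 hu, hu'⟩
    have h2 := weight_lt hu hne
    omega
  choose leaf hleaf using hJ
  -- The weight of `l` itself is added only to keep the key set nonempty.
  let K : Fin n → Finset ℕ := fun l =>
    insert (T.weight l) ((Finset.univ.filter fun u => u ∈ T.ancestors l ∩ marked).image T.weight)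
  have hKcard : ∀ l, (K l).card ≤ δ + 1 := by
    intro l
    refine (Finset.card_insert_le _ _).trans (Nat.succ_le_succ (Finset.card_image_le.trans ?_))
    have := hm l
    rwa [Set.ncard_eq_toFinset_card', Set.toFinset_card, ← Set.toFinset_card,
      show (T.ancestors l ∩ marked).toFinset =
        Finset.univ.filter fun u => u ∈ T.ancestors l ∩ marked by ext; simp] at this
  -- The answer is made a function of the set of keys below the bound, so that it is a step function
  -- by construction. Sets that are not of this form get a default answer.
  have hans : ∀ (l : Fin n) (L : Finset ℕ), ∃ ans : Option (Fin n), ∀ d,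
      (∀ i ∈ T.ancestors l ∩ marked, T.weight i ∈ L ↔ T.weight i ≤ d) →
      IsPredecessor (T.ancestors l ∩ marked) T.weight d ans := by
    intro l L
    by_cases h : ∃ d, ∀ i ∈ T.ancestors l ∩ marked, T.weight i ∈ L ↔ T.weight i ≤ d
    · obtain ⟨d, hd⟩ := h
      obtain ⟨ans, h⟩ := exists_isPredecessor (T.ancestors l ∩ marked) T.weight d
      refine ⟨ans, fun d' hd' => ?_⟩
      cases ans with
      | none =>
        intro i hi
        have h1 : d < T.weight i := h i hi
        have h2 := hd i hi
        have h3 := hd' i hi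
        rw [h2] at h3
        omega
      | some i =>
        obtain ⟨h1, h2, h3⟩ := h
        exact ⟨h1, (hd' i h1).1 ((hd i h1).2 h2), fun j hj hjd =>
          h3 j hj ((hd j hj).1 ((hd' j hj).2 hjd))⟩
    · exact ⟨none, fun d hd => (h ⟨d, hd⟩).elim⟩
  choose ans hans using hans
  have hdisj : ∀ a ∈ J, ∀ b ∈ J, a ∈ T.ancestors b → a = b := by
    intro a ha b hb hab
    simp only [J, Finset.mem_filter, Finset.mem_univ, true_and] at ha hb
    exact ha.2 b hab hb.1
  obtain ⟨arrs, hd, c1, c2, c3, c4⟩ := exists_rank_structure hp J K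
    (fun l e => encodeAnswer (ans l ((K l).filter (· < e))))
    (fun l _ => ⟨T.weight l, by simp [K]⟩) (fun l _ => (hKcard l).trans hδB)
    (by
      refine (Finset.sum_le_sum fun l hl => ?_).trans (sum_card_sub_le J hdisj)
      simp only [J, Finset.mem_filter] at hl
      exact (hKcard l).trans hl.2.1)
    (fun l _ x hx => by
      simp only [K, Finset.mem_insert, Finset.mem_image] at hx
      rcases hx with rfl | ⟨u, -, rfl⟩ <;> exact hw _)
    (fun l _ e => encodeAnswer_lt hp.lt_word _)
    (fun l _ e e' h => by
      rw [Finset.filter_congr fun x hx => h x hx])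
  refine ⟨arrs, fun p => if δ < (T.sub p).card then hd (leaf p) else 0, c1, c2, fun v => ?_, ?_⟩
  · dsimp only
    split_ifs with h
    · exact c3 _ (hleaf v h).1
    · positivity
  · intro m o ρ eh ed hs p hpp d hdp heh hed
    obtain ⟨hl, hpl⟩ := hleaf p hpp
    dsimp only at heh
    rw [if_pos hpp] at heh
    refine ⟨_, ?_, c4 m o ρ eh ed hs _ hl d (hdp.trans_lt (hw p)) heh hed⟩
    have hpred := hans (leaf p) ((K (leaf p)).filter (· < d + 1)) d (fun i hi => by
      have : T.weight i ∈ K (leaf p) := by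
        simp only [K, Finset.mem_insert, Finset.mem_image]
        exact .inr ⟨i, by simpa using hi, rfl⟩
      simp [this])
    revert hpred
    cases ans (leaf p) ((K (leaf p)).filter (· < d + 1)) with
    | none => exact fun h i hi => h i ⟨mem_ancestors_trans hi.1 hpl, hi.2⟩
    | some i =>
      rintro ⟨h1, h2, h3⟩
      exact ⟨⟨mem_ancestors_of_weight_le h1.1 hpl (h2.trans hdp), h1.2⟩, h2,
        fun j hj => h3 j ⟨mem_ancestors_trans hj.1 hpl, hj.2⟩⟩

/-- The search in trees where each node has at most `δ` marked ancestors. -/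
theorem exists_marked_structure {δ B D w : ℕ} (hp : Params δ B D n w) (hδB : δ + 1 ≤ B * B)
    (hw : ∀ v, T.weight v < 2 ^ w) (marked : Set (Fin n))
    (hm : ∀ v, (T.ancestors v ∩ marked).ncard ≤ δ) :
    ∃ arrs : Memory w, arrs.length = 15 + D * 14 ∧ arrs.size ≤ (D * 16 + 17) * n ∧
      ∀ (m : Memory w) (o : ℕ) (ρ : ℕ → ℕ) (ev ed : Expr), Slice m o arrs →
        ∀ (v : Fin n), ∀ d < 2 ^ w, Ev m ρ ev v → Ev m ρ ed d →
          ∃ ans, IsPredecessor (T.ancestors v ∩ marked) T.weight d ans ∧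
            Ev m ρ (markedQuery o D ev ed) (encodeAnswer ans) := by
  classical
  have hP1 := hp.pow_le (show 1 ≤ 3 by norm_num)
  have hP2 := hp.pow_le (show 2 ≤ 3 by norm_num)
  have hnw := hp.lt_word
  rw [one_mul] at hP1
  have hδ2 : δ < 2 ^ δ := Nat.lt_two_pow_self
  obtain ⟨upper, uhd, u1, u2, u3, u4⟩ := exists_upper_structure hp hδB hw marked hm
  -- the lowest ancestor with a large subtree
  have htop : ∀ v, ∃ p ∈ T.ancestors v, δ < (T.sub p).card ∧
      ∀ a ∈ T.ancestors v, δ < (T.sub a).card → T.weight a ≤ T.weight p := by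
    intro v
    obtain ⟨p, hp', hmax⟩ := Finset.exists_max_image
      (Finset.univ.filter fun a => a ∈ T.ancestors v ∧ δ < (T.sub a).card) T.weight
      ⟨T.root, by
        simp only [Finset.mem_filter, Finset.mem_univ, true_and, T.root_mem_ancestors v, sub_root,
          Finset.card_univ, Fintype.card_fin]
        omega⟩
    simp only [Finset.mem_filter, Finset.mem_univ, true_and] at hp' hmax
    exact ⟨p, hp'.1, hp'.2, fun a h1 h2 => hmax a ⟨h1, h2⟩⟩
  choose top t1 t2 t3 using htop
  -- the highest ancestor with a small subtree
  have hbot : ∀ v, ∃ μ, (T.sub v).card ≤ δ → μ ∈ T.ancestors v ∧ (T.sub μ).card ≤ δ ∧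
      ∀ a ∈ T.ancestors v, (T.sub a).card ≤ δ → T.weight μ ≤ T.weight a := by
    intro v
    by_cases hv : (T.sub v).card ≤ δ
    swap
    · exact ⟨v, fun h => (hv h).elim⟩
    obtain ⟨μ, hμ, hmin⟩ := Finset.exists_min_image
      (Finset.univ.filter fun a => a ∈ T.ancestors v ∧ (T.sub a).card ≤ δ) T.weight
      ⟨v, by simp [T.mem_ancestors_self, hv]⟩
    simp only [Finset.mem_filter, Finset.mem_univ, true_and] at hμ hmin
    exact ⟨μ, fun _ => ⟨hμ.1, hμ.2, fun a h1 h2 => hmin a ⟨h1, h2⟩⟩⟩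
  choose bot b1 using hbot
  -- The roots of the maximal small subtrees.
  let J : Finset (Fin n) := Finset.univ.filter fun μ => (T.sub μ).card ≤ δ ∧
    ∀ a ∈ T.ancestors μ, (T.sub a).card ≤ δ → a = μ
  have hJbot : ∀ v, (T.sub v).card ≤ δ → bot v ∈ J := by
    intro v hv
    obtain ⟨h1, h2, h3⟩ := b1 v hv
    simp only [J, Finset.mem_filter, Finset.mem_univ, true_and]
    refine ⟨h2, fun a ha ha' => ?_⟩
    by_contra hne
    have := h3 a (mem_ancestors_trans ha h1) ha'
    have := weight_lt ha hne
    omega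
  have hJdisj : ∀ a ∈ J, ∀ b ∈ J, a ∈ T.ancestors b → a = b := by
    intro a ha b hb hab
    simp only [J, Finset.mem_filter, Finset.mem_univ, true_and] at ha hb
    exact hb.2 a hab ha.1
  have hJsmall : ∀ μ ∈ J, (T.sub μ).card ≤ δ := by
    intro μ h
    simp only [J, Finset.mem_filter] at h
    exact h.2.1
  choose num node n1 n2 n3 n4 using fun μ => T.exists_numbering (T.sub μ)
  obtain ⟨enc, dec, henc⟩ := exists_subset_code δ
  -- The weight search ignores ancestry and returns all lighter nodes of the small subtree.
  -- Intersecting with `above v` restores ancestry and marks, and the largest number in the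
  -- intersection belongs to the heaviest node.
  let below : Fin n → ℕ → Finset ℕ := fun μ e =>
    ((T.sub μ).filter fun u => T.weight u < e).image (num μ)
  let above : Fin n → Finset ℕ := fun v =>
    ((T.sub (bot v)).filter fun u => u ∈ T.ancestors v ∩ marked).image (num (bot v))
  have hbelow : ∀ μ ∈ J, ∀ e, below μ e ⊆ Finset.range δ := by
    intro μ hμ e i hi
    simp only [below, Finset.mem_image, Finset.mem_filter] at hi
    obtain ⟨u, hu, rfl⟩ := hi
    exact Finset.mem_range.2 ((n1 μ u hu.1).trans_le (hJsmall μ hμ))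
  have habove : ∀ v, (T.sub v).card ≤ δ → above v ⊆ Finset.range δ := by
    intro v hv i hi
    simp only [above, Finset.mem_image, Finset.mem_filter] at hi
    obtain ⟨u, hu, rfl⟩ := hi
    exact Finset.mem_range.2 ((n1 _ u hu.1).trans_le (b1 v hv).2.1)
  obtain ⟨lower, lhd, l1, l2, l3, l4⟩ := exists_rank_structure hp J
    (fun μ => (T.sub μ).image T.weight) (fun μ e => enc (below μ e))
    (fun μ _ => ⟨T.weight μ, Finset.mem_image_of_mem _ (mem_sub.2 (T.mem_ancestors_self μ))⟩)
    (fun μ hμ => Finset.card_image_le.trans (by have := hJsmall μ hμ; omega))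
    ((Finset.sum_le_sum fun μ _ => Finset.card_image_le).trans (sum_card_sub_le J hJdisj))
    (fun μ _ x hx => by
      obtain ⟨u, -, rfl⟩ := Finset.mem_image.1 hx
      exact hw u)
    (fun μ hμ e => (henc _ (hbelow μ hμ e)).1.trans_le (by omega))
    (fun μ _ e e' h => by
      simp only [below]
      congr 2
      exact Finset.filter_congr fun u hu => h _ (Finset.mem_image_of_mem _ hu))
  obtain ⟨base, owner, g1, g2, g3⟩ := exists_allocation J (fun μ => (T.sub μ).card) n
    (sum_card_sub_le J hJdisj)
  let light : Fin n → Prop := fun v => (T.sub v).card ≤ δ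
  let arr : (Fin n → ℕ) → List (BitVec w) := fun f => tab w n fun i => if h : i < n then f ⟨i, h⟩ else 0
  have harr : ∀ {m : Memory w} {ρ : ℕ → ℕ} {seg : ℕ} {f : Fin n → ℕ} {ev : Expr} {v : Fin n},
      m.array seg = arr f → Ev m ρ ev v → f v < 2 ^ w → Ev m ρ (.load seg ev) (f v) := by
    intro m ρ seg f ev v h1 h2 h3
    simpa using Ev.load_tab h1 h2 v.2 (by simpa using h3)
  refine ⟨[arr fun v => if light v then 1 else 0,
    -- The maximum is stored plus one, so that 0 signals an empty intersection.
    tab w (2 ^ (2 * δ)) (fun x => (dec (x / 2 ^ δ) ∩ dec (x % 2 ^ δ)).sup fun i => i + 1),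
    tab w n (blocks owner node),
    arr fun v => enc (above v),
    arr fun v => lhd (bot v),
    arr fun v => base (bot v),
    arr fun v => uhd (top v),
    arr fun v => T.weight (top v),
    tab w 1 fun _ => 2 ^ δ] ++ (lower ++ upper), ?_, ?_, ?_⟩
  · simp [l1, u1]
    omega
  · rw [Memory.size_append, Memory.size_append]
    have : 0 < 2 ^ (2 * δ) := by positivity
    simp [arr, Memory.size] at l2 u2 ⊢
    nlinarith
  intro m o ρ ev ed hs v d hd hev hed
  have a0 := hs.left.array' 0 rfl
  have a1 := hs.left.array' 1 rfl
  have a2 := hs.left.array' 2 rfl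
  have a3 := hs.left.array' 3 rfl
  have a4 := hs.left.array' 4 rfl
  have a5 := hs.left.array' 5 rfl
  have a6 := hs.left.array' 6 rfl
  have a7 := hs.left.array' 7 rfl
  have a8 := hs.left.array' 8 rfl
  have slow : Slice m (o + 9) lower := (hs.right rfl).left
  have sup : Slice m (o + 9 + (3 + D * 7)) upper := (hs.right (o' := o + 9) rfl).right (by rw [l1])
  rw [add_zero] at a0
  have ewt := harr (f := fun v => T.weight (top v)) a7 hev (hw (top v))
  -- Clipping `d` at the weight of `top v` excludes nodes of the stored longer path that lie below
  -- `top v` and need not be ancestors of `v`.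
  obtain ⟨uans, up1, up2⟩ := u4 m _ ρ (.load (o + 6) ev)
    (.ifLt ed (.load (o + 7) ev) ed (.load (o + 7) ev)) sup (top v) (t2 v)
    (min d (T.weight (top v))) (min_le_right _ _) (harr (f := fun v => uhd (top v)) a6 hev (u3 _))
    (.ifLt hed ewt (fun h => by rwa [min_eq_left h.le]) fun h => by
      rwa [min_eq_right (not_lt.1 h)])
  -- the search among the large subtrees is right if there is no marked ancestor in small subtrees
  have hup : (∀ a ∈ T.ancestors v ∩ marked, T.weight a ≤ d → ¬ light a) →
      IsPredecessor (T.ancestors v ∩ marked) T.weight d uans := by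
    intro h
    have h' : ∀ a ∈ T.ancestors v ∩ marked, T.weight a ≤ d →
        a ∈ T.ancestors (top v) ∩ marked ∧ T.weight a ≤ min d (T.weight (top v)) := by
      intro a ha had
      have hwt := t3 v a ha.1 (not_le.1 (h a ha had))
      exact ⟨⟨mem_ancestors_of_weight_le ha.1 (t1 v) hwt, ha.2⟩, le_min had hwt⟩
    cases uans with
    | none =>
      intro a ha
      by_contra hda
      obtain ⟨h1, h2⟩ := h' a ha (not_lt.1 hda)
      exact absurd h2 (not_le.2 (up1 a h1))
    | some i =>
      obtain ⟨h1, h2, h3⟩ := up1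
      exact ⟨⟨mem_ancestors_trans h1.1 (t1 v), h1.2⟩, h2.trans (min_le_left _ _),
        fun j hj hjd => h3 j (h' j hj hjd).1 (h' j hj hjd).2⟩
  have hlightev := harr (f := fun v => if light v then 1 else 0) a0 hev
    (by split_ifs <;> omega)
  have e0 : Ev m ρ (.const 0) 0 := .const 0 (by positivity)
  by_cases hv : light v
  swap
  · rw [if_neg hv] at hlightev
    refine ⟨uans, hup fun a ha _ hla => hv ?_, ?_⟩
    · exact (card_sub_le ha.1).trans hla
    · exact .ifEq hlightev e0 (fun _ => up2) fun h => (h rfl).elim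
  rw [if_pos hv] at hlightev
  have hμJ := hJbot v hv
  obtain ⟨hμv, hμs, hμmin⟩ := b1 v hv
  set μ := bot v with hμ
  obtain ⟨ea1, ea2⟩ := henc _ (habove v hv)
  obtain ⟨eb1, eb2⟩ := henc _ (hbelow μ hμJ (d + 1))
  have emask := harr (f := fun v => enc (above v)) a3 hev (ea1.trans_le (by omega))
  have elow := l4 m (o + 9) ρ (.load (o + 4) ev) ed slow μ hμJ d hd
    (harr (f := fun v => lhd (bot v)) a4 hev (l3 _ hμJ)) hed
  have eP : Ev m ρ (.load (o + 8) (.const 0)) (2 ^ δ) :=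
    Ev.load_tab (f := fun _ => 2 ^ δ) a8 e0 (by norm_num) (by omega)
  have hidx : enc (above v) * 2 ^ δ + enc (below μ (d + 1)) < 2 ^ (2 * δ) := by
    rw [two_mul, pow_add]
    exact mul_add_lt ea1 eb1
  set C := above v ∩ below μ (d + 1) with hC
  have hCmem : ∀ i ∈ C, ∃ u, (u ∈ T.ancestors v ∩ marked ∧ T.weight u ≤ d ∧ u ∈ T.sub μ) ∧
      num μ u = i := by
    intro i hi
    obtain ⟨h1, h2⟩ := Finset.mem_inter.1 hi
    obtain ⟨u, hu, rfl⟩ := Finset.mem_image.1 h1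
    obtain ⟨u', hu', heq⟩ := Finset.mem_image.1 h2
    rw [Finset.mem_filter] at hu hu'
    have : u' = u := by
      have h3 := n2 μ u hu.1
      have h4 := n2 μ u' hu'.1
      rw [heq] at h4
      exact Fin.ext (h4.symm.trans h3)
    subst this
    exact ⟨u', ⟨hu.2, Nat.lt_succ_iff.1 hu'.2, hu.1⟩, rfl⟩
  have hmemC : ∀ u ∈ T.ancestors v ∩ marked, T.weight u ≤ d → light u → u ∈ T.sub μ ∧ num μ u ∈ C := by
    intro u hu hud hul
    have h1 : u ∈ T.sub μ :=
      mem_sub.2 (mem_ancestors_of_weight_le hμv hu.1 (hμmin u hu.1 hul))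
    exact ⟨h1, Finset.mem_inter.2 ⟨Finset.mem_image_of_mem _ (Finset.mem_filter.2 ⟨h1, hu⟩),
      Finset.mem_image_of_mem _ (Finset.mem_filter.2 ⟨h1, Nat.lt_succ_iff.2 hud⟩)⟩⟩
  have hsup : (C.sup fun i => i + 1) ≤ δ := by
    refine Finset.sup_le fun i hi => ?_
    have := Finset.mem_range.1 (habove v hv (Finset.mem_inter.1 hi).1)
    omega
  have ex := Ev.load_tab (ρ := ρ) a1 (.add (.mul emask eP (by omega)) elow (by omega)) hidx (by
    rw [Nat.mul_add_mod_of_lt eb1, Nat.mul_comm (enc (above v)), Nat.mul_add_div (by positivity),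
      Nat.div_eq_of_lt eb1, add_zero, ea2, eb2]
    exact hsup.trans_lt (by omega))
  rw [Nat.mul_add_mod_of_lt eb1, Nat.mul_comm (enc (above v)), Nat.mul_add_div (by positivity),
      Nat.div_eq_of_lt eb1, add_zero, ea2, eb2] at ex
  by_cases hempty : C = ∅
  · refine ⟨uans, hup fun a ha had hla => ?_, ?_⟩
    · have := (hmemC a ha had hla).2
      simp [hempty] at this
    · refine .ifEq hlightev e0 (fun _ => up2) fun _ => .ifEq ex e0 (fun _ => up2) fun h => ?_
      rw [← hC, hempty] at h
      simp at h
  obtain ⟨i, hi, hisup⟩ := Finset.exists_mem_eq_sup C (Finset.nonempty_iff_ne_empty.2 hempty)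
    fun i => i + 1
  have hmax : ∀ j ∈ C, j ≤ i := by
    intro j hj
    have := Finset.le_sup (f := fun i => i + 1) hj
    rw [hisup] at this
    simpa using this
  obtain ⟨u, ⟨hu1, hu2, hu3⟩, rfl⟩ := hCmem i hi
  rw [← hC, hisup] at ex
  have hblk := g1 μ hμJ (num μ u) (n1 μ u hu3)
  have hlt := g3 μ hμJ
  have hnum := n1 μ u hu3
  refine ⟨some u, ⟨hu1, hu2, fun j hj hjd => ?_⟩, ?_⟩
  · by_cases hjl : light j
    · obtain ⟨h1, h2⟩ := hmemC j hj hjd hjl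
      have := hmax _ h2
      by_contra hlt
      have := n4 μ u hu3 j h1 (not_le.1 hlt)
      omega
    -- A marked ancestor heavier than `u` lies below `u`, hence in the small subtree of `μ`, and
    -- would be light.
    · by_contra hlt
      refine hjl ((card_sub_le ?_).trans hμs)
      exact mem_ancestors_trans (mem_sub.1 hu3)
        (mem_ancestors_of_weight_le hu1.1 hj.1 (not_le.1 hlt).le)
  · refine .ifEq hlightev e0 (fun h => by simp at h) fun _ => .ifEq ex e0 (fun h => by simp at h)
      fun _ => ?_
    have ebase := harr (f := fun v => base (bot v)) a5 hev (by
      change base μ < 2 ^ w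
      omega)
    have e1 : Ev m ρ (.const 1) 1 := .const 1 (by omega)
    have := Ev.load_tab a2 ((ebase.add ex (by change base μ + _ < _; omega)).sub e1 (by omega))
      (by change base μ + _ - 1 < _; omega)
      (by
        rw [show base (bot v) + (num μ u + 1) - 1 = base μ + num μ u by rw [← hμ]; omega,
          blocks_eq hblk, n2 μ u hu3]
        omega)
    rw [show base (bot v) + (num μ u + 1) - 1 = base μ + num μ u by rw [← hμ]; omega,
      blocks_eq hblk, n2 μ u hu3] at this
    exact this

end WeightedTree

/-! ## Parameters for large words -/

namespace Fusion

theorem mul_lt_two_pow (k w : ℕ) (h : 2 * k + 4 ≤ w) : k * w < 2 ^ w := by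
  have hk : k < 2 ^ k := Nat.lt_two_pow_self
  induction w, h using Nat.le_induction with
  | base =>
    have h2 : k + 2 < 2 ^ (k + 2) := Nat.lt_two_pow_self
    have h3 : 2 ^ (2 * k + 4) = 2 ^ (k + 2) * 2 ^ (k + 2) := by rw [← pow_add]; congr 1; ring
    have h4 : 2 ^ (k + 2) = 2 ^ k * 4 := by rw [pow_add]; norm_num
    rw [h3]
    calc k * (2 * k + 4) = (2 * k) * (k + 2) := by ring
      _ < 2 ^ (k + 2) * 2 ^ (k + 2) := Nat.mul_lt_mul'' (by omega) h2
  | succ w hw ih =>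
    have : 2 ^ k ≤ 2 ^ w := Nat.pow_le_pow_right (by norm_num) (by omega)
    rw [pow_succ, mul_add]
    omega

/-- The left side is `2 ^ O(√δ log δ)`. Explicitly, `400 ≤ δ` gives `20 ≤ s`, then `s + 1 ≤ 2 ^ (s /
4)` and `δ + 1 ≤ 2 ^ (2 * (s / 4))`, and the resulting exponent `2 * (s / 4) * (s + 2)` is at most
`s * s ≤ δ`. -/
theorem code_count_le {δ : ℕ} (h : 400 ≤ δ) :
    (Nat.sqrt δ + 1 + 1) * (δ + 1) ^ (Nat.sqrt δ + 1) ≤ 2 ^ δ := by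
  set s := Nat.sqrt δ with hs
  have h1 : s * s ≤ δ := Nat.sqrt_le δ
  have h2 : δ < (s + 1) * (s + 1) := Nat.lt_succ_sqrt δ
  have h3 : 20 ≤ s := Nat.le_sqrt.2 (by omega)
  have h4 : ∀ u ≥ 5, 4 * u + 4 ≤ 2 ^ u := by
    intro u hu
    induction u, hu using Nat.le_induction with
    | base => norm_num
    | succ u hu ih => rw [pow_succ]; omega
  have h5 : s + 1 ≤ 2 ^ (s / 4) := by
    have := h4 (s / 4) (by omega)
    omega
  have h6 : δ + 1 ≤ 2 ^ (2 * (s / 4)) := by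
    calc δ + 1 ≤ (s + 1) * (s + 1) := h2
      _ ≤ 2 ^ (s / 4) * 2 ^ (s / 4) := Nat.mul_le_mul h5 h5
      _ = 2 ^ (2 * (s / 4)) := by rw [← pow_add]; congr 1; ring
  calc (s + 1 + 1) * (δ + 1) ^ (s + 1) ≤ (δ + 1) * (δ + 1) ^ (s + 1) :=
        Nat.mul_le_mul_right _ (by nlinarith)
    _ = (δ + 1) ^ (s + 2) := by ring
    _ ≤ (2 ^ (2 * (s / 4))) ^ (s + 2) := Nat.pow_le_pow_left h6 _
    _ = 2 ^ (2 * (s / 4) * (s + 2)) := by rw [← pow_mul]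
    _ ≤ 2 ^ δ := by
      refine Nat.pow_le_pow_right (by norm_num) (le_trans ?_ h1)
      have : 4 * (s / 4) ≤ s := Nat.mul_div_le s 4
      nlinarith

/-- On machines with large logarithmic words, the search structure has its parameters. -/
theorem exists_params {κ n w : ℕ} (h : LogWordSize κ n w) (hn : 0 < n)
    (hw : κ * 3200 + 2 * (16 * κ + 2) + 4 ≤ w) :
    Params ((Nat.log 2 n + 1) / 8) (Nat.sqrt ((Nat.log 2 n + 1) / 8) + 1) (16 * κ) n w ∧
      400 ≤ (Nat.log 2 n + 1) / 8 := by
  obtain ⟨h1, h2⟩ := h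
  set L := Nat.log 2 n + 1 with hL
  have hLw : L ≤ w := by
    have h3 : 2 ^ Nat.log 2 n ≤ n := Nat.pow_log_le_self 2 hn.ne'
    exact (Nat.pow_lt_pow_iff_right (by norm_num)).1 (h3.trans_lt h1)
  have hL' : 3200 ≤ L := by
    by_contra hlt
    have : κ * L ≤ κ * 3200 := Nat.mul_le_mul_left _ (by omega)
    omega
  have hδ : 400 ≤ L / 8 := by omega
  -- The bound `(16 * κ + 2) * w < 2 ^ w` covers both the shifts `δ * D` and the index range `D +
  -- 2`. The table size needs only `3 * (L / 8) ≤ L - 1`, and `L ≤ 16 * (L / 8)` gives `w ≤ δ * D`.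
  have hbig := mul_lt_two_pow (16 * κ + 2) w (by omega)
  refine ⟨⟨code_count_le hδ, ?_, h1, ?_, ?_, ?_, by omega⟩, hδ⟩
  · exact (Nat.pow_le_pow_right (by norm_num) (by omega)).trans (Nat.pow_log_le_self 2 hn.ne')
  · calc w ≤ κ * L := h2
      _ ≤ κ * (16 * (L / 8)) := Nat.mul_le_mul_left _ (by omega)
      _ = L / 8 * (16 * κ) := by ring
  · refine lt_of_le_of_lt ?_ hbig
    rw [mul_comm]
    exact Nat.mul_le_mul (by omega) (by omega)
  · refine lt_of_le_of_lt ?_ hbig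
    exact Nat.le_mul_of_pos_right _ (by omega)

end Fusion

/-! ## Logarithmically many marked ancestors -/

namespace WeightedTree

open Fusion

/-- Walking up the tree, for at most the given number of steps. -/
def walk (o : ℕ) : ℕ → Expr → Expr → Expr
  | 0, _, _ => .load (o + 3) (.const 0)
  | k + 1, ev, ed =>
    let next : Expr := .ifEq (.load (o + 2) ev) ev (.load (o + 3) (.const 0))
      (walk o k (.load (o + 2) ev) ed)
    .ifEq (.load o ev) (.const 0) next (.ifLt ed (.load (o + 1) ev) next ev)

/-- The last answer among the given number of searches. -/
def lastOf (none : Expr) (f : ℕ → Expr) : ℕ → Expr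
  | 0 => none
  | i + 1 => .ifEq (f i) none (lastOf none f i) (f i)

/-- The search among logarithmically many marked ancestors: a walk for small words, and otherwise
separate searches for `q` classes of marked nodes. -/
def ancestorQuery (W q D o : ℕ) (ev ed : Expr) : Expr :=
  .ifEq (.load o (.const 0)) (.const 0) (walk (o + 1) (2 ^ W) ev ed)
    (lastOf (.load (o + 4) (.const 0)) (fun i => markedQuery (o + 5 + i * (15 + D * 14)) D ev ed) q)

variable {n : ℕ} {T : WeightedTree n}

/-- A function of the nodes as an array. -/
def nodeArray (w : ℕ) (f : Fin n → ℕ) : List (BitVec w) :=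
  tab w n fun i => if h : i < n then f ⟨i, h⟩ else 0

@[simp] theorem length_nodeArray (w : ℕ) (f : Fin n → ℕ) : (nodeArray w f).length = n := by
  simp [nodeArray]

theorem ev_nodeArray {w : ℕ} {m : Memory w} {ρ : ℕ → ℕ} {seg : ℕ} {ev : Expr} {v : Fin n}
    (f : Fin n → ℕ) (h : m.array seg = nodeArray w f) (hv : Ev m ρ ev v) (hf : f v < 2 ^ w) :
    Ev m ρ (.load seg ev) (f v) := by
  simpa using Ev.load_tab h hv v.2 (by simpa using hf)

open Classical in
/-- The arrays for walking up the tree. -/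
noncomputable def walkArrays (w : ℕ) (T : WeightedTree n) (marked : Set (Fin n)) : Memory w :=
  [nodeArray w fun v => if v ∈ marked then 1 else 0, nodeArray w T.weight,
    nodeArray w fun v => T.parent v, tab w 1 fun _ => n]

/-- Weights strictly decrease towards the root, so the weight of the starting node bounds the number
of steps. The first marked node of weight at most `d` on the way up is the answer. -/
theorem ev_walk {w : ℕ} (hnw : n < 2 ^ w) (hw : ∀ v, T.weight v < 2 ^ w) {marked : Set (Fin n)}
    {m : Memory w} {o : ℕ} (hs : Slice m o (walkArrays w T marked)) {ρ : ℕ → ℕ} {ed : Expr} {d : ℕ}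
    (hed : Ev m ρ ed d) (k : ℕ) : ∀ (v : Fin n) (ev : Expr), T.weight v < k → Ev m ρ ev v →
      ∃ ans, IsPredecessor (T.ancestors v ∩ marked) T.weight d ans ∧
        Ev m ρ (walk o k ev ed) (encodeAnswer ans) := by
  classical
  have a0 := hs.array' 0 rfl
  have a1 := hs.array' 1 rfl
  have a2 := hs.array' 2 rfl
  have a3 := hs.array' 3 rfl
  rw [add_zero] at a0
  induction k with
  | zero => intro v _ h; omega
  | succ k ih =>
    intro v ev hv hev
    have e0 : Ev m ρ (.const 0) 0 := .const 0 (by positivity)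
    have en : Ev m ρ (.load (o + 3) (.const 0)) n :=
      Ev.load_tab (f := fun _ => n) a3 e0 (by norm_num) hnw
    have hv2 := v.2
    have emk := ev_nodeArray (fun v => if v ∈ marked then 1 else 0) a0 hev (by
      split_ifs <;> omega)
    have ewt := ev_nodeArray T.weight a1 hev (hw v)
    have epa := ev_nodeArray (fun v => (T.parent v : ℕ)) a2 hev ((T.parent v).2.trans hnw)
    by_cases hgood : v ∈ marked ∧ T.weight v ≤ d
    · refine ⟨some v, ⟨⟨T.mem_ancestors_self v, hgood.1⟩, hgood.2, fun j hj _ => weight_le hj.1⟩, ?_⟩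
      rw [if_pos hgood.1] at emk
      exact .ifEq emk e0 (fun h => by simp at h) fun _ => .ifLt hed ewt (fun h => by omega)
        fun _ => hev
    suffices H : ∃ ans, IsPredecessor (T.ancestors v ∩ marked) T.weight d ans ∧
        Ev m ρ (.ifEq (.load (o + 2) ev) ev (.load (o + 3) (.const 0))
          (walk o k (.load (o + 2) ev) ed)) (encodeAnswer ans) by
      obtain ⟨ans, h1, h2⟩ := H
      refine ⟨ans, h1, .ifEq emk e0 (fun _ => h2) fun hm => .ifLt hed ewt (fun _ => h2) fun hd => ?_⟩
      have hm : v ∈ marked := by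
        by_contra h
        simp [h] at hm
      exact (hgood ⟨hm, not_lt.1 hd⟩).elim
    by_cases hroot : v = T.root
    · refine ⟨none, fun i hi => ?_, .ifEq epa hev (fun _ => en) fun h => ?_⟩
      · have := hi.1
        rw [hroot] at this
        have hiv : i = v := (mem_ancestors_root this).trans hroot.symm
        subst hiv
        by_contra h
        exact hgood ⟨hi.2, not_lt.1 h⟩
      · rw [hroot, T.parent_root] at h
        exact (h rfl).elim
    · have hlt := T.weight_parent_lt v hroot
      obtain ⟨ans, h1, h2⟩ := ih (T.parent v) (.load (o + 2) ev) (by omega) epa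
      refine ⟨ans, ?_, .ifEq epa hev (fun h => ?_) fun _ => h2⟩
      · have hmem : ∀ i ∈ T.ancestors v ∩ marked, T.weight i ≤ d →
            i ∈ T.ancestors (T.parent v) ∩ marked := by
          intro i hi hid
          refine ⟨mem_ancestors_parent hi.1 ?_, hi.2⟩
          rintro rfl
          exact hgood ⟨hi.2, hid⟩
        cases ans with
        | none =>
          intro i hi
          by_contra h
          exact h (h1 i (hmem i hi (not_lt.1 h)))
        | some i =>
          exact ⟨⟨mem_ancestors_trans h1.1.1 ⟨1, rfl⟩, h1.1.2⟩, h1.2.1,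
            fun j hj hjd => h1.2.2 j (hmem j hj hjd) hjd⟩
      · have : T.parent v = v := Fin.ext h
        rw [this] at hlt
        omega

/-! ### Layers of marked nodes -/

variable (T) in
/-- The number of marked ancestors. -/
noncomputable def markedDepth (marked : Set (Fin n)) (v : Fin n) : ℕ :=
  (T.ancestors v ∩ marked).ncard

theorem markedDepth_le {marked : Set (Fin n)} {a b : Fin n} (h : a ∈ T.ancestors b) :
    T.markedDepth marked a ≤ T.markedDepth marked b :=
  Set.ncard_le_ncard (fun _ hu => ⟨mem_ancestors_trans hu.1 h, hu.2⟩) (Set.toFinite _)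

theorem markedDepth_lt {marked : Set (Fin n)} {a b : Fin n} (h : a ∈ T.ancestors b) (hne : a ≠ b)
    (hb : b ∈ marked) : T.markedDepth marked a < T.markedDepth marked b := by
  refine Set.ncard_lt_ncard ⟨fun _ hu => ⟨mem_ancestors_trans hu.1 h, hu.2⟩, fun hsub => ?_⟩
    (Set.toFinite _)
  have h1 := (hsub ⟨T.mem_ancestors_self b, hb⟩).1
  have h2 := weight_lt h hne
  have h3 := weight_le h1
  omega

/-- Marked nodes on one root path have distinct marked depths, because each counts itself. A class
allows only the `δ` depths of one interval. -/
theorem ncard_class_le {marked : Set (Fin n)} {δ : ℕ} (hδ : 0 < δ) (i : ℕ) (v : Fin n) :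
    (T.ancestors v ∩ {u | u ∈ marked ∧ T.markedDepth marked u / δ = i}).ncard ≤ δ := by
  have hinj : Set.InjOn (T.markedDepth marked)
      (T.ancestors v ∩ {u | u ∈ marked ∧ T.markedDepth marked u / δ = i}) := by
    intro a ha b hb hab
    by_contra hne
    rcases ancestors_total ha.1 hb.1 with h | h
    · have := markedDepth_lt h hne hb.2.1
      omega
    · have := markedDepth_lt h (Ne.symm hne) ha.2.1
      omega
  rw [← hinj.ncard_image]
  have hsub : T.markedDepth marked ''
      (T.ancestors v ∩ {u | u ∈ marked ∧ T.markedDepth marked u / δ = i}) ⊆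
      (Finset.Ico (i * δ) (i * δ + δ) : Finset ℕ) := by
    rintro _ ⟨u, hu, rfl⟩
    have h1 := hu.2.2
    have h2 := Nat.div_add_mod' (T.markedDepth marked u) δ
    have h3 := Nat.mod_lt (T.markedDepth marked u) hδ
    rw [h1] at h2
    simp only [Finset.coe_Ico, Set.mem_Ico]
    omega
  refine (Set.ncard_le_ncard hsub (Finset.finite_toSet _)).trans ?_
  rw [Set.ncard_coe_finset]
  simp

/-- Marked depth grows on the way down, so on a root path a later class lies entirely below the
earlier ones and any answer from it wins. Real answers are below `n`, so comparison with `n` detects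
a failed search. -/
theorem ev_lastOf {w : ℕ} {m : Memory w} {ρ : ℕ → ℕ} {marked : Set (Fin n)} {δ d : ℕ} {v : Fin n}
    {none : Expr} {f : ℕ → Expr} (hnone : Ev m ρ none n) {q : ℕ}
    (hf : ∀ i < q, ∃ ans, IsPredecessor
      (T.ancestors v ∩ {u | u ∈ marked ∧ T.markedDepth marked u / δ = i}) T.weight d ans ∧
        Ev m ρ (f i) (encodeAnswer ans)) :
    ∃ ans, IsPredecessor
      (T.ancestors v ∩ {u | u ∈ marked ∧ T.markedDepth marked u / δ < q}) T.weight d ans ∧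
        Ev m ρ (lastOf none f q) (encodeAnswer ans) := by
  induction q with
  | zero => exact ⟨.none, fun i hi => absurd hi.2.2 (Nat.not_lt_zero _), hnone⟩
  | succ q ih =>
    obtain ⟨ans, h1, h2⟩ := ih fun i hi => hf i (by omega)
    obtain ⟨ans', h1', h2'⟩ := hf q (by omega)
    cases ans' with
    | none =>
      refine ⟨ans, ?_, .ifEq h2' hnone (fun _ => h2) fun h => (h rfl).elim⟩
      have hmem : ∀ i ∈ T.ancestors v ∩ {u | u ∈ marked ∧ T.markedDepth marked u / δ < q + 1},
          T.weight i ≤ d →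
          i ∈ T.ancestors v ∩ {u | u ∈ marked ∧ T.markedDepth marked u / δ < q} := by
        intro i hi hid
        refine ⟨hi.1, hi.2.1, ?_⟩
        by_contra hlt
        have := h1' i ⟨hi.1, hi.2.1, by have := hi.2.2; omega⟩
        omega
      cases ans with
      | none =>
        intro i hi
        by_contra h
        exact h (h1 i (hmem i hi (not_lt.1 h)))
      | some i =>
        exact ⟨⟨h1.1.1, h1.1.2.1, h1.1.2.2.trans (Nat.lt_succ_self q)⟩, h1.2.1,
          fun j hj hjd => h1.2.2 j (hmem j hj hjd) hjd⟩
    | some u =>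
      obtain ⟨hu1, hu2, hu3⟩ := h1'
      refine ⟨some u, ⟨⟨hu1.1, hu1.2.1, ?_⟩, hu2, fun j hj hjd => ?_⟩,
        .ifEq h2' hnone (fun h => ?_) fun _ => h2'⟩
      · rw [hu1.2.2]
        omega
      · by_cases hjq : T.markedDepth marked j / δ = q
        · exact hu3 j ⟨hj.1, hj.2.1, hjq⟩ hjd
        · by_contra hlt
          have h3 := Nat.div_le_div_right (c := δ) (markedDepth_le (marked := marked)
            (mem_ancestors_of_weight_le hu1.1 hj.1 (not_le.1 hlt).le))
          have h4 := hj.2.2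
          have h5 := hu1.2.2
          omega
      · have h6 : (u : ℕ) = n := h
        have := u.2
        omega

/-- Predecessor search among marked ancestors: constant time and linear space. -/
theorem exists_ancestor_structure (κ C : ℕ) : ∃ (A c W q D : ℕ), ∀ (n w : ℕ) (T : WeightedTree n)
    (marked : Set (Fin n)), LogWordSize κ n w → (∀ v, T.weight v < 2 ^ w) →
    (∀ v, (T.ancestors v ∩ marked).ncard ≤ C * (Nat.log 2 n + 1)) →
    ∃ arrs : Memory w, arrs.length = A ∧ arrs.size ≤ c * n ∧
      ∀ (m : Memory w) (o : ℕ) (ρ : ℕ → ℕ) (ev ed : Expr), Slice m o arrs →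
        ∀ (v : Fin n), ∀ d < 2 ^ w, Ev m ρ ev v → Ev m ρ ed d →
          ∃ ans, IsPredecessor (T.ancestors v ∩ marked) T.weight d ans ∧
            Ev m ρ (ancestorQuery W q D o ev ed) (encodeAnswer ans) := by
  -- Below this word size all weights are less than the constant `2 ^ W`; from it on,
  -- `exists_params` applies.
  set W := κ * 3200 + 2 * (16 * κ + 2) + 4 with hW
  obtain ⟨D, hD⟩ : ∃ D, D = 16 * κ := ⟨_, rfl⟩
  set q := 16 * C + 1 with hq
  refine ⟨5 + q * (15 + D * 14), 5 + q * (D * 16 + 17), W, q, D, fun n w T marked hlog hw hm => ?_⟩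
  have hn : 0 < n := T.root.pos
  have hnw := hlog.1
  by_cases hsmall : w < W
  · refine ⟨[tab w 1 fun _ => 0] ++ (walkArrays w T marked ++
      -- Empty arrays pad the memory, since array names are fixed in the program and both cases must
      -- have the same number of arrays.
      List.replicate (q * (15 + D * 14)) []), ?_, ?_, ?_⟩
    · simp [walkArrays]
      omega
    · simp only [walkArrays, Memory.size, List.map_append, List.map_cons, length_tab, List.map_nil,
        length_nodeArray, List.map_replicate, List.length_nil, List.sum_append, List.sum_cons,
        List.sum_nil, List.sum_replicate, smul_zero]
      rw [add_mul]
      omega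
    · intro m o ρ ev ed hs v d hd hev hed
      have a0 := hs.left.array' 0 rfl
      rw [add_zero] at a0
      have e0 : Ev m ρ (.const 0) 0 := .const 0 (by positivity)
      have eflag := Ev.load_tab (f := fun _ => 0) a0 e0 (by norm_num) (by positivity)
      obtain ⟨ans, h1, h2⟩ := ev_walk hnw hw (hs.right (o' := o + 1) rfl).left hed (2 ^ W) v ev
        ((hw v).trans_le (Nat.pow_le_pow_right (by norm_num) hsmall.le)) hev
      exact ⟨ans, h1, .ifEq eflag e0 (fun _ => h2) fun h => (h rfl).elim⟩
  · obtain ⟨hp, hδ⟩ := exists_params hlog hn (not_lt.1 hsmall)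
    rw [← hD] at hp
    set δ := (Nat.log 2 n + 1) / 8 with hδdef
    have hδB : δ + 1 ≤ (Nat.sqrt δ + 1) * (Nat.sqrt δ + 1) := Nat.lt_succ_sqrt δ
    choose arrs l1 l2 l3 using fun i => exists_marked_structure hp hδB hw
      {u | u ∈ marked ∧ T.markedDepth marked u / δ = i} (ncard_class_le (by omega) i)
    refine ⟨[tab w 1 fun _ => 1] ++ (walkArrays w T marked ++ ((List.range q).map arrs).flatten),
      ?_, ?_, ?_⟩
    · simp [walkArrays, List.length_flatten, Function.comp_def, l1]
      omega
    · rw [Memory.size_append, Memory.size_append]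
      have h1 : Memory.size ((List.range q).map arrs).flatten ≤ q * ((D * 16 + 17) * n) := by
        refine (Memory.size_flatten (c := (D * 16 + 17) * n) ?_).trans (by simp)
        simp only [List.mem_map, forall_exists_index, and_imp]
        rintro x i - rfl
        exact l2 i
      have h2 : Memory.size [tab w 1 fun _ => 1] = 1 := by simp [Memory.size]
      have h3 : (walkArrays w T marked).size = 3 * n + 1 := by
        simp [walkArrays, Memory.size]
        omega
      rw [h2, h3, add_mul, mul_assoc]
      omega
    · intro m o ρ ev ed hs v d hd hev hed
      have a0 := hs.left.array' 0 rfl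
      rw [add_zero] at a0
      have hs' := hs.right (o' := o + 1) rfl
      have a4 := hs'.left.array' 3 rfl
      have e0 : Ev m ρ (.const 0) 0 := .const 0 (by positivity)
      have eflag := Ev.load_tab (f := fun _ => 1) a0 e0 (by norm_num) (by omega)
      have en := Ev.load_tab (f := fun _ => n) a4 e0 (by norm_num) hnw
      obtain ⟨ans, h1, h2⟩ := ev_lastOf (T := T) (δ := δ) (d := d) (v := v) (marked := marked) en
        (q := q) (f := fun i => markedQuery (o + 5 + i * (15 + D * 14)) D ev ed) (fun i hi =>
          l3 i m _ ρ ev ed ((hs'.right (o' := o + 5) (by simp [walkArrays])).flatten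
            (A := 15 + D * 14) (i := i) (by simp [l1]) (by simp [hi])) v d hd hev hed)
      refine ⟨ans, ?_, .ifEq eflag e0 (fun h => by simp at h) fun _ => h2⟩
      -- The first `q` classes contain all marked nodes, because marked depths are at most `C * (16
      -- * δ) < q * δ`.
      convert h1 using 2
      ext u
      simp only [Set.mem_ofPred_eq, iff_self_and]
      intro _
      rw [Nat.div_lt_iff_lt_mul (by omega)]
      refine (hm u).trans_lt ?_
      calc C * (Nat.log 2 n + 1) ≤ C * (16 * δ) := Nat.mul_le_mul_left _ (by omega)
        _ < q * δ := by
          rw [hq, add_mul]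
          nlinarith

/-- The bound leaves the registers from `k` on free as working space for the compiled program. -/
theorem below_query {o k : ℕ} {ed : Expr} (hd : ed.Below k) :
    ∀ (s : ℕ) (eh : Expr), eh.Below k → (query o s eh ed).Below k := by
  intro s
  induction s with
  | zero => exact fun eh h => h
  | succ s ih =>
    intro eh h
    have := ih (.load (o + 3 + s * 7 + 6) (.op .sub (.op .add (.op .add eh (.op .mul (.op .sub
      (stage o (o + 3 + s * 7 + 1) eh (.load (o + 3 + s * 7 + 2) eh) (.op .mod (.op .shr ed (.load o
      (.const (s + 2)))) (.load o (.const 0)))) (.const 1)) (.load o (.const 1)))) (stage o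
      (o + 3 + s * 7) (.op .add eh (.op .mul (.op .sub (stage o (o + 3 + s * 7 + 1) eh
      (.load (o + 3 + s * 7 + 2) eh) (.op .mod (.op .shr ed (.load o (.const (s + 2))))
      (.load o (.const 0)))) (.const 1)) (.load o (.const 1)))) (.load (o + 3 + s * 7 + 3)
      (.op .add eh (.op .sub (stage o (o + 3 + s * 7 + 1) eh (.load (o + 3 + s * 7 + 2) eh)
      (.op .mod (.op .shr ed (.load o (.const (s + 2)))) (.load o (.const 0)))) (.const 1))))
      (.op .mod (.op .shr ed (.load o (.const (s + 2)))) (.load o (.const 0))))) (.const 1)))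
      (by simp [Expr.Below, stage, h, hd])
    simp [query, Expr.Below, stage, h, hd] at this ⊢
    exact this

theorem below_ancestorQuery (W q D o : ℕ) {k : ℕ} {ev ed : Expr} (hv : ev.Below k)
    (hd : ed.Below k) : (ancestorQuery W q D o ev ed).Below k := by
  have hmarked : ∀ o, (markedQuery o D ev ed).Below k := by
    intro o
    have h1 := below_query (o := o + 9) hd D (.load (o + 4) ev) hv
    have h2 := below_query (o := o + 9 + (3 + D * 7))
      (ed := .ifLt ed (.load (o + 7) ev) ed (.load (o + 7) ev))
      ⟨hd, hv, hd, hv⟩ D (.load (o + 6) ev) hv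
    simp [markedQuery, upperQuery, Expr.Below, hv, h1, h2]
  have hlast : ∀ q, (lastOf (.load (o + 4) (.const 0))
      (fun i => markedQuery (o + 5 + i * (15 + D * 14)) D ev ed) q).Below k := by
    intro q
    induction q with
    | zero => trivial
    | succ q ih => exact ⟨hmarked _, trivial, ih, hmarked _⟩
  have hwalk : ∀ (i : ℕ) (ev : Expr), ev.Below k → (walk (o + 1) i ev ed).Below k := by
    intro i
    induction i with
    | zero => exact fun _ _ => trivial
    | succ i ih =>
      intro ev h
      have := ih (.load (o + 1 + 2) ev) h
      simp [walk, Expr.Below, h, hd, this]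
  exact ⟨trivial, trivial, hwalk _ ev hv, hlast q⟩

end WeightedTree

/-! ## Running a program on one of many packed memories -/

namespace WordRAM

/-- The test uses only registers below `R`. -/
def Test.Bounded (R : ℕ) : Test → Prop
  | .eq a b => a < R ∧ b < R
  | .lt a b => a < R ∧ b < R

theorem Test.Bounded.mono {R R' : ℕ} (hR : R ≤ R') {b : Test} (h : b.Bounded R) : b.Bounded R' := by
  cases b <;> exact ⟨h.1.trans_le hR, h.2.trans_le hR⟩

theorem Test.exists_bounded (b : Test) : ∃ K, b.Bounded K := by
  cases b with
  | eq x y => exact ⟨x + y + 1, by omega, by omega⟩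
  | lt x y => exact ⟨x + y + 1, by omega, by omega⟩

/-- The program uses only registers below `R` and arrays below `S`. -/
def Prog.Bounded (R S : ℕ) : Prog → Prop
  | .skip => True
  | .const r _ => r < R
  | .copy r a => r < R ∧ a < R
  | .op _ r a b => r < R ∧ a < R ∧ b < R
  | .load r seg a => r < R ∧ seg < S ∧ a < R
  | .store seg a r => seg < S ∧ a < R ∧ r < R
  | .seq p q => p.Bounded R S ∧ q.Bounded R S
  | .ite b p q => b.Bounded R ∧ p.Bounded R S ∧ q.Bounded R S
  | .loop b p => b.Bounded R ∧ p.Bounded R S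

theorem Prog.Bounded.mono {R S R' S' : ℕ} (hR : R ≤ R') (hS : S ≤ S') {p : Prog}
    (h : p.Bounded R S) : p.Bounded R' S' := by
  induction p with
  | skip => trivial
  | const => exact lt_of_lt_of_le h hR
  | copy => exact ⟨h.1.trans_le hR, h.2.trans_le hR⟩
  | op => exact ⟨h.1.trans_le hR, h.2.1.trans_le hR, h.2.2.trans_le hR⟩
  | load => exact ⟨h.1.trans_le hR, h.2.1.trans_le hS, h.2.2.trans_le hR⟩
  | store => exact ⟨h.1.trans_le hS, h.2.1.trans_le hR, h.2.2.trans_le hR⟩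
  | seq p q ihp ihq => exact ⟨ihp h.1, ihq h.2⟩
  | ite b p q ihp ihq => exact ⟨h.1.mono hR, ihp h.2.1, ihq h.2.2⟩
  | loop b p ihp => exact ⟨h.1.mono hR, ihp h.2⟩

theorem Prog.exists_bounded (p : Prog) : ∃ K, p.Bounded K K := by
  induction p with
  | skip => exact ⟨0, trivial⟩
  | const r => exact ⟨r + 1, Nat.lt_succ_self r⟩
  | copy r a => exact ⟨r + a + 1, by simp only [Prog.Bounded]; omega⟩
  | op o r a b => exact ⟨r + a + b + 1, by simp only [Prog.Bounded]; omega⟩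
  | load r s a => exact ⟨r + s + a + 1, by simp only [Prog.Bounded]; omega⟩
  | store s a r => exact ⟨r + s + a + 1, by simp only [Prog.Bounded]; omega⟩
  | seq p q ihp ihq =>
    obtain ⟨K, hK⟩ := ihp
    obtain ⟨K', hK'⟩ := ihq
    exact ⟨K + K', hK.mono (by omega) (by omega), hK'.mono (by omega) (by omega)⟩
  | ite b p q ihp ihq =>
    obtain ⟨K, hK⟩ := ihp
    obtain ⟨K', hK'⟩ := ihq
    obtain ⟨L, hL⟩ := b.exists_bounded
    exact ⟨K + K' + L, hL.mono (by omega), hK.mono (by omega) (by omega),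
      hK'.mono (by omega) (by omega)⟩
  | loop b p ihp =>
    obtain ⟨K, hK⟩ := ihp
    obtain ⟨L, hL⟩ := b.exists_bounded
    exact ⟨K + L, hL.mono (by omega), hK.mono (by omega) (by omega)⟩

/-- Access to a cell of an array that is cut into `k` pieces: register `R` holds the length of a
piece, register `R + 1` the position of the pieces in the arrays `a, a + 1, …`, and register `R + 2`
the index of the cell. -/
def bank (R : ℕ) (access : ℕ → Prog) (a : ℕ) : ℕ → Prog
  | 0 => .skip
  | k + 1 => .ite (.lt (R + 2) R) (.seq (.op .add (R + 2) (R + 2) (R + 1)) (access a))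
      (.seq (.op .sub (R + 2) (R + 2) R) (bank R access (a + 1) k))

/-- Array names cannot be computed, so the piece `x / len` is found by at most `k` rounds of testing
and subtracting, two steps each. What remains of `x` is `x % len`, and adding the block position
stays within a word because only `b + len`, not `b + k * len`, has to fit. -/
theorem bank_exec {w : ℕ} (R : ℕ) (access : ℕ → Prog) {len b : ℕ} (hb : b + len < 2 ^ w) (k : ℕ) :
    ∀ (a x : ℕ) (s : State w), x < k * len → (s.regs R).toNat = len →
      (s.regs (R + 1)).toNat = b → (s.regs (R + 2)).toNat = x →
      ∃ s₁ : State w, s₁.mem = s.mem ∧ (∀ r, r ≠ R + 2 → s₁.regs r = s.regs r) ∧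
        (s₁.regs (R + 2)).toNat = b + x % len ∧
        ∀ s₂ t, Exec (access (a + x / len)) s₁ s₂ t →
          ∃ t', t' ≤ t + 2 * k ∧ Exec (bank R access a k) s s₂ t' := by
  induction k with
  | zero => intro a x s hx; omega
  | succ k ih =>
    intro a x s hx h0 h1 h2
    have hlen : 0 < len := by
      rcases Nat.eq_zero_or_pos len with rfl | h
      · simp at hx
      · exact h
    by_cases hlt : x < len
    · refine ⟨s.setReg (R + 2) (s.regs (R + 2) + s.regs (R + 1)), rfl,
        fun r hr => by simp [State.setReg, hr], ?_, ?_⟩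
      · simp only [State.setReg, Function.update_self, BitVec.toNat_add, h1, h2,
          Nat.mod_eq_of_lt hlt]
        rw [Nat.mod_eq_of_lt (by omega), add_comm]
      · intro s₂ t he
        rw [Nat.div_eq_of_lt hlt, add_zero] at he
        refine ⟨_, ?_, .ite_true _ _ _ _ _ _ ?_ (.seq _ _ _ _ _ _ _ (.op _ _ _ _ _) he)⟩
        · omega
        · simpa [Test.holds, BitVec.lt_def, h0, h2] using hlt
    · have hsub : (s.regs (R + 2) - s.regs R).toNat = x - len := by
        rw [BitVec.toNat_sub_of_le (by rw [BitVec.le_def]; omega), h0, h2]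
      obtain ⟨s₁, q1, q2, q3, q4⟩ := ih (a + 1) (x - len)
        (s.setReg (R + 2) (s.regs (R + 2) - s.regs R)) (by rw [Nat.succ_mul] at hx; omega)
        (by simpa [State.setReg] using h0) (by simpa [State.setReg] using h1)
        (by simpa [State.setReg] using hsub)
      have e1 : x % len = (x - len) % len := Nat.mod_eq_sub_mod (not_lt.1 hlt)
      have e2 : x / len = (x - len) / len + 1 := Nat.div_eq_sub_div hlen (not_lt.1 hlt)
      refine ⟨s₁, q1, fun r hr => ?_, by rw [q3, e1], fun s₂ t he => ?_⟩
      · rw [q2 r hr]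
        simp [State.setReg, hr]
      · rw [e2, show a + ((x - len) / len + 1) = a + 1 + (x - len) / len by ring] at he
        obtain ⟨t', ht', he'⟩ := q4 s₂ t he
        refine ⟨_, ?_, .ite_false _ _ _ _ _ _ ?_ (.seq _ _ _ _ _ _ _ (.op _ _ _ _ _) he')⟩
        · omega
        · simpa [Test.holds, BitVec.lt_def, h0, h2] using hlt

/-- The program that runs `p` on a memory whose arrays are cut into `k` pieces each. -/
def Prog.pack (R A k : ℕ) : Prog → Prog
  | .load r seg a => .seq (.copy (R + 2) a) (bank R (fun b => .load r b (R + 2)) (A + seg * k) k)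
  | .store seg a r => .seq (.copy (R + 2) a) (bank R (fun b => .store b (R + 2) r) (A + seg * k) k)
  | .seq p q => .seq (p.pack R A k) (q.pack R A k)
  | .ite b p q => .ite b (p.pack R A k) (q.pack R A k)
  | .loop b p => .loop b (p.pack R A k)
  | p => p

/-- The arrays of many memories, cut into `k` pieces each and packed into arrays of length `n`. -/
def packed {ι : Type*} {w : ℕ} (n S k : ℕ) (owner : ℕ → Option (ι × ℕ)) (len : ι → ℕ)
    (loc : ι → Memory w) : Memory w :=
  (List.range (S * k)).map fun q => (List.range n).map fun p =>
    match owner p with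
    | some (c, i) => ((loc c).array (q / k)).getD (q % k * len c + i) 0
    | none => 0

theorem map_range_set {α : Type*} (n i : ℕ) (f : ℕ → α) (x : α) :
    ((List.range n).map f).set i x = (List.range n).map (Function.update f i x) := by
  apply List.ext_getElem?
  intro j
  rw [List.getElem?_set]
  by_cases hij : i = j
  · subst hij
    by_cases hi : i < n <;> simp [hi]
  · by_cases hj : j < n <;> simp [hj, hij, Ne.symm hij]

section
variable {ι : Type*} [DecidableEq ι] {w n S k : ℕ} {owner : ℕ → Option (ι × ℕ)} {len : ι → ℕ}
  {base : ι → ℕ} {loc : ι → Memory w} {c : ι}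

theorem packed_array {seg x : ℕ} {y : BitVec w} {m : Memory w}
    (howner : ∀ i < len c, owner (base c + i) = some (c, i)) (hbase : base c + len c ≤ n)
    (hseg : seg < S) (hx : x < k * len c) (hy : (m.array seg)[x]? = some y) :
    ((packed n S k owner len (Function.update loc c m)).array
      (seg * k + x / len c))[base c + x % len c]? = some y := by
  have hlen : 0 < len c := Nat.pos_of_ne_zero fun h => by simp [h] at hx
  have hj : x / len c < k := (Nat.div_lt_iff_lt_mul hlen).2 hx
  have hk : 0 < k := (Nat.zero_le _).trans_lt hj
  have hi := Nat.mod_lt x hlen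
  have hq : seg * k + x / len c < S * k := Fusion.mul_add_lt hseg hj
  have e1 : (seg * k + x / len c) / k = seg := by
    rw [Nat.mul_comm, Nat.mul_add_div hk, Nat.div_eq_of_lt hj, add_zero]
  have e2 : (seg * k + x / len c) % k = x / len c := Nat.mul_add_mod_of_lt hj
  simp [packed, Memory.array, hq, show base c + x % len c < n by omega, howner _ hi, e1, e2,
    Nat.div_add_mod', List.getD_eq_getElem?_getD]
  simp [Memory.array, List.getD_eq_getElem?_getD] at hy
  simp [hy]

/-- Piece and offset determine `x`, and array and piece determine the packed array; blocks of
different owners are disjoint. So one write changes exactly one represented cell. The bound `hx'`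
matters: beyond the end of the original array the packed cell exists, but a write there would
represent nothing. -/
theorem packed_set {seg x : ℕ} {y : BitVec w} {m : Memory w}
    (howner : ∀ i < len c, owner (base c + i) = some (c, i))
    (howner' : ∀ p i, owner p = some (c, i) → i < len c ∧ p = base c + i)
    (hbase : base c + len c ≤ n)
    (hseg : seg < S) (hx : x < k * len c) (hx' : x < (m.array seg).length) :
    (packed n S k owner len (Function.update loc c m)).set (seg * k + x / len c)
      (((packed n S k owner len (Function.update loc c m)).array
        (seg * k + x / len c)).set (base c + x % len c) y) =
    packed n S k owner len (Function.update loc c (m.set seg ((m.array seg).set x y))) := by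
  have hlen : 0 < len c := Nat.pos_of_ne_zero fun h => by simp [h] at hx
  have hj : x / len c < k := (Nat.div_lt_iff_lt_mul hlen).2 hx
  have hk : 0 < k := (Nat.zero_le _).trans_lt hj
  have hi := Nat.mod_lt x hlen
  have hq : seg * k + x / len c < S * k := Fusion.mul_add_lt hseg hj
  have hsegm : seg < m.length := by
    by_contra h
    simp [Memory.array, List.getD_eq_getElem?_getD, List.getElem?_eq_none (not_lt.1 h)] at hx'
  have harr : ∀ s', Memory.array (m.set seg ((m.array seg).set x y)) s' =
      if s' = seg then (m.array seg).set x y else m.array s' := by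
    intro s'
    split_ifs with h
    · subst h
      simp [Memory.array, List.getD_eq_getElem?_getD, hsegm]
    · simp [Memory.array, List.getD_eq_getElem?_getD, Ne.symm h]
  have hget : ∀ q < S * k, (packed n S k owner len (Function.update loc c m)).array q =
      (List.range n).map fun p => match owner p with
        | some (c', i) => (((Function.update loc c m) c').array (q / k)).getD
            (q % k * len c' + i) 0
        | none => 0 := by
    intro q hq
    simp [packed, Memory.array, List.getD_eq_getElem?_getD, hq]
  rw [hget _ hq, map_range_set]
  conv_lhs => rw [packed]
  rw [map_range_set, packed]
  apply List.map_congr_left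
  intro q' hq'
  have hne : ∀ p c' i, owner p = some (c', i) → c' ≠ c → p ≠ base c + x % len c := by
    intro p c' i h1 h2 h3
    rw [h3, howner _ hi] at h1
    simp at h1
    exact h2 h1.1.symm
  -- The effect of the write, cell by cell: only array `seg`, piece `x / len c` and offset `x % len
  -- c` of the block of `c` change.
  have key : ∀ p, (match owner p with
      | some (c', i) => (((Function.update loc c (m.set seg ((m.array seg).set x y))) c').array
          (q' / k)).getD (q' % k * len c' + i) 0
      | none => 0) = if q' = seg * k + x / len c ∧ p = base c + x % len c then y else
      (match owner p with
      | some (c', i) => (((Function.update loc c m) c').array (q' / k)).getD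
          (q' % k * len c' + i) 0
      | none => 0) := by
    intro p
    rcases hp : owner p with _ | ⟨c', i⟩
    · have : p ≠ base c + x % len c := by
        rintro rfl
        rw [howner _ hi] at hp
        simp at hp
      simp [this]
    · by_cases hc : c' = c
      · subst hc
        obtain ⟨hil, rfl⟩ := howner' p i hp
        simp only [Function.update_self, harr]
        by_cases hs : q' / k = seg
        · rw [if_pos hs, hs, List.getD_eq_getElem?_getD, List.getElem?_set]
          by_cases hxi : x = q' % k * len c' + i
          · have e1 : x / len c' = q' % k := by
              rw [hxi, Nat.mul_comm, Nat.mul_add_div hlen, Nat.div_eq_of_lt hil, add_zero]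
            have e2 : x % len c' = i := by rw [hxi]; exact Nat.mul_add_mod_of_lt hil
            have e3 : q' = seg * k + x / len c' := by rw [e1, ← hs, Nat.div_add_mod']
            rw [if_pos hxi, if_pos hx', if_pos ⟨e3, by rw [e2]⟩]
            rfl
          · rw [if_neg hxi, if_neg]
            · rw [List.getD_eq_getElem?_getD]
            · rintro ⟨h1, h2⟩
              apply hxi
              have : q' % k = x / len c' := by rw [h1]; exact Nat.mul_add_mod_of_lt hj
              rw [this, show i = x % len c' by omega, Nat.div_add_mod']
        · rw [if_neg hs, if_neg]
          rintro ⟨h1, -⟩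
          apply hs
          rw [h1, Nat.mul_comm, Nat.mul_add_div hk, Nat.div_eq_of_lt hj, add_zero]
      · simp [hc, hne p c' i hp hc]
  by_cases hqq : q' = seg * k + x / len c
  · subst hqq
    rw [Function.update_self]
    apply List.map_congr_left
    intro p hp
    rw [key p]
    by_cases hpp : p = base c + x % len c
    · rw [hpp, Function.update_self, if_pos ⟨rfl, rfl⟩]
    · rw [Function.update_of_ne hpp, if_neg fun h => hpp h.2]
  · rw [Function.update_of_ne hqq]
    apply List.map_congr_left
    intro p hp
    rw [key p, if_neg fun h => hqq h.1]

/-- The state `st` of the packed machine represents the state `s` of the machine for `c`. -/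
structure Represents (R A n S k : ℕ) (owner : ℕ → Option (ι × ℕ)) (len base : ι → ℕ)
    (loc : ι → Memory w) (c : ι) (pre : Memory w) (st s : State w) : Prop where
  regs : ∀ r < R, st.regs r = s.regs r
  reg_len : (st.regs R).toNat = len c
  reg_base : (st.regs (R + 1)).toNat = base c
  mem : st.mem = pre ++ packed n S k owner len (Function.update loc c s.mem)
  length_le : ∀ seg, (s.mem.array seg).length ≤ k * len c

theorem Represents.setReg {R A : ℕ} {pre : Memory w} {st s : State w} {r : ℕ} (x : BitVec w)
    (h : Represents R A n S k owner len base loc c pre st s) (hr : r < R) :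
    Represents R A n S k owner len base loc c pre (st.setReg r x) (s.setReg r x) where
  regs r' hr' := by
    by_cases h' : r' = r
    · simp [State.setReg, h']
    · simpa [State.setReg, h'] using h.regs r' hr'
  reg_len := by simpa [State.setReg, hr.ne'] using h.reg_len
  reg_base := by simpa [State.setReg, show R + 1 ≠ r by omega] using h.reg_base
  mem := h.mem
  length_le := h.length_le

/-- Step by step simulation, by induction on the run. The factor `2 * k + 2` is the price of a
memory access: one copy, up to `k` rounds of two steps, and the access itself. Writes are simulated
too, since a search may use its structure as scratch space before restoring it. -/
theorem pack_exec {R A : ℕ} {pre : Memory w} (hpre : pre.length = A)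
    (howner : ∀ i < len c, owner (base c + i) = some (c, i))
    (howner' : ∀ p i, owner p = some (c, i) → i < len c ∧ p = base c + i)
    (hbase : base c + len c ≤ n) (hn : n < 2 ^ w) {p : Prog} {s s' : State w} {t : ℕ}
    (he : Exec p s s' t) : p.Bounded R S → ∀ st,
      Represents R A n S k owner len base loc c pre st s →
      ∃ st' t', Exec (p.pack R A k) st st' t' ∧ t' ≤ (2 * k + 2) * t ∧
        Represents R A n S k owner len base loc c pre st' s' := by
  have holds : ∀ {b : Test} {st s : State w}, Represents R A n S k owner len base loc c pre st s →
      b.Bounded R → (b.holds st ↔ b.holds s) := by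
    intro b st s h hb
    cases b <;> simp [Test.holds, h.regs _ hb.1, h.regs _ hb.2]
  have harr : ∀ q m, Memory.array (pre ++ packed n S k owner len (Function.update loc c m)) (A + q) =
      (packed n S k owner len (Function.update loc c m)).array q := by
    intro q m
    rw [Memory.array, Memory.array, List.getD_eq_getElem?_getD, List.getD_eq_getElem?_getD,
      List.getElem?_append_right (by omega), ← hpre, Nat.add_sub_cancel_left]
  induction he with
  | skip s => exact fun _ st h => ⟨st, 0, .skip st, by simp, h⟩
  | const s r x => exact fun hb st h => ⟨_, 1, .const st r x, by omega, h.setReg _ hb⟩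
  | copy s r a =>
    intro hb st h
    have := Exec.copy st r a
    rw [h.regs a hb.2] at this
    exact ⟨_, 1, this, by omega, h.setReg _ hb.1⟩
  | op s o r a b =>
    intro hb st h
    have := Exec.op st o r a b
    rw [h.regs a hb.2.1, h.regs b hb.2.2] at this
    exact ⟨_, 1, this, by omega, h.setReg _ hb.1⟩
  | load s r seg a x hx =>
    intro hb st h
    have hlt : (s.regs a).toNat < k * len c :=
      (List.getElem?_eq_some_iff.1 hx).1.trans_le (h.length_le seg)
    obtain ⟨s₁, q1, q2, q3, q4⟩ := bank_exec R (fun b => .load r b (R + 2)) (len := len c)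
      (b := base c) (hbase.trans_lt hn) k (A + seg * k) (s.regs a).toNat
      (st.setReg (R + 2) (st.regs a)) hlt (by simpa [State.setReg] using h.reg_len)
      (by simpa [State.setReg] using h.reg_base) (by simp [State.setReg, h.regs a hb.2.2])
    obtain ⟨t', ht', he⟩ := q4 _ _ (.load _ _ _ _ x (by
      rw [q1, q3]
      simp only [State.setReg, h.mem, add_assoc, harr]
      exact packed_array howner hbase hb.2.1 hlt hx))
    refine ⟨_, _, .seq _ _ _ _ _ _ _ (.copy _ _ _) he, by omega, ?_⟩
    refine Represents.setReg x (s := s) ⟨fun r' hr' => ?_, ?_, ?_, ?_, h.length_le⟩ hb.1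
    · rw [q2 r' (by omega)]
      simpa [State.setReg, show r' ≠ R + 2 by omega] using h.regs r' hr'
    · rw [q2 R (by omega)]
      simpa [State.setReg] using h.reg_len
    · rw [q2 (R + 1) (by omega)]
      simpa [State.setReg] using h.reg_base
    · rw [q1]
      exact h.mem
  | store s seg a r hx =>
    intro hb st h
    have hlt : (s.regs a).toNat < k * len c := hx.trans_le (h.length_le seg)
    have hlen : 0 < len c := Nat.pos_of_ne_zero fun h => by simp [h] at hlt
    have hj : (s.regs a).toNat / len c < k := (Nat.div_lt_iff_lt_mul hlen).2 hlt
    have hi := Nat.mod_lt (s.regs a).toNat hlen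
    have hq : seg * k + (s.regs a).toNat / len c < S * k := Fusion.mul_add_lt hb.1 hj
    obtain ⟨s₁, q1, q2, q3, q4⟩ := bank_exec R (fun b => .store b (R + 2) r) (len := len c)
      (b := base c) (hbase.trans_lt hn) k (A + seg * k) (s.regs a).toNat
      (st.setReg (R + 2) (st.regs a)) hlt (by simpa [State.setReg] using h.reg_len)
      (by simpa [State.setReg] using h.reg_base) (by simp [State.setReg, h.regs a hb.2.1])
    obtain ⟨t', ht', he⟩ := q4 _ _ (.store _ _ _ _ (by
      rw [q1, q3]
      simp only [State.setReg, h.mem, add_assoc, harr]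
      simp [packed, Memory.array, List.getD_eq_getElem?_getD, hq]
      omega))
    refine ⟨_, _, .seq _ _ _ _ _ _ _ (.copy _ _ _) he, by omega, ?_⟩
    have hregs : ∀ r' < R + 2, s₁.regs r' = st.regs r' := by
      intro r' hr'
      rw [q2 r' (by omega)]
      simp [State.setReg, show r' ≠ R + 2 by omega]
    refine ⟨fun r' hr' => ?_, ?_, ?_, ?_, ?_⟩
    · exact (hregs r' (by omega)).trans (h.regs r' hr')
    · exact (congrArg BitVec.toNat (hregs R (by omega))).trans h.reg_len
    · exact (congrArg BitVec.toNat (hregs (R + 1) (by omega))).trans h.reg_base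
    · simp only [State.setCell, q1, q3, hregs r (by have := hb.2.2; omega), h.regs r hb.2.2]
      simp only [State.setReg, h.mem, add_assoc, harr]
      rw [List.set_append_right _ _ (by rw [hpre]; exact Nat.le_add_right _ _), ← hpre, Nat.add_sub_cancel_left,
        packed_set howner howner' hbase hb.1 hlt hx]
    · intro seg'
      have hsegm : seg < s.mem.length := by
        by_contra h
        simp [Memory.array, List.getD_eq_getElem?_getD, List.getElem?_eq_none (not_lt.1 h)] at hx
      have := h.length_le seg'
      by_cases hs : seg' = seg
      · subst hs
        simpa [State.setCell, Memory.array, List.getD_eq_getElem?_getD, hsegm] using this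
      · simpa [State.setCell, Memory.array, List.getD_eq_getElem?_getD, List.getElem?_set,
          Ne.symm hs] using this
  | seq p q s s₁ s₂ t₁ t₂ h₁ h₂ ih₁ ih₂ =>
    intro hb st h
    obtain ⟨st₁, u₁, e₁, c₁, r₁⟩ := ih₁ hb.1 st h
    obtain ⟨st₂, u₂, e₂, c₂, r₂⟩ := ih₂ hb.2 st₁ r₁
    exact ⟨st₂, _, .seq _ _ _ _ _ _ _ e₁ e₂, by rw [mul_add]; omega, r₂⟩
  | ite_true b p q s s₁ t hb' h₁ ih =>
    intro hb st h
    obtain ⟨st₁, u₁, e₁, c₁, r₁⟩ := ih hb.2.1 st h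
    exact ⟨st₁, _, .ite_true _ _ _ _ _ _ ((holds h hb.1).2 hb') e₁, by rw [mul_add]; omega, r₁⟩
  | ite_false b p q s s₁ t hb' h₁ ih =>
    intro hb st h
    obtain ⟨st₁, u₁, e₁, c₁, r₁⟩ := ih hb.2.2 st h
    exact ⟨st₁, _, .ite_false _ _ _ _ _ _ (fun h' => hb' ((holds h hb.1).1 h')) e₁,
      by rw [mul_add]; omega, r₁⟩
  | loop_true b p s s₁ s₂ t₁ t₂ hb' h₁ h₂ ih₁ ih₂ =>
    intro hb st h
    obtain ⟨st₁, u₁, e₁, c₁, r₁⟩ := ih₁ hb.2 st h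
    obtain ⟨st₂, u₂, e₂, c₂, r₂⟩ := ih₂ hb st₁ r₁
    exact ⟨st₂, _, .loop_true _ _ _ _ _ _ _ ((holds h hb.1).2 hb') e₁ e₂,
      by rw [mul_add, mul_add]; omega, r₂⟩
  | loop_false b p s hb' =>
    intro hb st h
    exact ⟨st, 1, .loop_false _ _ _ (fun h' => hb' ((holds h hb.1).1 h')), by omega, h⟩

end

end WordRAM

/-! ## Path decomposition -/

namespace WeightedTree

variable {n : ℕ} (T : WeightedTree n)

/-- The tree in which the weight of a node is one more than the weight of its parent was. -/
def shifted : WeightedTree n where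
  root := T.root
  parent := T.parent
  parent_root := T.parent_root
  reaches_root := T.reaches_root
  weight v := if v = T.root then 0 else T.weight (T.parent v) + 1
  weight_parent_lt v hv := by
    rw [if_neg hv]
    split_ifs with h
    · omega
    · have := T.weight_parent_lt _ h
      omega

theorem shifted_weight_le (v : Fin n) : T.shifted.weight v ≤ T.weight v := by
  simp only [shifted]
  split_ifs with h
  · exact Nat.zero_le _
  · exact T.weight_parent_lt v h

/-- The size class of a node: the logarithm of the size of its subtree. -/
noncomputable def sizeClass (v : Fin n) : ℕ := Nat.log 2 (T.sub v).card

/-- The nodes where the size class changes on the way from the root. -/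
def heads : Set (Fin n) := {v | v = T.root ∨ T.sizeClass v ≠ T.sizeClass (T.parent v)}

open Classical in
/-- The nodes below `c` of the same size class. -/
noncomputable def path (c : Fin n) : Finset (Fin n) :=
  Finset.univ.filter fun u => c ∈ T.ancestors u ∧ T.sizeClass u = T.sizeClass c

variable {T} {a b c u v : Fin n}

theorem mem_path : u ∈ T.path c ↔ c ∈ T.ancestors u ∧ T.sizeClass u = T.sizeClass c := by
  simp [path]

theorem self_mem_path (c : Fin n) : c ∈ T.path c := mem_path.2 ⟨T.mem_ancestors_self c, rfl⟩

theorem sizeClass_le (h : a ∈ T.ancestors b) : T.sizeClass b ≤ T.sizeClass a :=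
  Nat.log_mono_right (card_sub_le h)

/-- Two incomparable nodes have disjoint subtrees. If both were of the class of `c`, with at least
`2 ^ T.sizeClass c` nodes each, the subtree of `c` would be too large for its class. -/
theorem path_total (ha : a ∈ T.path c) (hb : b ∈ T.path c) :
    a ∈ T.ancestors b ∨ b ∈ T.ancestors a := by
  by_contra! h
  rw [mem_path] at ha hb
  have hdis := disjoint_sub h.1 h.2
  have hle : (T.sub a).card + (T.sub b).card ≤ (T.sub c).card := by
    rw [← Finset.card_union_of_disjoint hdis]
    exact Finset.card_le_card (Finset.union_subset (sub_subset ha.1) (sub_subset hb.1))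
  have hpow : ∀ x, T.sizeClass x = T.sizeClass c → 2 ^ T.sizeClass c ≤ (T.sub x).card := by
    intro x hx
    rw [← hx]
    exact Nat.pow_log_le_self 2 (Finset.card_ne_zero_of_mem (mem_sub.2 (T.mem_ancestors_self x)))
  have h1 := hpow a ha.2
  have h2 := hpow b hb.2
  have h3 : (T.sub c).card < 2 ^ (T.sizeClass c + 1) := Nat.lt_pow_succ_log_self (by norm_num) _
  rw [pow_succ] at h3
  omega

/-- Size classes never grow on the way down, and at a head other than the root the class drops. This
makes the paths of different heads disjoint and bounds the number of heads above a node. -/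
theorem sizeClass_lt_of_heads (hb : b ∈ T.heads) (h : a ∈ T.ancestors b) (hne : a ≠ b) :
    T.sizeClass b < T.sizeClass a := by
  have hroot : b ≠ T.root := by
    rintro rfl
    exact hne (mem_ancestors_root h)
  have h1 : T.sizeClass b ≠ T.sizeClass (T.parent b) := hb.resolve_left hroot
  have h2 : T.sizeClass b ≤ T.sizeClass (T.parent b) := sizeClass_le ⟨1, rfl⟩
  have h3 := sizeClass_le (mem_ancestors_parent h hne)
  omega

theorem disjoint_path (ha : a ∈ T.heads) (hb : b ∈ T.heads) (hne : a ≠ b) :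
    Disjoint (T.path a) (T.path b) := by
  rw [Finset.disjoint_left]
  intro u hua hub
  rw [mem_path] at hua hub
  rcases ancestors_total hua.1 hub.1 with h | h
  · have := sizeClass_lt_of_heads hb h hne
    omega
  · have := sizeClass_lt_of_heads ha h hne.symm
    omega

open Classical in
theorem sum_card_path_le (T : WeightedTree n) :
    ∑ c ∈ Finset.univ.filter (· ∈ T.heads), (T.path c).card ≤ n := by
  rw [← Finset.card_biUnion]
  · exact (Finset.card_le_univ _).trans (by simp)
  · intro a ha b hb hab
    exact disjoint_path (by simpa using ha) (by simpa using hb) hab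

/-- Heads on one root path have distinct size classes, and these are among `0, …, Nat.log 2 n`. -/
theorem ncard_heads_le (v : Fin n) : (T.ancestors v ∩ T.heads).ncard ≤ Nat.log 2 n + 1 := by
  have hinj : Set.InjOn T.sizeClass (T.ancestors v ∩ T.heads) := by
    intro a ha b hb hab
    by_contra hne
    rcases ancestors_total ha.1 hb.1 with h | h
    · have := sizeClass_lt_of_heads hb.2 h hne
      omega
    · have := sizeClass_lt_of_heads ha.2 h (Ne.symm hne)
      omega
  rw [← hinj.ncard_image]
  have hsub : T.sizeClass '' (T.ancestors v ∩ T.heads) ⊆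
      (Finset.range (Nat.log 2 n + 1) : Finset ℕ) := by
    rintro _ ⟨u, -, rfl⟩
    simp only [Finset.coe_range, Set.mem_Iio, Nat.lt_succ_iff]
    exact Nat.log_mono_right ((Finset.card_le_univ _).trans (by simp))
  refine (Set.ncard_le_ncard hsub (Finset.finite_toSet _)).trans ?_
  rw [Set.ncard_coe_finset]
  simp

theorem isPredecessor_none_of_head {d : ℕ} (hcd : d < T.weight c) (hroot : c = T.root) :
    IsPredecessor (T.ancestors v) T.weight d none := by
  intro i hi
  have := weight_le (T.root_mem_ancestors i)
  rw [← hroot] at this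
  omega

/-- The shifted weight of `c` being at most `d + 1` says that its parent weighs at most `d`. As `c`
itself is too heavy, the answer is that parent. -/
theorem isPredecessor_parent_of_head {d : ℕ}
    (hc : IsPredecessor (T.ancestors v ∩ T.heads) T.shifted.weight (d + 1) (some c))
    (hcd : d < T.weight c) (hroot : c ≠ T.root) :
    IsPredecessor (T.ancestors v) T.weight d (some (T.parent c)) := by
  obtain ⟨⟨h1, -⟩, h2, -⟩ := hc
  simp only [shifted, if_neg hroot] at h2
  refine ⟨parent_mem_ancestors h1, by omega, fun j hj hjd => ?_⟩
  have hjc := mem_ancestors_of_weight_le hj h1 (by omega)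
  exact weight_le (mem_ancestors_parent hjc (by rintro rfl; omega))

/-- The search runs over the whole path of `c`, which may leave the root path of `v`. It leaves it
below the node `e`, which already weighs more than `d`, so nodes that are not ancestors of `v` are
never returned. -/
theorem isPredecessor_path_of_head {d : ℕ}
    (hc : IsPredecessor (T.ancestors v ∩ T.heads) T.shifted.weight (d + 1) (some c))
    (hvd : d < T.weight v)
    (hu : u ∈ T.path c) (hud : T.weight u ≤ d)
    (hmax : ∀ x ∈ T.path c, T.weight x ≤ d → T.weight x ≤ T.weight u) :
    IsPredecessor (T.ancestors v) T.weight d (some u) := by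
  obtain ⟨⟨h1, -⟩, -, h3⟩ := hc
  -- the lowest ancestor of `v` on the path
  obtain ⟨e, he, hemax⟩ := Finset.exists_max_image ((T.path c).filter fun x => v ∈ T.sub x) T.weight
    ⟨c, Finset.mem_filter.2 ⟨self_mem_path c, mem_sub.2 h1⟩⟩
  simp only [Finset.mem_filter, mem_sub] at he hemax
  have hce := (mem_path.1 he.1).1
  -- Otherwise the child of `e` towards `v` would be a head whose parent weighs at most `d`, with a
  -- larger shifted weight than `c`.
  have hed : d < T.weight e := by
    by_contra hed
    rw [not_lt] at hed
    have hev : e ≠ v := by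
      rintro rfl
      omega
    obtain ⟨b, hb, hbe, hbroot⟩ := exists_child he.2 hev
    have heb : e ∈ T.ancestors b := ⟨1, hbe⟩
    have hlt := T.weight_parent_lt b hbroot
    rw [hbe] at hlt
    have hcb := mem_ancestors_trans hce heb
    have hbhead : b ∈ T.heads := by
      refine .inr fun hcl => ?_
      rw [hbe] at hcl
      have := hemax b ⟨mem_path.2 ⟨hcb, hcl.trans (mem_path.1 he.1).2⟩, hb⟩
      omega
    have hwb : T.shifted.weight b = T.weight e + 1 := by simp [shifted, hbroot, hbe]
    have := h3 b ⟨hb, hbhead⟩ (by omega)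
    have h4 := T.shifted_weight_le c
    have h5 := weight_le hce
    omega
  have huv : u ∈ T.ancestors v := by
    rcases path_total hu he.1 with h | h
    · exact mem_ancestors_trans h he.2
    · have := weight_le h
      omega
  refine ⟨huv, hud, fun j hj hjd => ?_⟩
  rcases ancestors_total h1 hj with h | h
  · refine hmax j (mem_path.2 ⟨h, le_antisymm (sizeClass_le h) ?_⟩) hjd
    rw [← (mem_path.1 he.1).2]
    exact sizeClass_le (mem_ancestors_of_weight_le hj he.2 (by omega))
  · exact (weight_le h).trans (weight_le (mem_path.1 hu).1)

end WeightedTree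

/-! ## The theorem -/

namespace WordRAM

theorem Memory.length_array_le {w : ℕ} (m : Memory w) (seg : ℕ) :
    (m.array seg).length ≤ m.size := by
  by_cases h : seg < m.length
  · simp only [Memory.array, List.getD_eq_getElem?_getD, h, List.getElem?_eq_getElem,
      Option.getD_some, Memory.size]
    exact List.single_le_sum (by simp) _ (List.mem_map_of_mem (List.getElem_mem h))
  · simp [Memory.array, List.getD_eq_getElem?_getD, List.getElem?_eq_none (not_lt.1 h)]

theorem size_packed {ι : Type*} {w : ℕ} (n S k : ℕ) (owner : ℕ → Option (ι × ℕ)) (len : ι → ℕ)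
    (loc : ι → Memory w) : Memory.size (packed n S k owner len loc) = S * k * n := by
  simp [packed, Memory.size, Function.comp_def]

/-- Sets the registers `1, …, r` to `0`. -/
def clear : ℕ → Prog
  | 0 => .skip
  | r + 1 => .seq (clear r) (.const (r + 1) 0)

theorem clear_runs {w : ℕ} (r : ℕ) (s : State w) : Runs (clear r) s r fun s' =>
    s'.mem = s.mem ∧ ∀ i, s'.regs i = if 1 ≤ i ∧ i ≤ r then 0 else s.regs i := by
  induction r with
  | zero =>
    exact ⟨s, 0, .skip s, le_rfl, rfl, fun i => by rw [if_neg (by omega)]⟩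
  | succ r ih =>
    refine ih.seq (t₂ := 1) fun s' hs' => ⟨_, _, .const _ _ _, le_rfl, hs'.1, fun i => ?_⟩
    by_cases h : i = r + 1
    · subst h
      simp [State.setReg]
    · rw [State.setReg]
      simp only [Function.update_of_ne h, hs'.2 i]
      congr 1
      simp only [eq_iff_iff]
      omega

end WordRAM

/-! ### Assembly of the two data structures -/

open WeightedTree

/-- Every node lies above a leaf, so the bound for leaves holds for all nodes, and the compiled
query expression of `exists_ancestor_structure` can be used. -/
theorem marked_ancestor_search (κ C : ℕ) : ∃ (c : ℕ) (query : Prog),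
    ∀ (n w : ℕ) (T : WeightedTree n) (marked : Set (Fin n)),
      LogWordSize κ n w → (∀ v, T.weight v < 2 ^ w) →
      (∀ v, T.IsLeaf v → (T.ancestors v ∩ marked).ncard ≤ C * (Nat.log 2 n + 1)) →
      ∃ mem : Memory w, mem.size ≤ c * n ∧
        ∀ (v : Fin n) (d : BitVec w),
          ∃ ans : Option (Fin n), IsPredecessor (T.ancestors v ∩ marked) T.weight d.toNat ans ∧
            Answers query mem [BitVec.ofNat w v, d] c (encodeAnswer ans) := by
  obtain ⟨A, c, W, q, D, H⟩ := exists_ancestor_structure κ C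
  obtain ⟨e, he⟩ : ∃ e, ancestorQuery W q D 0 (.var 0) (.var 1) = e := ⟨_, rfl⟩
  have hbelow : e.Below 2 :=
    he ▸ below_ancestorQuery W q D 0 (by simp [Expr.Below]) (by simp [Expr.Below])
  refine ⟨c + e.cost + 1, .seq (e.compile 2) (.copy 0 2), fun n w T marked hlog hw hm => ?_⟩
  obtain ⟨mem, -, hsize, hq⟩ := H n w T marked hlog hw fun v => by
    obtain ⟨l, hl, hvl⟩ := T.exists_leaf v
    have hsub : T.ancestors v ∩ marked ⊆ T.ancestors l ∩ marked :=
      fun u hu => ⟨mem_ancestors_trans hu.1 hvl, hu.2⟩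
    exact (Set.ncard_le_ncard hsub (Set.toFinite _)).trans (hm l hl)
  refine ⟨mem, hsize.trans (Nat.mul_le_mul_right _ (by omega)), fun v d => ?_⟩
  obtain ⟨ans, h1, h2⟩ := hq mem 0 (fun r => if r = 0 then v else d.toNat) (.var 0) (.var 1)
    (Slice.refl mem) v d.toNat d.isLt (.var 0) (.var 1)
  rw [he] at h2
  refine ⟨ans, h1, ?_⟩
  have hv : (v : ℕ) < 2 ^ w := v.2.trans hlog.1
  have hrun := h2.runs hbelow 2 (queryState mem [BitVec.ofNat w v, d]) le_rfl rfl (by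
    intro r hr
    interval_cases r
    · simp [queryState, Nat.mod_eq_of_lt hv]
    · simp [queryState])
  obtain ⟨s, k, g1, g2, g3, g4⟩ := hrun.seq (t₂ := 1)
    (R := fun s => (s.regs 0).toNat = encodeAnswer ans ∧ s.mem = mem) fun s' hs' =>
    ⟨_, _, .copy s' 0 2, le_rfl, by simpa [State.setReg] using hs'.2.1, hs'.1⟩
  exact ⟨s, k, g1, by omega, g3, g4⟩

/-- The node to which the search leads: the lowest head whose parent is light enough. -/
def headQuery (W q D : ℕ) : Expr :=
  ancestorQuery W q D 0 (.var 0) (.op .add (.var 1) (.const 1))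

/-- The keys on a path. -/
noncomputable def WeightedTree.pathKeys {n : ℕ} (T : WeightedTree n) (c : Fin n) : Finset ℕ :=
  (T.path c).image T.weight

theorem WeightedTree.exists_pathNode {n : ℕ} (T : WeightedTree n) (c : Fin n) (i : ℕ) :
    ∃ u, i < (T.pathKeys c).card → u ∈ T.path c ∧ T.weight u = Fusion.enum (T.pathKeys c) i := by
  by_cases h : i < (T.pathKeys c).card
  · obtain ⟨u, hu⟩ := Finset.mem_image.1 (Fusion.enum_mem h)
    exact ⟨u, fun _ => hu⟩
  · exact ⟨c, fun h' => (h h').elim⟩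

theorem WeightedTree.pathKeys_card_pos {n : ℕ} (T : WeightedTree n) (c : Fin n) :
    0 < (T.pathKeys c).card :=
  Finset.card_pos.2 ⟨T.weight c, Finset.mem_image_of_mem _ (self_mem_path c)⟩

/-- With the search key in register `1` and the length and the position of a path in registers
`R` and `R + 1`, the search on this path; the array `o` lists the nodes of the paths. -/
def pathSearch (o R k : ℕ) (search : Prog) : Prog :=
  .seq (.copy 0 1) <| .seq (clear (R - 1)) <| .seq (search.pack R (o + 1) k) <|
  .seq (.op .add 0 0 (R + 1)) (.load 0 o 0)

/-- Clearing the registers recreates the initial state that the given search expects. Length and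
position of the path sit in registers that the search cannot touch. The rank it returns is an offset
in the block of the path, where the node is looked up. -/
theorem pathSearch_runs {ι : Type*} [DecidableEq ι] {w n k K o : ℕ}
    {owner : ℕ → Option (ι × ℕ)} {len base : ι → ℕ} {loc : ι → Memory w} {c : ι}
    {pre : Memory w} (hpre : pre.length = o + 1)
    (howner : ∀ i < len c, owner (base c + i) = some (c, i))
    (howner' : ∀ p i, owner p = some (c, i) → i < len c ∧ p = base c + i)
    (hbase : base c + len c ≤ n) (hn : n < 2 ^ w) {search : Prog} (hb : search.Bounded K K)
    (hsize : (loc c).size ≤ k * len c) {d : BitVec w} {t i : ℕ}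
    (hans : Answers search (loc c) [d] t i) (hi : i < len c) {y : BitVec w}
    (hy : (pre.array o)[base c + i]? = some y) (s : State w)
    (hm : s.mem = pre ++ packed n K k owner len loc) (h1 : s.regs 1 = d)
    (hR : (s.regs (K + 2)).toNat = len c) (hR1 : (s.regs (K + 3)).toNat = base c) :
    Runs (pathSearch o (K + 2) k search) s (1 + (K + 1 + ((2 * k + 2) * t + 2)))
      fun s' => s'.regs 0 = y ∧ s'.mem = s.mem := by
  refine Runs.seq (Q := fun s' => s' = s.setReg 0 d) ⟨_, _, .copy _ _ _, le_rfl, by rw [h1]⟩ ?_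
  rintro _ rfl
  refine (clear_runs (K + 1) _).seq fun s₁ hs₁ => ?_
  obtain ⟨s₂, t₂, e₂, ht, hout, hmem⟩ := hans
  obtain ⟨st, t', e', ht', hrep⟩ := pack_exec (R := K + 2) (loc := loc) hpre howner howner' hbase hn e₂
    (hb.mono (by omega) le_rfl) s₁ {
      regs := fun r hr => by
        rw [hs₁.2 r]
        by_cases h0 : r = 0
        · subst h0
          simp [State.setReg, queryState]
        · rw [if_pos (by omega)]
          obtain ⟨r, rfl⟩ := Nat.exists_eq_succ_of_ne_zero h0
          simp [queryState]
      reg_len := by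
        rw [hs₁.2, if_neg (by omega)]
        simpa [State.setReg] using hR
      reg_base := by
        rw [hs₁.2, if_neg (by omega)]
        simpa [State.setReg] using hR1
      mem := by
        rw [hs₁.1]
        simpa [State.setReg, queryState, Function.update_eq_self] using hm
      length_le := fun seg => (Memory.length_array_le _ seg).trans hsize }
  refine Runs.seq (Q := fun s' => s' = st) ⟨st, t', e', ht'.trans (Nat.mul_le_mul_left _ ht), rfl⟩ ?_
  rintro s' rfl
  have hmem' : s'.mem = s.mem := by
    rw [hrep.mem, hmem, Function.update_eq_self, hm]
  have h0 : (s'.regs 0 + s'.regs (K + 3)).toNat = base c + i := by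
    rw [BitVec.toNat_add, hrep.regs 0 (by omega), hout, hrep.reg_base,
      Nat.mod_eq_of_lt (by omega), add_comm]
  refine ⟨_, _, .seq _ _ _ _ _ _ _ (.op s' .add 0 0 (K + 3)) (.load _ 0 o 0 y ?_), le_rfl,
    by simp [State.setReg], by simpa [State.setReg] using hmem'⟩
  have : (s'.mem.array o) = pre.array o := by
    rw [hmem', hm]
    simp [Memory.array, List.getD_eq_getElem?_getD, List.getElem?_append, hpre]
  simp only [State.setReg, Function.update_self, BinOp.eval, h0, this, hy]

/-- The search among all ancestors. The arrays from `A` on hold the weights, the parents, the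
lengths and positions of the paths, and the nodes of the paths. -/
def weightedAncestorProg (A W q D R k : ℕ) (search : Prog) : Prog :=
  .seq (Expr.compile (.ifLt (.var 1) (.load A (.var 0)) (.load (A + 1) (headQuery W q D)) (.var 0))
    (R + 3)) <|
  -- A flag: 0 means that the preceding value is already the answer, 1 that the path of the head
  -- must be searched.
  .seq (Expr.compile (.ifLt (.var 1) (.load A (.var 0))
    (.ifLt (.var 1) (.load A (headQuery W q D)) (.const 0) (.const 1)) (.const 0)) (R + 4)) <|
  .seq (.const (R + 5) 0) <|
  .ite (.eq (R + 4) (R + 5)) (.copy 0 (R + 3)) <|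
  .seq (Expr.compile (.load (A + 2) (headQuery W q D)) R) <|
  .seq (Expr.compile (.load (A + 3) (headQuery W q D)) (R + 1)) <|
  pathSearch (A + 4) R k search

theorem Runs.ite_true {w : ℕ} {b : Test} {p q : Prog} {s : State w} {t : ℕ} {Q : State w → Prop}
    (hb : b.holds s) (h : Runs p s t Q) : Runs (.ite b p q) s (t + 1) Q := by
  obtain ⟨s', k, h1, h2, h3⟩ := h
  exact ⟨s', _, .ite_true _ _ _ _ _ _ hb h1, by omega, h3⟩

theorem Runs.ite_false {w : ℕ} {b : Test} {p q : Prog} {s : State w} {t : ℕ} {Q : State w → Prop}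
    (hb : ¬ b.holds s) (h : Runs q s t Q) : Runs (.ite b p q) s (t + 1) Q := by
  obtain ⟨s', k, h1, h2, h3⟩ := h
  exact ⟨s', _, .ite_false _ _ _ _ _ _ hb h1, by omega, h3⟩

/-- The first part of `weightedAncestorProg`: either the answer is in a register, or the search on
the path of `c` follows. -/
theorem weightedAncestorProg_runs {w : ℕ} {mem : Memory w} {A W q D K k : ℕ} {search : Prog}
    {v d x f len base : ℕ} (hv : v < 2 ^ w) (hd : d < 2 ^ w) {t out : ℕ}
    (hx : Ev mem (fun r => if r = 0 then v else d)
      (.ifLt (.var 1) (.load A (.var 0)) (.load (A + 1) (headQuery W q D)) (.var 0)) x)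
    (hf : Ev mem (fun r => if r = 0 then v else d) (.ifLt (.var 1) (.load A (.var 0))
      (.ifLt (.var 1) (.load A (headQuery W q D)) (.const 0) (.const 1)) (.const 0)) f)
    (hout : f = 0 → x = out)
    (hlen : f ≠ 0 → Ev mem (fun r => if r = 0 then v else d) (.load (A + 2) (headQuery W q D)) len)
    (hbase : f ≠ 0 →
      Ev mem (fun r => if r = 0 then v else d) (.load (A + 3) (headQuery W q D)) base)
    (hsearch : f ≠ 0 → ∀ s : State w, s.mem = mem → s.regs 1 = BitVec.ofNat w d →
      (s.regs (K + 2)).toNat = len → (s.regs (K + 3)).toNat = base →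
      Runs (pathSearch (A + 4) (K + 2) k search) s t
        fun s' => (s'.regs 0).toNat = out ∧ s'.mem = mem) :
    Answers (weightedAncestorProg A W q D (K + 2) k search) mem [BitVec.ofNat w v, BitVec.ofNat w d]
      (4 * (headQuery W q D).cost + 30 + t) out := by
  have hq : (headQuery W q D).Below 2 :=
    below_ancestorQuery W q D 0 (by simp [Expr.Below]) (by simp [Expr.Below])
  have hr : ∀ (s : State w), s.regs 0 = BitVec.ofNat w v → s.regs 1 = BitVec.ofNat w d →
      ∀ r < 2, (s.regs r).toNat = if r = 0 then v else d := by
    intro s h0 h1 r hr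
    interval_cases r
    · simp [h0, Nat.mod_eq_of_lt hv]
    · simp [h1, Nat.mod_eq_of_lt hd]
  suffices H : Runs (weightedAncestorProg A W q D (K + 2) k search)
      (queryState mem [BitVec.ofNat w v, BitVec.ofNat w d])
      (4 * (headQuery W q D).cost + 30 + t)
      (fun s' => (s'.regs 0).toNat = out ∧ s'.mem = mem) by
    obtain ⟨s, k, h1, h2, h3⟩ := H
    exact ⟨s, k, h1, h2, h3⟩
  refine Runs.mono (Runs.seq (hx.runs (b := 2) (by simp [Expr.Below, hq]) (K + 5) _ (by omega) rfl
    (hr _ rfl rfl)) (t₂ := 3 * (headQuery W q D).cost + 20 + t) ?_)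
    (by simp only [Expr.cost]; omega) fun _ h => h
  rintro s₁ ⟨m1, x1, r1⟩
  have r10 := r1 0 (by omega)
  have r11 := r1 1 (by omega)
  refine Runs.mono (Runs.seq (hf.runs (b := 2) (by simp [Expr.Below, hq]) (K + 6) s₁ (by omega) m1
    (hr _ r10 r11)) (t₂ := 2 * (headQuery W q D).cost + 5 + t) ?_)
    (by simp only [Expr.cost]; omega) fun _ h => h
  rintro s₂ ⟨m2, f2, r2⟩
  have r20 := (r2 0 (by omega)).trans r10
  have r21 := (r2 1 (by omega)).trans r11
  have x2 := (congrArg BitVec.toNat (r2 (K + 5) (by omega))).trans x1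
  have hconst : Runs (.const (K + 7) 0) s₂ 1 fun s' => s' = s₂.setReg (K + 7) (BitVec.ofNat w 0) :=
    ⟨_, _, .const _ _ _, le_rfl, rfl⟩
  refine Runs.mono (hconst.seq (t₂ := 2 * (headQuery W q D).cost + 3 + t + 1) ?_) (by omega)
    fun _ h => h
  intro s₃ hs₃
  have m3 : s₃.mem = mem := by rw [hs₃]; exact m2
  have r3 : ∀ r, r ≠ K + 7 → s₃.regs r = s₂.regs r := by
    intro r hr
    rw [hs₃]
    simp [State.setReg, hr]
  have htest : (Test.eq (K + 6) (K + 7)).holds s₃ ↔ f = 0 := by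
    rw [Test.holds, r3 (K + 6) (by omega), hs₃, BitVec.toNat_eq, f2]
    simp [State.setReg]
  by_cases h0 : f = 0
  · refine Runs.ite_true (htest.2 h0) ⟨_, _, .copy _ _ _, by omega, ?_, m3⟩
    simp [State.setReg, r3 (K + 5), x2, hout h0]
  · refine Runs.ite_false (fun h => h0 (htest.1 h)) ?_
    have r30 := (r3 0 (by omega)).trans r20
    have r31 := (r3 1 (by omega)).trans r21
    refine Runs.mono (Runs.seq ((hlen h0).runs (b := 2) (by simp [Expr.Below, hq]) (K + 2) s₃
      (by omega) m3 (hr _ r30 r31)) (t₂ := (headQuery W q D).cost + 1 + t) ?_)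
      (by simp only [Expr.cost]; omega) fun _ h => h
    rintro s₄ ⟨m4, l4, r4⟩
    have r40 := (r4 0 (by omega)).trans r30
    have r41 := (r4 1 (by omega)).trans r31
    refine Runs.seq ((hbase h0).runs (b := 2) (by simp [Expr.Below, hq]) (K + 3) s₄
      (by omega) m4 (hr _ r40 r41)) ?_
    rintro s₅ ⟨m5, b5, r5⟩
    exact hsearch h0 s₅ m5 ((r5 1 (by omega)).trans r41)
      ((congrArg BitVec.toNat (r5 (K + 2) (by omega))).trans l4) b5

/-- A query costs constant time plus one simulated search on one path. Paths are disjoint, so their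
linear space structures fit into `K * k` arrays of `n` words, and monotonicity replaces the length
of the path by `n` in the time bound. -/
theorem weighted_ancestor_search (κ : ℕ) (pred : ℕ → ℕ → ℕ) (hpos : ∀ m U, 1 ≤ pred m U)
    (hmono : ∀ U, Monotone fun m => pred m U) (h : LinearSpacePredecessor κ pred) :
    LinearSpaceWeightedAncestor κ pred := by
  classical
  obtain ⟨k, search, hsearch⟩ := h
  obtain ⟨A, cA, W, q, D, H⟩ := exists_ancestor_structure κ 1
  obtain ⟨K, hK⟩ := search.exists_bounded
  refine ⟨cA + 5 + K * k + 4 * (headQuery W q D).cost + 33 + K + (2 * k + 2) * k,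
    weightedAncestorProg A W q D (K + 2) k search, fun n w U T hlog hU hw => ?_⟩
  have hn := hlog.1
  have hw' : ∀ v, T.weight v < 2 ^ w := fun v => (hw v).trans_le hU
  obtain ⟨arrs, hA, hsize, hq⟩ := H n w T.shifted T.heads hlog
    (fun v => (T.shifted_weight_le v).trans_lt (hw' v))
    (fun v => by rw [one_mul]; exact ncard_heads_le v)
  have hcard : ∀ c, (T.pathKeys c).card ≤ (T.path c).card := fun c => Finset.card_image_le
  have hlenn : ∀ c, (T.pathKeys c).card ≤ n := fun c =>
    (hcard c).trans ((Finset.card_le_univ _).trans (by simp))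
  -- The size bound `N` is `n` for every path, so all structures are built for the word size of the
  -- whole tree, however short the path.
  choose loc hloc hans using fun c : Fin n => hsearch n w U (T.pathKeys c).card
    (fun i => Fusion.enum (T.pathKeys c) i) hlog hU (T.pathKeys_card_pos c) (hlenn c)
    (fun i j hij => Fusion.enum_lt_enum hij j.2)
    (fun i => by
      obtain ⟨u, -, hu⟩ := Finset.mem_image.1 (Fusion.enum_mem i.2)
      exact hu ▸ hw u)
  choose node hnode using fun c => T.exists_pathNode c
  obtain ⟨base, owner, ho1, ho2, ho3⟩ := exists_allocation (Finset.univ.filter (· ∈ T.heads))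
    (fun c => (T.pathKeys c).card) n
    ((Finset.sum_le_sum fun c _ => hcard c).trans T.sum_card_path_le)
  set len : Fin n → ℕ := fun c => (T.pathKeys c).card with hlen
  set five : Memory w := [nodeArray w T.weight,
    -- The entry `n` at the root encodes "no predecessor".
    nodeArray w fun v => if v = T.root then n else T.parent v, nodeArray w len, nodeArray w base,
    tab w n (blocks owner fun c i => node c i)] with hfive
  set pre : Memory w := arrs ++ five with hpre
  set mem : Memory w := pre ++ packed n K k owner len loc with hmem
  refine ⟨mem, ?_, fun v d => ?_⟩
  · have : Memory.size five = 5 * n := by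
      simp only [hfive, Memory.size, List.map_cons, length_nodeArray, length_tab, List.map_nil,
        List.sum_cons, List.sum_nil]
      ring
    rw [hmem, Memory.size_append, hpre, Memory.size_append, this, size_packed]
    refine (Nat.add_le_add_right (Nat.add_le_add_right hsize _) _).trans ?_
    rw [← add_mul, ← add_mul]
    exact Nat.mul_le_mul_right _ (by omega)
  have hs : Slice mem 0 pre := (Slice.refl mem).left
  have h5 : Slice mem A five := hs.right (by rw [hA, zero_add])
  have a0 : mem.array A = _ := h5.array' 0 rfl
  have a1 := h5.array' 1 rfl
  have a2 := h5.array' 2 rfl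
  have a3 := h5.array' 3 rfl
  have a4 : pre.array (A + 4) = tab w n (blocks owner fun c i => node c i) := by
    simp [hpre, hfive, Memory.array, List.getD_eq_getElem?_getD, hA]
  set ρ : ℕ → ℕ := fun r => if r = 0 then v else d.toNat with hρ
  have e0 : Ev mem ρ (.var 0) v := .var 0
  have e1 : Ev mem ρ (.var 1) d.toNat := .var 1
  have ewt : Ev mem ρ (.load A (.var 0)) (T.weight v) := ev_nodeArray T.weight a0 e0 (hw' v)
  have hd : d = BitVec.ofNat w d.toNat := by simp
  have hpred : 1 ≤ pred n U := hpos n U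
  by_cases hdv : d.toNat < T.weight v
  swap
  · refine ⟨some v, ⟨T.mem_ancestors_self v, not_lt.1 hdv, fun j hj _ => weight_le hj⟩, ?_⟩
    obtain ⟨s, t, r1, r2, r3⟩ := weightedAncestorProg_runs (K := K) (k := k) (search := search)
      (t := 0) (out := v) (len := 0) (base := 0) (v.2.trans hn) d.isLt
      (.ifLt e1 ewt (fun h => (hdv h).elim) fun _ => e0)
      (.ifLt e1 ewt (fun h => (hdv h).elim) fun _ => .const 0 (by positivity))
      (fun _ => rfl) (fun h => (h rfl).elim) (fun h => (h rfl).elim) (fun h => (h rfl).elim)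
    rw [← hd] at r1
    refine ⟨s, t, r1, r2.trans ?_, r3⟩
    refine le_trans ?_ (Nat.le_mul_of_pos_right _ hpred)
    omega
  -- Numbers `d` from the weight of `v` on have been dealt with; this also keeps `d + 1` within a
  -- word.
  have hd1 : d.toNat + 1 < 2 ^ w := by have := hw' v; omega
  obtain ⟨ans, hc, ec⟩ := hq mem 0 ρ (.var 0) (.op .add (.var 1) (.const 1)) hs.left v
    (d.toNat + 1) hd1 e0 (.add e1 (.const 1 (by omega)) hd1)
  obtain _ | c := ans
  -- The root is a head of shifted weight 0, so some head is always found.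
  · have := hc T.root ⟨T.root_mem_ancestors v, .inl rfl⟩
    simp [shifted] at this
  replace ec : Ev mem ρ (headQuery W q D) c := ec
  have ewc : Ev mem ρ (.load A (headQuery W q D)) (T.weight c) :=
    ev_nodeArray T.weight a0 ec (hw' c)
  have epar : Ev mem ρ (.load (A + 1) (headQuery W q D)) _ :=
    ev_nodeArray (fun v => if v = T.root then n else T.parent v) a1 ec (by
      split_ifs
      · exact hn
      · exact (T.parent c).2.trans hn)
  by_cases hdc : d.toNat < T.weight c
  · obtain ⟨ans, hans, hout⟩ : ∃ ans, IsPredecessor (T.ancestors v) T.weight d.toNat ans ∧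
        (if c = T.root then n else (T.parent c : ℕ)) = encodeAnswer ans := by
      by_cases hroot : c = T.root
      · exact ⟨none, isPredecessor_none_of_head hdc hroot, by simp [hroot, encodeAnswer]⟩
      · exact ⟨some (T.parent c), isPredecessor_parent_of_head hc hdc hroot,
          by simp [hroot, encodeAnswer]⟩
    refine ⟨ans, hans, ?_⟩
    obtain ⟨s, t, r1, r2, r3⟩ := weightedAncestorProg_runs (K := K) (k := k) (search := search)
      (t := 0) (out := encodeAnswer ans) (len := 0) (base := 0) (v.2.trans hn) d.isLt
      (.ifLt e1 ewt (fun _ => epar) fun h => (h hdv).elim)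
      (.ifLt e1 ewt (fun _ => .ifLt e1 ewc (fun _ => .const 0 (by positivity))
        fun h => (h hdc).elim) fun h => (h hdv).elim)
      (fun _ => hout) (fun h => (h rfl).elim) (fun h => (h rfl).elim) (fun h => (h rfl).elim)
    rw [← hd] at r1
    refine ⟨s, t, r1, r2.trans ?_, r3⟩
    refine le_trans ?_ (Nat.le_mul_of_pos_right _ hpred)
    omega
  rw [not_lt] at hdc
  have hchead : c ∈ Finset.univ.filter (· ∈ T.heads) := by simpa using hc.1.2
  obtain ⟨ans, hi, hrun⟩ := hans c d (hdv.trans (hw v))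
  have hcmem : T.weight c ∈ T.pathKeys c := Finset.mem_image_of_mem _ (self_mem_path c)
  obtain _ | i := ans
  -- The search on the path cannot fail, because `c` itself weighs at most `d`.
  · obtain ⟨j, hj, hjc⟩ := Fusion.exists_enum_eq hcmem
    have := hi ⟨j, hj⟩ (Set.mem_univ _)
    dsimp only at this
    omega
  obtain ⟨hu, hui⟩ := hnode c i i.2
  obtain ⟨-, hid, himax⟩ := hi
  dsimp only at hid himax
  refine ⟨some (node c i), isPredecessor_path_of_head hc hdv hu (by rwa [hui])
    (fun x hx hxd => ?_), ?_⟩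
  · obtain ⟨j, hj, hjx⟩ := Fusion.exists_enum_eq (Finset.mem_image_of_mem T.weight hx)
    rw [← hjx, hui]
    exact himax ⟨j, hj⟩ (Set.mem_univ _) (by rwa [← hjx] at hxd)
  have hb := ho3 c hchead
  have hiown := ho1 c hchead i i.2
  have hpos' := T.pathKeys_card_pos c
  obtain ⟨s, t, r1, r2, r3⟩ := weightedAncestorProg_runs (K := K) (k := k) (search := search)
    (t := 1 + (K + 1 + ((2 * k + 2) * (k * pred (len c) U) + 2))) (out := node c i)
    (len := len c) (base := base c) (v.2.trans hn) d.isLt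
    (.ifLt e1 ewt (fun _ => epar) fun h => (h hdv).elim)
    (.ifLt e1 ewt (fun _ => .ifLt e1 ewc (fun h => (hdc.not_gt h).elim)
      fun _ => .const 1 (by omega)) fun h => (h hdv).elim)
    (fun h => by simp at h)
    (fun _ => ev_nodeArray len a2 ec ((hlenn c).trans_lt hn))
    (fun _ => ev_nodeArray base a3 ec (by omega))
    (fun _ s hm h1 hR hR1 => by
      refine (pathSearch_runs (c := c) (K := K) (y := BitVec.ofNat w (node c i))
        (by simp [hpre, hfive, hA]) (ho1 c hchead) (fun p i hp => (ho2 p c i hp).2) hb hn hK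
        (hloc c) hrun i.2 ?_ s hm (h1.trans hd.symm) hR hR1).mono le_rfl fun s' hs' =>
          ⟨?_, hs'.2.trans hm⟩
      · rw [a4]
        have hin : base c + i < n := by have := i.2; omega
        simp [tab, encodeAnswer, hin, blocks_eq hiown]
      · rw [hs'.1]
        simp [Nat.mod_eq_of_lt ((node c i).2.trans hn)])
  rw [← hd] at r1
  refine ⟨s, t, r1, r2.trans ?_, r3⟩
  have hp : pred (len c) U ≤ pred n U := hmono U (hlenn c)
  calc _ ≤ (4 * (headQuery W q D).cost + 34 + K) * 1 + (2 * k + 2) * k * pred (len c) U := by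
        rw [← mul_assoc]
        omega
    _ ≤ (4 * (headQuery W q D).cost + 34 + K) * pred n U + (2 * k + 2) * k * pred n U :=
        Nat.add_le_add (Nat.mul_le_mul_left _ hpred) (Nat.mul_le_mul_left _ hp)
    _ ≤ _ := by
        rw [← add_mul]
        exact Nat.mul_le_mul_right _ (by omega)

open WordRAM in
theorem mainTheorem2 (κ : ℕ) :
    (∀ C : ℕ, ∃ (c : ℕ) (query : Prog), ∀ (n w : ℕ) (T : WeightedTree n) (marked : Set (Fin n)),
      LogWordSize κ n w → (∀ v, T.weight v < 2 ^ w) →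
      (∀ v, T.IsLeaf v → (T.ancestors v ∩ marked).ncard ≤ C * (Nat.log 2 n + 1)) →
      ∃ mem : Memory w, mem.size ≤ c * n ∧
        ∀ (v : Fin n) (d : BitVec w),
          ∃ ans : Option (Fin n), IsPredecessor (T.ancestors v ∩ marked) T.weight d.toNat ans ∧
            Answers query mem [BitVec.ofNat w v, d] c (encodeAnswer ans)) ∧
    (∀ pred : ℕ → ℕ → ℕ, (∀ m U, 1 ≤ pred m U) → (∀ U, Monotone fun m => pred m U) →
      LinearSpacePredecessor κ pred → LinearSpaceWeightedAncestor κ pred) :=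
  ⟨marked_ancestor_search κ, weighted_ancestor_search κ⟩
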